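/- **Setting.** Let $\mathfrak w\in\mathbb R^2\setminus\{0\}$, $N\in\mathbb N$, $N\ge 1$, $\lambda>0$. For $n\ge 0$ let $\Gamma L^2_n$ be the space of symmetric square-integrable functions on $(\mathbb T^2)^n$ ($\mathbb T^2$ the torus of side length $2\pi$) with mean zero in every variable, with the inner product $\langle\varphi,\psi\rangle=n!\,\langle\varphi,\psi\rangle_{L^2((\mathbb T^2)^n)}$. Such a $\varphi$ is described by its Fourier coefficients $\widehat\varphi(k_{1:n})$, $k_{1:n}=(k_1,\dots,k_n)\in(\mathbb Z^2)^n$, with respect to the orthonormal basis $(2\pi)^{-n}e^{i(k_1\cdot x_1+\dots+k_n\cdot x_n)}$; they are symmetric and vanish if some $k_i=0$. On $\Gamma L^2_n$ let $\mathcal N\varphi=n\varphi$, $$\widehat{\mathcal L_0\varphi}(k_{1:n})=-\tfrac12\sum_{i=1}^n|k_i|^2\,\widehat\varphi(k_{1:n}),\qquad \widehat{\mathcal L_0^{\mathfrak w}\varphi}(k_{1:n})=-\tfrac12\sum_{i=1}^n(\mathfrak w\cdot k_i)^2\,\widehat\varphi(k_{1:n}),$$ and let $\mathcal A_+:\Gamma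 L^2_n\to\Gamma L^2_{n+1}$ be given by $$\widehat{\mathcal A_+\varphi}(k_{1:n+1})=-\frac{i}{\pi(n+1)}\sum_{1\le a<b\le n+1}\mathbb J^N_{k_a,k_b}\,[\mathfrak w\cdot(k_a+k_b)]\,\widehat\varphi\big(k_a+k_b,k_{\{1:n+1\}\setminus\{a,b\}}\big),$$ where $\mathbb J^N_{\ell,m}=1$ if $|\ell|,|m|,|\ell+m|\in(0,N]$ and $\mathbb J^N_{\ell,m}=0$ otherwise. Set $$\mathcal H_2=0,\qquad \mathcal H_k=(\mathcal A_+)^*(\lambda-\mathcal L_0+\mathcal H_{k-1})^{-1}\mathcal A_+\quad(k\ge 3);$$ these are bounded positive operators on each $\Gamma L^2_n$. For $\delta\in(0,1)$ and $K>0$ put $\theta_2=0$, $\theta_{k+1}=1-\theta_k/2$ for $k\ge 2$ (so that $\theta_k\to\frac23$), $$\mathrm L^N_k(x,z)=\Big(\log\Big(1+\frac{N^2}{x}\Big)+z\Big)^{\theta_k},\qquad z_k(n)=K(n+k)^{\frac92+\frac32\delta},\qquad f_k(n)=3\,z_k(n)^{2/3},$$ $$\mathcal S_k=\begin{cases} f_k(\mathcal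 N)\,\mathrm L^N_k(\lambda-\mathcal L_0,z_k(\mathcal N)) & k \text{ odd},\\[2pt] \dfrac1{f_k(\mathcal N)}\big[\mathrm L^N_k(\lambda-\mathcal L_0,z_k(\mathcal N))-f_k(\mathcal N)\big] & k\text{ even},\end{cases}$$ and define constants by $c_2=\dfrac1{\pi(|\mathfrak w|^2\vee 1)}$ and, for $k\ge 1$, $$c_{2k+1}=\frac{3}{2\pi|\mathfrak w|}\,\frac{1+\frac1{2k^{1+\delta}}}{c_{2k}},\qquad c_{2k+2}=\frac{3}{2\pi|\mathfrak w|}\,\frac{1-\frac1{2k^{1+\delta}}}{\big(1+\frac1{2k^{1+\delta}}\big)c_{2k+1}}.$$ For operators, $\mathcal A\le\mathcal B$ means $\langle\mathcal A\varphi,\varphi\rangle\le\langle\mathcal B\varphi,\varphi\rangle$ for all $n$ and all $\varphi\in\Gamma L^2_n$ for which both quadratic forms are finite. **Theorem.** There is $K_0>0$, depending only on $|\mathfrak w|$, such that for every $K\ge K_0$, every $\delta\in(0,1)$, every $\lambda>0$, every integer $N\ge1$ and every integer $k\ge 0$, $$\mathcal H_{2k+3}\le c_{2k+3}\Big((-\mathcal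 L_0^{\mathfrak w})\,\mathcal S_{2k+3}+f_{2k+3}(\mathcal N)(-\mathcal L_0)\Big),$$ $$\mathcal H_{2k+2}\ge c_{2k+2}\Big((-\mathcal L_0^{\mathfrak w})\,\mathcal S_{2k+2}-\frac{1}{(\mathcal N+k)^{1+\delta}}(-\mathcal L_0)\Big),$$ and $c_{2k+3}>1$, $c_{2k+2}<1$. (On $\Gamma L^2_0$ the operators $\mathcal L_0,\mathcal L_0^{\mathfrak w}$ vanish and all terms are read as $0$.) -/

import Mathlib

noncomputable section

namespace Burgers

/-- Fourier modes of the two-dimensional torus of side length `2π`. -/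
abbrev Mode : Type := Fin 2 → ℤ

def Mode.vec (k : Mode) : EuclideanSpace ℝ (Fin 2) := WithLp.toLp 2 fun i => (k i : ℝ)

/-- Square-summable families of Fourier coefficients `φ̂(k₁, …, kₙ)`, `kᵢ ∈ ℤ²`: by Parseval, with respect to
the orthonormal basis `(2π)⁻ⁿ exp(i(k₁·x₁ + … + kₙ·xₙ))`, this is `L²((𝕋²)ⁿ; ℂ)`. -/
abbrev L2Seq (n : ℕ) : Type := lp (fun _ : Fin n → Mode => ℂ) 2

/-- The `n`-th homogeneous component `ΓL²ₙ` of Fock space, in Fourier variables: symmetric `L²` functions on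
`(𝕋²)ⁿ` that have mean zero in every variable, i.e. symmetric coefficients that vanish as soon as one mode
is `0`. -/
def chaos (n : ℕ) : Submodule ℂ (L2Seq n) where
  carrier := {φ | (∀ (σ : Equiv.Perm (Fin n)) (k : Fin n → Mode), φ (k ∘ σ) = φ k) ∧
    ∀ (k : Fin n → Mode) (i : Fin n), k i = 0 → φ k = 0}
  add_mem' := by
    rintro a b ⟨ha, ha'⟩ ⟨hb, hb'⟩
    refine ⟨fun σ k => ?_, fun k i h => ?_⟩
    · simp [ha σ k, hb σ k]
    · simp [ha' k i h, hb' k i h]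
  zero_mem' := ⟨fun _ _ => rfl, fun _ _ _ => rfl⟩
  smul_mem' := by
    rintro c a ⟨ha, ha'⟩
    refine ⟨fun σ k => ?_, fun k i h => ?_⟩
    · simp [ha σ k]
    · simp [ha' k i h]

theorem isClosed_chaos (n : ℕ) : IsClosed (chaos n : Set (L2Seq n)) := by
  have hev : ∀ k : Fin n → Mode, Continuous fun φ : L2Seq n => φ k := fun k =>
    (lp.evalCLM ℂ (fun _ : Fin n → Mode => ℂ) (p := 2) k).continuous
  have : (chaos n : Set (L2Seq n)) =
      (⋂ σ : Equiv.Perm (Fin n), ⋂ k : Fin n → Mode, {φ | φ (k ∘ σ) = φ k}) ∩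
      ⋂ k : Fin n → Mode, ⋂ i : Fin n, ⋂ _ : k i = 0, {φ | φ k = 0} := by
    ext φ; simp [chaos]
  rw [this]
  refine IsClosed.inter (isClosed_iInter fun σ => isClosed_iInter fun k => ?_)
    (isClosed_iInter fun k => isClosed_iInter fun i => isClosed_iInter fun _ => ?_)
  · exact isClosed_eq (hev _) (hev _)
  · exact isClosed_eq (hev _) continuous_const

instance (n : ℕ) : CompleteSpace (chaos n) := (isClosed_chaos n).completeSpace_coe

/-- Makes sure that `inner ℂ` on `ΓL²ₙ` is read as the one of the inner product space structure. -/
instance (n : ℕ) : Inner ℂ (chaos n) := InnerProductSpace.toInner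

/-- The Fock space inner product on `ΓL²ₙ`: `n!` times the `L²` inner product (conjugate-linear in the first
argument). -/
def fockInner (n : ℕ) (φ ψ : chaos n) : ℂ := (n.factorial : ℂ) * inner ℂ φ ψ

open Classical in
/-- The indicator `𝕁ᴺ_{ℓ,m}` of `0 < |ℓ| ≤ N`, `0 < |m| ≤ N`, `0 < |ℓ + m| ≤ N`. -/
def cutoff (N : ℕ) (l m : Mode) : ℝ :=
  if (0 < ‖l.vec‖ ∧ ‖l.vec‖ ≤ N) ∧ (0 < ‖m.vec‖ ∧ ‖m.vec‖ ≤ N) ∧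
    (0 < ‖(l + m).vec‖ ∧ ‖(l + m).vec‖ ≤ N) then 1 else 0

/-- The modes `(kᵢ + kⱼ, k_{{1:n+1} ∖ {i,j}})`: the sum `kᵢ + kⱼ` is put in the place of `kᵢ` and `kⱼ` is dropped.
The order of the entries is irrelevant, since the elements of `ΓL²ₙ` are symmetric. -/
def merge {n : ℕ} (i j : Fin (n + 1)) (k : Fin (n + 1) → Mode) : Fin n → Mode :=
  j.removeNth (Function.update k i (k i + k j))

def creationCoeff (w : EuclideanSpace ℝ (Fin 2)) (N : ℕ) (l m : Mode) : ℝ :=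
  cutoff N l m * inner ℝ w (l + m).vec

theorem merge_comp_perm {n : ℕ} (σ : Equiv.Perm (Fin (n + 1))) (i j : Fin (n + 1))
    (k : Fin (n + 1) → Mode) :
    ∃ ρ : Equiv.Perm (Fin n), merge i j (k ∘ σ) = merge (σ i) (σ j) k ∘ ρ := by
  have hσ : ∀ a : Fin (n + 1), a ≠ j ↔ σ a ≠ σ j := fun a => by simp
  refine ⟨((finSuccAboveEquiv j).trans (σ.subtypeEquiv hσ)).trans
    (finSuccAboveEquiv (σ j)).symm, ?_⟩
  funext a
  have h1 : (σ j).succAbove ((((finSuccAboveEquiv j).trans (σ.subtypeEquiv hσ)).trans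
    (finSuccAboveEquiv (σ j)).symm) a) = σ (j.succAbove a) := by
    have := (finSuccAboveEquiv (σ j)).apply_symm_apply
      ((σ.subtypeEquiv hσ) (finSuccAboveEquiv j a))
    exact congrArg Subtype.val this
  simp only [merge, Fin.removeNth_apply, Function.comp_apply, h1]
  by_cases h : j.succAbove a = i
  · simp [h]
  · rw [Function.update_of_ne h, Function.update_of_ne (fun h' => h (σ.injective h'))]
    rfl

theorem merge_swap {n : ℕ} (i j : Fin (n + 1)) (k : Fin (n + 1) → Mode) :
    ∃ ρ : Equiv.Perm (Fin n), merge i j k = merge j i k ∘ ρ := by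
  obtain ⟨ρ, hρ⟩ := merge_comp_perm (Equiv.swap i j) i j k
  refine ⟨ρ, ?_⟩
  rw [Equiv.swap_apply_left, Equiv.swap_apply_right] at hρ
  rw [← hρ]
  funext a
  simp only [merge, Fin.removeNth_apply, Function.comp_apply, Equiv.swap_apply_left,
    Equiv.swap_apply_right]
  by_cases h : j.succAbove a = i
  · simp [h, add_comm]
  · rw [Function.update_of_ne h, Function.update_of_ne h, Function.comp_apply,
      Equiv.swap_apply_of_ne_of_ne h (Fin.succAbove_ne j a)]

theorem merge_injective {n : ℕ} (i j : Fin (n + 1)) :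
    Function.Injective fun k : Fin (n + 1) → Mode => (merge i j k, k j) := by
  intro k k' h
  simp only [Prod.mk.injEq] at h
  obtain ⟨h1, h2⟩ := h
  funext a
  by_cases ha : a = j
  · rw [ha, h2]
  · obtain ⟨b, rfl⟩ := Fin.exists_succAbove_eq ha
    have h3 := congrFun h1 b
    simp only [merge, Fin.removeNth_apply] at h3
    by_cases hb : j.succAbove b = i
    · rw [hb] at h3 ⊢
      simpa [h2] using h3
    · rwa [Function.update_of_ne hb, Function.update_of_ne hb] at h3

theorem cutoff_comm (N : ℕ) (l m : Mode) : cutoff N l m = cutoff N m l := by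
  unfold cutoff
  rw [add_comm l m]
  congr 1
  exact propext ⟨fun h => ⟨h.2.1, h.1, h.2.2⟩, fun h => ⟨h.2.1, h.1, h.2.2⟩⟩

theorem abs_creationCoeff_le (w : EuclideanSpace ℝ (Fin 2)) (N : ℕ) (l m : Mode) :
    |creationCoeff w N l m| ≤ ‖w‖ * N := by
  unfold creationCoeff cutoff
  split_ifs with h
  · rw [one_mul]
    exact (abs_real_inner_le_norm _ _).trans
      (mul_le_mul_of_nonneg_left h.2.2.2 (norm_nonneg _))
  · simp only [zero_mul, abs_zero]; positivity

theorem mem_box_of_creationCoeff_ne_zero {w : EuclideanSpace ℝ (Fin 2)} {N : ℕ} {l m : Mode}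
    (h : creationCoeff w N l m ≠ 0) :
    m ∈ Finset.Icc (fun _ => -(N : ℤ) : Mode) (fun _ => (N : ℤ)) := by
  unfold creationCoeff cutoff at h
  split_ifs at h with hc
  · have hm := hc.2.1.2
    have hi : ∀ i, |m i| ≤ (N : ℤ) := fun i => by
      have h1 := (PiLp.norm_apply_le m.vec i).trans hm
      have h2 : ‖m.vec i‖ = ((|m i| : ℤ) : ℝ) := by
        rw [Real.norm_eq_abs, Int.cast_abs]; rfl
      rw [h2] at h1
      exact_mod_cast h1
    rw [Finset.mem_Icc]
    exact ⟨fun i => (abs_le.mp (hi i)).1, fun i => (abs_le.mp (hi i)).2⟩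
  · simp at h

theorem sum_creation_le (w : EuclideanSpace ℝ (Fin 2)) (N : ℕ) {n : ℕ} (i j : Fin (n + 1)) (φ : L2Seq n) (s : Finset (Fin (n + 1) → Mode)) :
    ∑ k ∈ s, ‖(creationCoeff w N (k i) (k j) : ℂ) * φ (merge i j k)‖ ^ (2 : ENNReal).toReal ≤
      (‖w‖ * N) ^ 2 *
        ((Finset.Icc (fun _ => -(N : ℤ) : Mode) (fun _ => (N : ℤ))).card * ‖φ‖ ^ 2) := by
  classical
  set B := Finset.Icc (fun _ => -(N : ℤ) : Mode) (fun _ => (N : ℤ)) with hB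
  set Q := s.image (merge i j)
  have h2 : (2 : ENNReal).toReal = (2 : ℕ) := by norm_num
  calc ∑ k ∈ s, ‖(creationCoeff w N (k i) (k j) : ℂ) * φ (merge i j k)‖ ^ (2 : ENNReal).toReal
      ≤ ∑ k ∈ s, (‖w‖ * N) ^ 2 * (if k j ∈ B then ‖φ (merge i j k)‖ ^ 2 else 0) := by
        refine Finset.sum_le_sum fun k _ => ?_
        rw [h2, Real.rpow_natCast, norm_mul, mul_pow, Complex.norm_real, Real.norm_eq_abs]
        by_cases hc : creationCoeff w N (k i) (k j) = 0
        · rw [hc]; simp only [abs_zero]; split_ifs <;> simp; positivity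
        · rw [if_pos (mem_box_of_creationCoeff_ne_zero hc)]
          gcongr
          exact abs_creationCoeff_le _ _ _ _
    _ = (‖w‖ * N) ^ 2 * ∑ p ∈ s.image (fun k => (merge i j k, k j)),
          (if p.2 ∈ B then ‖φ p.1‖ ^ 2 else 0) := by
        rw [← Finset.mul_sum, Finset.sum_image fun a _ b _ h => merge_injective i j h]
    _ ≤ (‖w‖ * N) ^ 2 * ∑ p ∈ Q ×ˢ B, ‖φ p.1‖ ^ 2 := by
        gcongr
        rw [← Finset.sum_filter]
        refine Finset.sum_le_sum_of_subset_of_nonneg ?_ fun _ _ _ => by positivity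
        intro p hp
        simp only [Finset.mem_filter, Finset.mem_image] at hp
        obtain ⟨⟨k, hk, rfl⟩, hp⟩ := hp
        exact Finset.mem_product.mpr ⟨Finset.mem_image_of_mem _ hk, hp⟩
    _ = (‖w‖ * N) ^ 2 * (B.card * ∑ q ∈ Q, ‖φ q‖ ^ 2) := by
        rw [Finset.sum_product]; simp [Finset.mul_sum]
    _ ≤ _ := by
        gcongr
        have := lp.sum_rpow_le_norm_rpow (p := 2) (by norm_num) φ Q
        simpa [h2, Real.rpow_natCast] using this

def creationPair (w : EuclideanSpace ℝ (Fin 2)) (N : ℕ) {n : ℕ} (i j : Fin (n + 1)) : L2Seq n →L[ℂ] L2Seq (n + 1) :=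
  LinearMap.mkContinuous
    { toFun := fun φ => ⟨fun k => (creationCoeff w N (k i) (k j) : ℂ) * φ (merge i j k),
        memℓp_gen' (sum_creation_le w N i j φ)⟩
      map_add' := fun a b => by
        ext k
        exact mul_add _ _ _
      map_smul' := fun c a => by
        ext k
        exact mul_left_comm _ _ _ }
    (‖w‖ * N * Real.sqrt (Finset.Icc (fun _ => -(N : ℤ) : Mode) (fun _ => (N : ℤ))).card)
    (fun φ => by
      refine lp.norm_le_of_forall_sum_le (by norm_num) (by positivity) fun s => ?_
      refine (sum_creation_le w N i j φ s).trans (le_of_eq ?_)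
      have h2 : (2 : ENNReal).toReal = (2 : ℕ) := by norm_num
      rw [h2, Real.rpow_natCast]
      simp only [mul_pow]
      rw [Real.sq_sqrt (by positivity)]
      ring)


/-- `(𝒜₊ᴺ φ)^(k_{1:n+1}) =
-(i / (π (n+1))) ∑_{i<j} 𝕁ᴺ_{kᵢ,kⱼ} (w·(kᵢ+kⱼ)) φ̂(kᵢ+kⱼ, k_{{1:n+1} ∖ {i,j}})`,
see `creationSeq_apply`. -/
def creationSeq (w : EuclideanSpace ℝ (Fin 2)) (N n : ℕ) : L2Seq n →L[ℂ] L2Seq (n + 1) :=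
  (-(Complex.I / (Real.pi * (n + 1)))) •
    ∑ i : Fin (n + 1), ∑ j ∈ Finset.Ioi i, creationPair w N i j

theorem creationSeq_apply (w : EuclideanSpace ℝ (Fin 2)) (N n : ℕ) (φ : L2Seq n)
    (k : Fin (n + 1) → Mode) :
    creationSeq w N n φ k = -(Complex.I / (Real.pi * (n + 1))) *
      ∑ i : Fin (n + 1), ∑ j ∈ Finset.Ioi i,
        (cutoff N (k i) (k j) : ℂ) * ((inner ℝ w (k i + k j).vec : ℝ) : ℂ) * φ (merge i j k) := by
  have hp : ∀ i j : Fin (n + 1), creationPair w N i j φ k =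
      (cutoff N (k i) (k j) : ℂ) * ((inner ℝ w (k i + k j).vec : ℝ) : ℂ) * φ (merge i j k) := by
    intro i j
    rw [← Complex.ofReal_mul]
    rfl
  simp only [creationSeq, smul_apply, sum_apply,
    lp.coeFn_smul, lp.coeFn_sum, Pi.smul_apply, Finset.sum_apply, smul_eq_mul, hp]

theorem sum_pairs_perm {n : ℕ} (g : Fin (n + 1) → Fin (n + 1) → ℂ) (hg : ∀ i j, g i j = g j i)
    (σ : Equiv.Perm (Fin (n + 1))) :
    ∑ i, ∑ j ∈ Finset.Ioi i, g (σ i) (σ j) = ∑ i, ∑ j ∈ Finset.Ioi i, g i j := by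
  have key : ∀ h : Fin (n + 1) → Fin (n + 1) → ℂ, (∀ i j, h i j = h j i) →
      2 * ∑ i, ∑ j ∈ Finset.Ioi i, h i j = ∑ i, ∑ j, if i = j then 0 else h i j := by
    intro h hh
    have e1 : ∑ i, ∑ j ∈ Finset.Ioi i, h i j = ∑ i, ∑ j, if i < j then h i j else 0 := by
      refine Finset.sum_congr rfl fun i _ => ?_
      rw [← Finset.sum_filter]
      congr 1
      ext j; simp
    have e2 : ∑ i, ∑ j ∈ Finset.Ioi i, h i j = ∑ i, ∑ j, if j < i then h i j else 0 := by
      rw [e1, Finset.sum_comm]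
      refine Finset.sum_congr rfl fun i _ => Finset.sum_congr rfl fun j _ => ?_
      rw [hh]
    rw [two_mul]
    nth_rewrite 1 [e1]
    rw [e2, ← Finset.sum_add_distrib]
    refine Finset.sum_congr rfl fun i _ => ?_
    rw [← Finset.sum_add_distrib]
    refine Finset.sum_congr rfl fun j _ => ?_
    rcases lt_trichotomy i j with h' | h' | h'
    · simp [h', h'.ne, h'.not_gt]
    · simp [h']
    · simp [h', h'.ne', h'.not_gt]
  have h2 : (2 : ℂ) ≠ 0 := two_ne_zero
  refine mul_left_cancel₀ h2 ?_
  rw [key _ (fun i j => hg _ _), key _ hg,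
    ← Equiv.sum_comp σ fun i => ∑ j, if i = j then 0 else g i j]
  refine Finset.sum_congr rfl fun i _ => ?_
  rw [← Equiv.sum_comp σ fun j => if σ i = j then 0 else g (σ i) j]
  simp

theorem creationSeq_mem (w : EuclideanSpace ℝ (Fin 2)) (N n : ℕ) (φ : chaos n) :
    creationSeq w N n φ ∈ chaos (n + 1) := by
  obtain ⟨φ, hs, h0⟩ := φ
  refine ⟨fun σ k => ?_, fun k a ha => ?_⟩
  · simp only [creationSeq_apply]
    congr 1
    set g : Fin (n + 1) → Fin (n + 1) → ℂ := fun i j =>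
      (cutoff N (k i) (k j) : ℂ) * ((inner ℝ w (k i + k j).vec : ℝ) : ℂ) * φ (merge i j k) with hg
    have hsymm : ∀ i j, g i j = g j i := fun i j => by
      obtain ⟨ρ, hρ⟩ := merge_swap i j k
      simp only [hg]
      rw [cutoff_comm, add_comm (k i), hρ, hs]
    rw [← sum_pairs_perm g hsymm σ]
    refine Finset.sum_congr rfl fun i _ => Finset.sum_congr rfl fun j _ => ?_
    obtain ⟨ρ, hρ⟩ := merge_comp_perm σ i j k
    rw [hρ, hs]
    rfl
  · rw [creationSeq_apply]
    refine mul_eq_zero_of_right _ (Finset.sum_eq_zero fun i _ => Finset.sum_eq_zero fun j hj => ?_)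
    have hij : i ≠ j := (Finset.mem_Ioi.mp hj).ne
    have hv : Mode.vec 0 = 0 := by ext b; simp [Mode.vec]
    by_cases hi : a = i
    · subst hi; simp [cutoff, ha, hv]
    by_cases hj' : a = j
    · subst hj'; simp [cutoff, ha, hv]
    obtain ⟨b, rfl⟩ := Fin.exists_succAbove_eq hj'
    have : φ (merge i j k) = 0 := by
      refine h0 _ b ?_
      simp only [merge, Fin.removeNth_apply]
      rw [Function.update_of_ne hi, ha]
    rw [this, mul_zero]

/-- The operator `𝒜₊ᴺ : ΓL²ₙ → ΓL²ₙ₊₁`. -/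
def creation (w : EuclideanSpace ℝ (Fin 2)) (N n : ℕ) : chaos n →L[ℂ] chaos (n + 1) :=
  ((creationSeq w N n).comp (chaos n).subtypeL).codRestrict (chaos (n + 1))
    (creationSeq_mem w N n)

/-- The adjoint `(𝒜₊ᴺ)* : ΓL²ₙ₊₁ → ΓL²ₙ` with respect to the Fock inner products, see `fockInner_creation`. The
factor `n + 1 = (n+1)! / n!` comes from the weights in `fockInner`. -/
def creationAdj (w : EuclideanSpace ℝ (Fin 2)) (N n : ℕ) : chaos (n + 1) →L[ℂ] chaos n :=
  ((n : ℂ) + 1) • ContinuousLinearMap.adjoint (creation w N n)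

theorem fockInner_creation (w : EuclideanSpace ℝ (Fin 2)) (N n : ℕ) (φ : chaos n)
    (ψ : chaos (n + 1)) :
    fockInner (n + 1) (creation w N n φ) ψ = fockInner n φ (creationAdj w N n ψ) := by
  have h : inner ℂ φ (creationAdj w N n ψ) = ((n : ℂ) + 1) * inner ℂ (creation w N n φ) ψ :=
    (inner_smul_right _ _ _).trans
      (congrArg _ (ContinuousLinearMap.adjoint_inner_right (creation w N n) φ ψ))
  rw [fockInner, fockInner, h, Nat.factorial_succ]
  push_cast
  ring

/-- Symbols of operators on Fock space that are diagonal in chaos and in Fourier. Sums and products of symbols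
(pointwise, in the ring `FourierMult`) are the symbols of sums and compositions. -/
abbrev FourierMult : Type := ∀ n : ℕ, (Fin n → Mode) → ℝ

namespace FourierMult

/-- The self-adjoint operator on `ΓL²ₙ` with Fourier multiplier `g`, on its maximal domain. -/
def op (g : FourierMult) (n : ℕ) : chaos n →ₗ.[ℂ] chaos n where
  domain :=
    { carrier := {φ | ∃ ψ : chaos n, ∀ k, (ψ : L2Seq n) k = (g n k : ℂ) * (φ : L2Seq n) k}
      add_mem' := by
        rintro a b ⟨a', ha⟩ ⟨b', hb⟩
        exact ⟨a' + b', fun k => by simp [ha k, hb k, mul_add]⟩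
      zero_mem' := ⟨0, fun k => by simp⟩
      smul_mem' := by
        rintro c a ⟨a', ha⟩
        exact ⟨c • a', fun k => by simp [ha k, mul_left_comm]⟩ }
  toFun :=
    { toFun := fun φ => φ.2.choose
      map_add' := fun a b => by
        ext k
        refine ((a + b).2.choose_spec k).trans ?_
        simp [a.2.choose_spec k, b.2.choose_spec k, mul_add]
      map_smul' := fun c a => by
        ext k
        refine ((c • a).2.choose_spec k).trans ?_
        simp [a.2.choose_spec k, mul_left_comm] }

theorem mem_op_domain {g : FourierMult} {n : ℕ} {φ ψ : chaos n}
    (h : ∀ k, (ψ : L2Seq n) k = (g n k : ℂ) * (φ : L2Seq n) k) : φ ∈ (g.op n).domain := ⟨ψ, h⟩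

theorem op_apply (g : FourierMult) (n : ℕ) (φ : (g.op n).domain) (k : Fin n → Mode) :
    (g.op n φ : L2Seq n) k = (g n k : ℂ) * ((φ : chaos n) : L2Seq n) k :=
  φ.2.choose_spec k

theorem inner_op (g : FourierMult) (n : ℕ) (φ ψ : (g.op n).domain) :
    inner ℂ (g.op n φ) (ψ : chaos n) = inner ℂ (φ : chaos n) (g.op n ψ) := by
  have h1 := lp.hasSum_inner (𝕜 := ℂ) ((g.op n φ : chaos n) : L2Seq n) ((ψ : chaos n) : L2Seq n)
  have h2 := lp.hasSum_inner (𝕜 := ℂ) ((φ : chaos n) : L2Seq n) ((g.op n ψ : chaos n) : L2Seq n)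
  refine h1.unique (Eq.mp (congrArg (fun F => HasSum F _) ?_) h2)
  funext k
  rw [op_apply, op_apply]
  simp only [RCLike.inner_apply, map_mul, Complex.conj_ofReal]
  ring

/-- `φ` has a finite quadratic form `⟨g φ, φ⟩`. -/
def InFormDomain (g : FourierMult) (n : ℕ) (φ : chaos n) : Prop :=
  Summable fun k => g n k * ‖(φ : L2Seq n) k‖ ^ 2

/-- The quadratic form `⟨g φ, φ⟩ = n! ∑_k g(k) |φ̂(k)|²` of the Fourier multiplier `g` in the Fock inner product.
It extends `⟨g φ, φ⟩` from the domain of `g.op n` to the form domain, see `form_op`. -/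
def form (g : FourierMult) (n : ℕ) (φ : chaos n) : ℝ :=
  (n.factorial : ℝ) * ∑' k, g n k * ‖(φ : L2Seq n) k‖ ^ 2

theorem hasSum_op (g : FourierMult) (n : ℕ) (φ : (g.op n).domain) :
    HasSum (fun k => g n k * ‖((φ : chaos n) : L2Seq n) k‖ ^ 2)
      (inner ℂ (g.op n φ) (φ : chaos n)).re := by
  have h := Complex.hasSum_re
    (lp.hasSum_inner (𝕜 := ℂ) ((g.op n φ : chaos n) : L2Seq n) ((φ : chaos n) : L2Seq n))
  refine Eq.mp (congrArg (fun F => HasSum F _) ?_) h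
  funext k
  rw [op_apply]
  simp only [RCLike.inner_apply, map_mul, Complex.conj_ofReal]
  symm
  rw [mul_left_comm, Complex.mul_conj, ← Complex.ofReal_mul, Complex.ofReal_re,
    Complex.normSq_eq_norm_sq]

theorem form_op (g : FourierMult) (n : ℕ) (φ : (g.op n).domain) :
    g.InFormDomain n φ ∧ g.form n φ = (fockInner n (g.op n φ) φ).re := by
  refine ⟨(g.hasSum_op n φ).summable, ?_⟩
  rw [form, (g.hasSum_op n φ).tsum_eq, fockInner, ← Complex.ofReal_natCast, Complex.re_ofReal_mul]

theorem sum_bounded_le {g : FourierMult} {n : ℕ} {C : ℝ} (hC : ∀ k, |g n k| ≤ C) (φ : L2Seq n)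
    (s : Finset (Fin n → Mode)) :
    ∑ k ∈ s, ‖(g n k : ℂ) * φ k‖ ^ (2 : ENNReal).toReal ≤ (C * ‖φ‖) ^ 2 := by
  have h2 : (2 : ENNReal).toReal = (2 : ℕ) := by norm_num
  have h := lp.sum_rpow_le_norm_rpow (p := 2) (by norm_num) φ s
  rw [h2] at h ⊢
  simp only [Real.rpow_natCast] at h ⊢
  rw [mul_pow]
  refine le_trans ?_ (mul_le_mul_of_nonneg_left h (sq_nonneg C))
  rw [Finset.mul_sum]
  refine Finset.sum_le_sum fun k _ => ?_
  rw [norm_mul, mul_pow, Complex.norm_real, Real.norm_eq_abs]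
  have := hC k
  gcongr

/-- A bounded symmetric Fourier multiplier as a bounded operator. -/
def bddOp (g : FourierMult) (n : ℕ) (C : ℝ) (hC : ∀ k, |g n k| ≤ C)
    (hs : ∀ (σ : Equiv.Perm (Fin n)) k, g n (k ∘ σ) = g n k) : chaos n →L[ℂ] chaos n :=
  LinearMap.mkContinuous
    { toFun := fun φ => ⟨⟨fun k => (g n k : ℂ) * (φ : L2Seq n) k,
          memℓp_gen' (sum_bounded_le hC (φ : L2Seq n))⟩,
        fun σ k => by
          change (g n (k ∘ σ) : ℂ) * (φ : L2Seq n) (k ∘ σ) = (g n k : ℂ) * (φ : L2Seq n) k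
          rw [hs, φ.2.1],
        fun k i h => by
          change (g n k : ℂ) * (φ : L2Seq n) k = 0
          rw [φ.2.2 k i h, mul_zero]⟩
      map_add' := fun a b => by
        ext k
        exact mul_add _ _ _
      map_smul' := fun c a => by
        ext k
        exact mul_left_comm _ _ _ }
    C
    (fun φ => by
      have hC0 : 0 ≤ C := (abs_nonneg _).trans (hC 0)
      refine lp.norm_le_of_forall_sum_le (by norm_num) (by positivity) fun s => ?_
      refine (sum_bounded_le hC (φ : L2Seq n) s).trans (le_of_eq ?_)
      have h2 : (2 : ENNReal).toReal = (2 : ℕ) := by norm_num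
      rw [h2, Real.rpow_natCast]
      rfl)

end FourierMult

/-- `ℒ₀`, with Fourier multiplier `-½ |k_{1:n}|²`. -/
def laplacian : FourierMult := fun _ k => -(1 / 2) * ∑ i, ‖(k i).vec‖ ^ 2

/-- `R` is the bounded everywhere defined two-sided inverse of the unbounded operator `T`. -/
def IsBoundedInverse {E : Type*} [NormedAddCommGroup E] [NormedSpace ℂ E] (T : E →ₗ.[ℂ] E)
    (R : E →L[ℂ] E) : Prop :=
  (∀ v : E, ∃ h : R v ∈ T.domain, T ⟨R v, h⟩ = v) ∧ ∀ u : T.domain, R (T u) = u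

open Classical in
/-- `T⁻¹`, if `T` has a bounded inverse. -/
def boundedInverse {E : Type*} [NormedAddCommGroup E] [NormedSpace ℂ E] (T : E →ₗ.[ℂ] E) :
    E →L[ℂ] E :=
  if h : ∃ R : E →L[ℂ] E, IsBoundedInverse T R then h.choose else 0

/-- The unbounded operator `λ - ℒ₀ + H` on `ΓL²ₙ`, with the domain of `ℒ₀`. -/
def resolventArg (lam : ℝ) (n : ℕ) (H : chaos n →L[ℂ] chaos n) : chaos n →ₗ.[ℂ] chaos n :=
  (H : chaos n →ₗ[ℂ] chaos n) +ᵥ FourierMult.op (lam • 1 - laplacian) n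

/-- `ℋ₂ = 0` and `ℋₖ = (𝒜₊ᴺ)* (λ - ℒ₀ + ℋₖ₋₁)⁻¹ 𝒜₊ᴺ` for `k ≥ 3`, on each `ΓL²ₙ`. The values at `k = 0, 1` are not
used. The inverses exist, see `opH_resolvent`. -/
def opH (w : EuclideanSpace ℝ (Fin 2)) (N : ℕ) (lam : ℝ) :
    ℕ → ∀ n : ℕ, chaos n →L[ℂ] chaos n
  | 0 => 0
  | 1 => 0
  | 2 => 0
  | k + 3 => fun n =>
      creationAdj w N n ∘L boundedInverse (resolventArg lam (n + 1) (opH w N lam (k + 2) (n + 1))) ∘L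
        creation w N n

theorem exists_isBoundedInverse {lam : ℝ} (hlam : 0 < lam) (n : ℕ) (H : chaos n →L[ℂ] chaos n)
    (hH : H.IsPositive) : ∃ R, IsBoundedInverse (resolventArg lam n H) R := by
  set d : FourierMult := lam • 1 - laplacian with hd
  have hdk : ∀ k : Fin n → Mode, d n k = lam + 1 / 2 * ∑ i, ‖(k i).vec‖ ^ 2 := fun k => by
    simp [hd, laplacian]
  have hd0 : ∀ k : Fin n → Mode, lam ≤ d n k := fun k => by
    rw [hdk]
    have : 0 ≤ ∑ i, ‖(k i).vec‖ ^ 2 := by positivity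
    linarith
  have hdpos : ∀ k : Fin n → Mode, 0 < d n k := fun k => hlam.trans_le (hd0 k)
  have hds : ∀ (σ : Equiv.Perm (Fin n)) k, d n (k ∘ σ) = d n k := fun σ k => by
    rw [hdk, hdk]
    congr 2
    exact Equiv.sum_comp σ fun i => ‖(k i).vec‖ ^ 2
  have happ : ∀ u : (resolventArg lam n H).domain,
      resolventArg lam n H u = H (u : chaos n) + d.op n u := fun u => rfl
  -- the square root of the inverse of the diagonal part
  set g : FourierMult := fun m k => (Real.sqrt (d m k))⁻¹ with hg
  have hgC : ∀ k : Fin n → Mode, |g n k| ≤ (Real.sqrt lam)⁻¹ := fun k => by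
    rw [abs_of_nonneg (by positivity)]
    exact inv_anti₀ (Real.sqrt_pos.mpr hlam) (Real.sqrt_le_sqrt (hd0 k))
  set s : chaos n →L[ℂ] chaos n := g.bddOp n _ hgC (fun σ k => by simp [hg, hds]) with hs
  have hsk : ∀ (φ : chaos n) k, (s φ : L2Seq n) k = (g n k : ℂ) * (φ : L2Seq n) k :=
    fun φ k => rfl
  have hssym : ∀ φ ψ : chaos n, inner ℂ (s φ) ψ = inner ℂ φ (s ψ) := by
    intro φ ψ
    have h1 := lp.hasSum_inner (𝕜 := ℂ) (s φ : L2Seq n) (ψ : L2Seq n)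
    have h2 := lp.hasSum_inner (𝕜 := ℂ) (φ : L2Seq n) (s ψ : L2Seq n)
    refine h1.unique (Eq.mp (congrArg (fun F => HasSum F _) ?_) h2)
    funext k
    rw [hsk, hsk]
    simp only [RCLike.inner_apply, map_mul, Complex.conj_ofReal]
    ring
  set M : chaos n →L[ℂ] chaos n := ContinuousLinearMap.id ℂ _ + s ∘L H ∘L s with hM
  have hunit : IsUnit M := by
    refine ContinuousLinearMap.isUnit_of_forall_le_norm_inner_map M (c := 1) one_pos fun x => ?_
    have hx : inner ℂ (M x) x = inner ℂ x x + inner ℂ (H (s x)) (s x) := by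
      rw [← hssym, ← inner_add_left]
      rfl
    have hpos : 0 ≤ (inner ℂ (H (s x)) (s x)).re := hH.re_inner_nonneg_left (s x)
    refine le_trans ?_ (Complex.re_le_norm _)
    rw [hx, Complex.add_re]
    have : (inner ℂ x x : ℂ).re = ‖x‖ ^ 2 := (norm_sq_eq_re_inner (𝕜 := ℂ) x).symm
    rw [this]
    simp only [NNReal.coe_one, mul_one]
    linarith
  obtain ⟨U, hU⟩ := hunit
  have hMU : ∀ x, M ((↑U⁻¹ : chaos n →L[ℂ] chaos n) x) = x := fun x => by
    rw [← hU]
    exact congrArg (fun f : chaos n →L[ℂ] chaos n => f x) U.mul_inv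
  set R : chaos n →L[ℂ] chaos n := s ∘L (↑U⁻¹ : chaos n →L[ℂ] chaos n) ∘L s with hR
  have hkey : ∀ v k, ((v - H (R v) : chaos n) : L2Seq n) k = (d n k : ℂ) * (R v : L2Seq n) k := by
    intro v k
    set u : chaos n := (↑U⁻¹ : chaos n →L[ℂ] chaos n) (s v) with hu
    have hRv : R v = s u := rfl
    have h1 : u = s (v - H (s u)) := by
      have : u + s (H (s u)) = s v := hMU (s v)
      rw [map_sub, ← this]; abel
    have h2 : (R v : L2Seq n) k = (g n k : ℂ) * ((g n k : ℂ) * ((v - H (R v) : chaos n) : L2Seq n) k) := by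
      conv_lhs => rw [hRv, hsk, h1, hsk]
      rw [hRv]
    rw [h2, ← mul_assoc, ← mul_assoc, ← Complex.ofReal_mul, ← Complex.ofReal_mul]
    have : d n k * g n k * g n k = 1 := by
      simp only [hg]
      have := Real.mul_self_sqrt (hdpos k).le
      have h0 := (Real.sqrt_pos.mpr (hdpos k)).ne'
      field_simp
      nlinarith
    rw [this]; simp
  have hright : ∀ v, ∃ h : R v ∈ (resolventArg lam n H).domain,
      resolventArg lam n H ⟨R v, h⟩ = v := by
    intro v
    have hmem : R v ∈ (d.op n).domain := FourierMult.mem_op_domain (hkey v)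
    refine ⟨hmem, ?_⟩
    rw [happ]
    have : d.op n ⟨R v, hmem⟩ = v - H (R v) := by
      ext k
      rw [FourierMult.op_apply, hkey]
    refine (congrArg (fun y => H (R v) + y) this).trans ?_
    abel
  refine ⟨R, hright, fun u => ?_⟩
  obtain ⟨hm, he⟩ := hright (resolventArg lam n H u)
  set x : (resolventArg lam n H).domain := ⟨R (resolventArg lam n H u), hm⟩ - u with hx
  have hTx : resolventArg lam n H x = 0 := by rw [hx, LinearPMap.map_sub, he, sub_self]
  have h3 := FourierMult.hasSum_op d n x
  have h4 : (inner ℂ (H (x : chaos n)) (x : chaos n)).re + (inner ℂ (d.op n x) (x : chaos n)).re = 0 := by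
    rw [← Complex.add_re, ← inner_add_left, ← happ, hTx, inner_zero_left, Complex.zero_re]
  have h5 : 0 ≤ (inner ℂ (H (x : chaos n)) (x : chaos n)).re := hH.re_inner_nonneg_left _
  have hnn : ∀ k, 0 ≤ d n k * ‖((x : chaos n) : L2Seq n) k‖ ^ 2 := fun k =>
    mul_nonneg (hdpos k).le (sq_nonneg _)
  have h6 : (inner ℂ (d.op n x) (x : chaos n)).re = 0 :=
    le_antisymm (by linarith) (h3.nonneg hnn)
  rw [h6] at h3
  have h7 := (hasSum_zero_iff_of_nonneg hnn).mp h3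
  have hx0 : (x : chaos n) = 0 := by
    ext k
    have := congrFun h7 k
    simpa [(hdpos k).ne'] using this
  exact sub_eq_zero.mp hx0

theorem isBoundedInverse_boundedInverse {lam : ℝ} (hlam : 0 < lam) (n : ℕ)
    (H : chaos n →L[ℂ] chaos n) (hH : H.IsPositive) :
    IsBoundedInverse (resolventArg lam n H) (boundedInverse (resolventArg lam n H)) := by
  have h := exists_isBoundedInverse hlam n H hH
  rw [boundedInverse, dif_pos h]
  exact h.choose_spec

theorem isPositive_of_isBoundedInverse {lam : ℝ} (hlam : 0 < lam) {n : ℕ}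
    {H R : chaos n →L[ℂ] chaos n} (hH : H.IsPositive) (hR : IsBoundedInverse (resolventArg lam n H) R) :
    R.IsPositive := by
  set d : FourierMult := lam • 1 - laplacian with hd
  have happ : ∀ u : (resolventArg lam n H).domain,
      resolventArg lam n H u = H (u : chaos n) + d.op n u := fun u => rfl
  refine ⟨fun v v' => ?_, fun v => ?_⟩
  · obtain ⟨h, e⟩ := hR.1 v
    obtain ⟨h', e'⟩ := hR.1 v'
    have e1 : v = H (R v) + d.op n ⟨R v, h⟩ := e.symm
    have e1' : v' = H (R v') + d.op n ⟨R v', h'⟩ := e'.symm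
    change inner ℂ (R v) v' = inner ℂ v (R v')
    conv_lhs => rw [e1']
    conv_rhs => rw [e1]
    rw [inner_add_right, inner_add_left]
    have a1 : inner ℂ (R v) (H (R v')) = inner ℂ (H (R v)) (R v') :=
      (hH.isSymmetric (R v) (R v')).symm
    have a2 := FourierMult.inner_op d n ⟨R v, h⟩ ⟨R v', h'⟩
    rw [a1]
    exact congrArg _ a2.symm
  · obtain ⟨h, e⟩ := hR.1 v
    have e1 : v = H (R v) + d.op n ⟨R v, h⟩ := e.symm
    have hval : (inner ℂ v (R v)).re = (inner ℂ (H (R v)) (R v)).re +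
        (inner ℂ (d.op n ⟨R v, h⟩) (R v)).re := by
      conv_lhs => rw [e1]
      rw [inner_add_left, Complex.add_re, ← e1]
    have h5 : 0 ≤ (inner ℂ (H (R v)) (R v)).re := hH.re_inner_nonneg_left _
    have h3 := FourierMult.hasSum_op d n ⟨R v, h⟩
    have h6 : 0 ≤ (inner ℂ (d.op n ⟨R v, h⟩) (R v)).re := by
      refine h3.nonneg fun k => mul_nonneg ?_ (sq_nonneg _)
      have : d n k = lam + 1 / 2 * ∑ i, ‖(k i).vec‖ ^ 2 := by simp [hd, laplacian]
      rw [this]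
      positivity
    rw [ContinuousLinearMap.reApplyInnerSelf_apply, inner_re_symm]
    change 0 ≤ (inner ℂ v (R v)).re
    rw [hval]
    exact add_nonneg h5 h6

theorem opH_isPositive (w : EuclideanSpace ℝ (Fin 2)) (N : ℕ) {lam : ℝ} (hlam : 0 < lam) :
    ∀ k n : ℕ, (opH w N lam k n).IsPositive
  | 0, n => ContinuousLinearMap.isPositive_zero
  | 1, n => ContinuousLinearMap.isPositive_zero
  | 2, n => ContinuousLinearMap.isPositive_zero
  | k + 3, n => by
      have ih := opH_isPositive w N hlam (k + 2) (n + 1)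
      have hR := isPositive_of_isBoundedInverse hlam ih
        (isBoundedInverse_boundedInverse hlam (n + 1) _ ih)
      have h := (hR.adjoint_conj (creation w N n)).smul_of_nonneg
        (c := ((n : ℂ) + 1)) (by rw [RCLike.nonneg_iff]; simp; positivity)
      exact h

theorem opH_resolvent (w : EuclideanSpace ℝ (Fin 2)) (N : ℕ) {lam : ℝ} (hlam : 0 < lam)
    (k n : ℕ) :
    IsBoundedInverse (resolventArg lam n (opH w N lam k n))
      (boundedInverse (resolventArg lam n (opH w N lam k n))) :=
  isBoundedInverse_boundedInverse hlam n _ (opH_isPositive w N hlam k n)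

/-- `ℒ₀ʷ`, with Fourier multiplier `-½ ∑ᵢ (w·kᵢ)²`. -/
def skewLaplacian (w : EuclideanSpace ℝ (Fin 2)) : FourierMult :=
  fun _ k => -(1 / 2) * ∑ i, (inner ℝ w (k i).vec) ^ 2

/-- The function `h(𝒩)` of the number operator. -/
def ofNumber (h : ℕ → ℝ) : FourierMult := fun n _ => h n

/-- `θ₂ = 0`, `θₖ₊₁ = 1 - θₖ / 2`. The values at `0, 1` are not used. -/
def theta : ℕ → ℝ
  | 0 => 0
  | 1 => 0
  | 2 => 0
  | k + 3 => 1 - theta (k + 2) / 2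

/-- `L(x, z) = log(1 + x⁻¹) + z`. -/
def logL (x z : ℝ) : ℝ := Real.log (1 + x⁻¹) + z

/-- `Lₖᴺ(x, z) = L(x / N², z) ^ θₖ`. -/
def logLk (N k : ℕ) (x z : ℝ) : ℝ := logL (x / (N : ℝ) ^ 2) z ^ theta k

/-- `zₖ(n) = K (n + k)^(9/2 + 3δ/2)`. -/
def zCoeff (K δ : ℝ) (k n : ℕ) : ℝ := K * ((n : ℝ) + k) ^ (9 / 2 + 3 / 2 * δ)

/-- `fₖ(n) = 3 zₖ(n)^(2/3)`. -/
def fCoeff (K δ : ℝ) (k n : ℕ) : ℝ := 3 * zCoeff K δ k n ^ (2 / 3 : ℝ)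

/-- The operators `𝒮ₖᴺ`; here `lam - laplacian n p` is the symbol of `λ - ℒ₀`. -/
def opS (K δ lam : ℝ) (N k : ℕ) : FourierMult := fun n p =>
  if Odd k then
    fCoeff K δ k n * logLk N k (lam - laplacian n p) (zCoeff K δ k n)
  else
    1 / fCoeff K δ k n * (logLk N k (lam - laplacian n p) (zCoeff K δ k n) - fCoeff K δ k n)

/-- The constants `c₂ = 1 / (π (|w|² ∨ 1))` and, for `k ≥ 1` and `ε = 1 / (2 k^(1+δ))`,
`c₂ₖ₊₁ = 3 / (2π|w|) · (1 + ε) / c₂ₖ`, `c₂ₖ₊₂ = 3 / (2π|w|) · (1 - ε) / ((1 + ε) c₂ₖ₊₁)`.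
The values at `0, 1` are not used. For an index `j` equal to `2k + 1` or `2k + 2` one has `k = (j - 1) / 2`,
rounded down. -/
def cCoeff (w : EuclideanSpace ℝ (Fin 2)) (δ : ℝ) : ℕ → ℝ
  | 0 => 0
  | 1 => 0
  | 2 => 1 / (Real.pi * max (‖w‖ ^ 2) 1)
  | m + 3 =>
    let ε : ℝ := 1 / (2 * (((m + 2) / 2 : ℕ) : ℝ) ^ (1 + δ))
    if Odd (m + 3) then
      3 / (2 * Real.pi * ‖w‖) * ((1 + ε) / cCoeff w δ (m + 2))
    else
      3 / (2 * Real.pi * ‖w‖) * ((1 - ε) / ((1 + ε) * cCoeff w δ (m + 2)))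

/-- `H ≤ g` as quadratic forms on every `ΓL²ₙ`. Outside the form domain of `g` the right-hand side is not
finite. -/
def OpLE (H : ∀ n : ℕ, chaos n →L[ℂ] chaos n) (g : FourierMult) : Prop :=
  ∀ (n : ℕ) (φ : chaos n), g.InFormDomain n φ → (fockInner n (H n φ) φ).re ≤ g.form n φ

/-- `g ≤ H` as quadratic forms on every `ΓL²ₙ`. -/
def OpGE (H : ∀ n : ℕ, chaos n →L[ℂ] chaos n) (g : FourierMult) : Prop :=
  ∀ (n : ℕ) (φ : chaos n), g.InFormDomain n φ → g.form n φ ≤ (fockInner n (H n φ) φ).re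

end Burgers

end

noncomputable section

namespace Burgers

open MeasureTheory

/-! ### Variational bounds for the resolvent -/

/-! The two families of bounds are proved together by an alternating induction: a lower bound for
`opH` at level 2k+2 yields the upper bound at level 2k+3 (`opLE_of_opGE`), and that one yields the
lower bound at level 2k+4 (`opGE_of_opLE`). The start is trivial, since θ₂ = 0 makes the lower
symbol nonpositive while ℋ₂ = 0.

Each step has three ingredients. First, inversion reverses the order of forms: if ℋ is bounded by a
Fourier multiplier g on one side, the inverse of λ - ℒ₀ + ℋ is bounded on the other side by the
multiplier D = 1/(λ - ℒ₀ + g) (`re_inner_resolvent_le`, `le_re_inner_resolvent`). Only 𝒜₊* D 𝒜₊ with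
diagonal D then has to be estimated.

Second, 𝒜₊ is a sum over pairs of modes that are merged. When both factors merge the same pair, the
form is diagonal in the merged configuration q, with symbol proportional to ∑_b (w·q_b)² ∑_l D(q
with q_b split into q_b - l and l). When the pairs differ, a weighted Cauchy-Schwarz inequality and
a lattice sum bounded uniformly in its scale give an error of order n² sup(D ∑|kᵢ|²) (-ℒ₀ʷ)
(`abs_tsum_creation_sub_le`). The upper bound absorbs it in f, the lower bound in the term
(-ℒ₀)/(𝒩+k)^(1+δ).

Third, the sum over l is compared with a planar integral. The angular integral of 1/(a + b cos²) is
2π/√(a(a+b)), so a weight L^θ in front of (w·l)² becomes L^(-θ/2), and integrating L^(-θ/2) dr/r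
gives L^(1-θ/2)/(1-θ/2). This is the recursion of the exponents.

The upper bound can afford crude constants: the lattice sum produces only √f, and the surplus √f
swallows every constant depending on |w| (`tsum_upperSymbol_le`, `upper_coefficient_le`). The lower
bound must be sharp up to the factor 1 - ε: the factor 1/(1-θ/2) ≥ 3/2 for odd levels is the 3/2 in
the constants c (`le_tsum_lowerSymbol`, `lower_coefficient_le`). Its lower-order losses are paid by
the subtraction of f, which also makes the claim void at scales near or above the cutoff N. -/

theorem sub_laplacian_eq (lam : ℝ) (n : ℕ) (k : Fin n → Mode) :
    lam - laplacian n k = lam + 1 / 2 * ∑ i, ‖(k i).vec‖ ^ 2 := by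
  simp [laplacian]

theorem le_sub_laplacian (lam : ℝ) (n : ℕ) (k : Fin n → Mode) : lam ≤ lam - laplacian n k := by
  rw [sub_laplacian_eq]
  have : 0 ≤ ∑ i, ‖(k i).vec‖ ^ 2 := by positivity
  linarith

theorem laplacian_comp_perm (n : ℕ) (σ : Equiv.Perm (Fin n)) (k : Fin n → Mode) :
    laplacian n (k ∘ σ) = laplacian n k := by
  simp only [laplacian]
  congr 1
  exact Equiv.sum_comp σ fun i => ‖(k i).vec‖ ^ 2

theorem summable_norm_sq {n : ℕ} (φ : L2Seq n) : Summable fun k => ‖φ k‖ ^ 2 := by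
  have h := (lp.memℓp φ).summable (p := 2) (by norm_num)
  have h2 : (2 : ENNReal).toReal = (2 : ℕ) := by norm_num
  simpa [h2, Real.rpow_natCast] using h

theorem summable_mul_norm_sq {n : ℕ} (φ : L2Seq n) {D : (Fin n → Mode) → ℝ} {C : ℝ}
    (hD : ∀ k, |D k| ≤ C) : Summable fun k => D k * ‖φ k‖ ^ 2 := by
  refine Summable.of_norm_bounded ((summable_norm_sq φ).mul_left C) fun k => ?_
  rw [Real.norm_eq_abs, abs_mul, abs_of_nonneg (sq_nonneg ‖φ k‖)]
  exact mul_le_mul_of_nonneg_right (hD k) (sq_nonneg _)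

theorem hasSum_re_inner {n : ℕ} (φ ψ : chaos n) :
    HasSum (fun k => (inner ℂ ((φ : L2Seq n) k) ((ψ : L2Seq n) k) : ℂ).re) (inner ℂ φ ψ).re :=
  Complex.hasSum_re (lp.hasSum_inner (𝕜 := ℂ) (φ : L2Seq n) (ψ : L2Seq n))

/-- The quadratic form of the inverse of `λ - ℒ₀ + H` is at most the one of the inverse of
`λ - ℒ₀ + g` if `g ≤ H`. -/
theorem re_inner_resolvent_le {lam : ℝ} (hlam : 0 < lam) {n : ℕ} {H : chaos n →L[ℂ] chaos n}
    {R : chaos n →L[ℂ] chaos n} (hR : IsBoundedInverse (resolventArg lam n H) R)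
    (g : (Fin n → Mode) → ℝ) {C κ : ℝ} (hgC : ∀ k, |g k| ≤ C * (lam - laplacian n k))
    (hκ : 0 < κ) (hg : ∀ k, κ * (lam - laplacian n k) ≤ lam - laplacian n k + g k)
    (hgH : ∀ φ : chaos n, Summable (fun k => g k * ‖(φ : L2Seq n) k‖ ^ 2) →
      ∑' k, g k * ‖(φ : L2Seq n) k‖ ^ 2 ≤ (inner ℂ (H φ) φ).re) (ψ : chaos n) :
    (inner ℂ (R ψ) ψ).re ≤ ∑' k, (lam - laplacian n k + g k)⁻¹ * ‖(ψ : L2Seq n) k‖ ^ 2 := by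
  set d : FourierMult := lam • 1 - laplacian with hd
  have hdk : ∀ k, d n k = lam - laplacian n k := fun k => by simp [hd]
  obtain ⟨hm, he⟩ := hR.1 ψ
  set u : chaos n := R ψ with hu
  have e1 : ψ = H u + d.op n ⟨u, hm⟩ := he.symm
  have hdu := FourierMult.hasSum_op d n ⟨u, hm⟩
  simp only [hdk] at hdu
  have hgs : Summable fun k => g k * ‖(u : L2Seq n) k‖ ^ 2 := by
    refine Summable.of_norm_bounded (hdu.summable.mul_left C) fun k => ?_
    rw [Real.norm_eq_abs, abs_mul, abs_of_nonneg (sq_nonneg ‖(u : L2Seq n) k‖), ← mul_assoc]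
    exact mul_le_mul_of_nonneg_right (hgC k) (sq_nonneg _)
  -- The multiplier g may be negative; κ keeps λ - ℒ₀ + g uniformly positive, hence invertible.
  have hpos : ∀ k, κ * lam ≤ lam - laplacian n k + g k := fun k =>
    (mul_le_mul_of_nonneg_left (le_sub_laplacian lam n k) hκ.le).trans (hg k)
  have hpos' : ∀ k, 0 < lam - laplacian n k + g k := fun k => (mul_pos hκ hlam).trans_le (hpos k)
  have hs : Summable fun k => (lam - laplacian n k + g k)⁻¹ * ‖(ψ : L2Seq n) k‖ ^ 2 := by
    refine summable_mul_norm_sq _ (C := (κ * lam)⁻¹) fun k => ?_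
    rw [abs_of_pos (inv_pos.mpr (hpos' k))]
    exact inv_anti₀ (mul_pos hκ hlam) (hpos k)
  have h1 : (inner ℂ u ψ).re = (inner ℂ (H u) u).re + (inner ℂ (d.op n ⟨u, hm⟩) u).re := by
    have : (inner ℂ u ψ).re = (inner ℂ ψ u).re := inner_re_symm (𝕜 := ℂ) u ψ
    rw [this]
    conv_lhs => rw [e1]
    rw [inner_add_left, Complex.add_re]
  -- With u = Rψ, the form ⟨u, ψ⟩ equals ⟨(λ - ℒ₀ + H)u, u⟩, and H dominates g at u.
  have h2 : ∑' k, (lam - laplacian n k + g k) * ‖(u : L2Seq n) k‖ ^ 2 ≤ (inner ℂ u ψ).re := by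
    simp only [add_mul]
    rw [hdu.summable.tsum_add hgs, hdu.tsum_eq, h1]
    linarith [hgH u hgs]
  have hs2 : Summable fun k => (lam - laplacian n k + g k) * ‖(u : L2Seq n) k‖ ^ 2 := by
    simp only [add_mul]
    exact hdu.summable.add hgs
  have h3 := hasSum_re_inner u ψ
  -- Young's inequality mode by mode. By `h2` the sum in u is at most one copy of ⟨u, ψ⟩, which
  -- leaves the claim.
  have h4 : 2 * (inner ℂ u ψ).re ≤
      ∑' k, (lam - laplacian n k + g k) * ‖(u : L2Seq n) k‖ ^ 2 +
      ∑' k, (lam - laplacian n k + g k)⁻¹ * ‖(ψ : L2Seq n) k‖ ^ 2 := by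
    rw [← hs2.tsum_add hs]
    refine hasSum_le (fun k => ?_) (h3.mul_left 2) (hs2.add hs).hasSum
    have hk := hpos' k
    have h5 : (inner ℂ ((u : L2Seq n) k) ((ψ : L2Seq n) k) : ℂ).re ≤
        ‖(u : L2Seq n) k‖ * ‖(ψ : L2Seq n) k‖ := (Complex.re_le_norm _).trans (norm_inner_le_norm _ _)
    set y := lam - laplacian n k + g k
    have h6 : y * ‖(u : L2Seq n) k‖ ^ 2 + y⁻¹ * ‖(ψ : L2Seq n) k‖ ^ 2 -
        2 * (‖(u : L2Seq n) k‖ * ‖(ψ : L2Seq n) k‖) =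
        y⁻¹ * (y * ‖(u : L2Seq n) k‖ - ‖(ψ : L2Seq n) k‖) ^ 2 := by
      field_simp
      ring
    have h7 : 0 ≤ y⁻¹ * (y * ‖(u : L2Seq n) k‖ - ‖(ψ : L2Seq n) k‖) ^ 2 := by positivity
    linarith
  linarith

/-- The quadratic form of the inverse of `λ - ℒ₀ + H` is at least the one of the inverse of
`λ - ℒ₀ + g` if `H ≤ g`. -/
theorem le_re_inner_resolvent {lam : ℝ} (hlam : 0 < lam) {n : ℕ} {H : chaos n →L[ℂ] chaos n}
    (hH : H.IsPositive)
    {R : chaos n →L[ℂ] chaos n} (hR : IsBoundedInverse (resolventArg lam n H) R)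
    (g : (Fin n → Mode) → ℝ) (hg : ∀ k, 0 ≤ g k)
    (hgs : ∀ (σ : Equiv.Perm (Fin n)) k, g (k ∘ σ) = g k)
    (hgH : ∀ φ : chaos n, Summable (fun k => g k * ‖(φ : L2Seq n) k‖ ^ 2) →
      (inner ℂ (H φ) φ).re ≤ ∑' k, g k * ‖(φ : L2Seq n) k‖ ^ 2) (ψ : chaos n) :
    ∑' k, (lam - laplacian n k + g k)⁻¹ * ‖(ψ : L2Seq n) k‖ ^ 2 ≤ (inner ℂ (R ψ) ψ).re := by
  set d : FourierMult := lam • 1 - laplacian with hd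
  have hdk : ∀ k, d n k = lam - laplacian n k := fun k => by simp [hd]
  have hd0 := le_sub_laplacian lam n
  have hpos : ∀ k, 0 < lam - laplacian n k + g k := fun k => by linarith [hd0 k, hg k]
  obtain ⟨hm, he⟩ := hR.1 ψ
  set u : chaos n := R ψ with hu
  have e1 : ψ = H u + d.op n ⟨u, hm⟩ := he.symm
  -- `bddOp` takes a symbol on all chaoses, so 1/(λ - ℒ₀ + g) is extended by 0 off the n-th one.
  -- Applied to ψ it gives the trial vector v.
  set m : FourierMult := fun n' k => if h : n' = n then
    (lam - laplacian n (h ▸ k) + g (h ▸ k))⁻¹ else 0 with hmdef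
  have hmk : ∀ k, m n k = (lam - laplacian n k + g k)⁻¹ := fun k => by simp [hmdef]
  have hmC : ∀ k, |m n k| ≤ lam⁻¹ := fun k => by
    rw [hmk, abs_of_pos (inv_pos.mpr (hpos k))]
    exact inv_anti₀ hlam (by linarith [hd0 k, hg k])
  have hms : ∀ (σ : Equiv.Perm (Fin n)) k, m n (k ∘ σ) = m n k := fun σ k => by
    rw [hmk, hmk, hgs, laplacian_comp_perm]
  set v : chaos n := m.bddOp n _ hmC hms ψ with hv
  have hvk : ∀ k, (v : L2Seq n) k = (m n k : ℂ) * (ψ : L2Seq n) k := fun k => rfl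
  have hvn : ∀ k, (lam - laplacian n k + g k) * ‖(v : L2Seq n) k‖ ^ 2 =
      (lam - laplacian n k + g k)⁻¹ * ‖(ψ : L2Seq n) k‖ ^ 2 := fun k => by
    rw [hvk, norm_mul, mul_pow, Complex.norm_real, Real.norm_eq_abs, sq_abs, hmk]
    have := (hpos k).ne'
    field_simp
  have hs : Summable fun k => (lam - laplacian n k + g k)⁻¹ * ‖(ψ : L2Seq n) k‖ ^ 2 := by
    simpa only [hmk] using summable_mul_norm_sq (ψ : L2Seq n) hmC
  have hs2 : Summable fun k => (lam - laplacian n k + g k) * ‖(v : L2Seq n) k‖ ^ 2 := by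
    simpa only [hvn] using hs
  -- `v` lies in the domain of `ℒ₀`
  set m' : FourierMult := fun n' k => if h : n' = n then
    (lam - laplacian n (h ▸ k)) * (lam - laplacian n (h ▸ k) + g (h ▸ k))⁻¹ else 0 with hm'def
  have hm'k : ∀ k, m' n k = (lam - laplacian n k) * (lam - laplacian n k + g k)⁻¹ := fun k => by
    simp [hm'def]
  have hm'C : ∀ k, |m' n k| ≤ 1 := fun k => by
    have h0 : 0 ≤ lam - laplacian n k := hlam.le.trans (hd0 k)
    rw [hm'k, abs_of_nonneg (mul_nonneg h0 (inv_pos.mpr (hpos k)).le), ← div_eq_mul_inv,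
      div_le_one (hpos k)]
    linarith [hg k]
  have hm's : ∀ (σ : Equiv.Perm (Fin n)) k, m' n (k ∘ σ) = m' n k := fun σ k => by
    rw [hm'k, hm'k, hgs, laplacian_comp_perm]
  have hvm : v ∈ (d.op n).domain := by
    refine FourierMult.mem_op_domain (ψ := m'.bddOp n _ hm'C hm's ψ) fun k => ?_
    change (m' n k : ℂ) * (ψ : L2Seq n) k = _
    rw [hvk, hm'k, hdk, hmk]
    push_cast
    ring
  have hdv := FourierMult.hasSum_op d n ⟨v, hvm⟩
  simp only [hdk] at hdv
  have hgv : Summable fun k => g k * ‖(v : L2Seq n) k‖ ^ 2 := by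
    have := hs2.sub hdv.summable
    refine this.congr fun k => ?_
    ring
  have hdiff := FourierMult.hasSum_op d n (⟨u, hm⟩ - ⟨v, hvm⟩)
  -- Positivity of λ - ℒ₀ and of H at u - v is the variational principle ⟨u, ψ⟩ ≥ 2 Re⟨v, ψ⟩ - ⟨(λ -
  -- ℒ₀ + H)v, v⟩. Replacing H by g in the last term turns the right-hand side into ⟨v, ψ⟩.
  have hnn : 0 ≤ (inner ℂ (d.op n (⟨u, hm⟩ - ⟨v, hvm⟩)) (u - v)).re := by
    refine hdiff.nonneg fun k => mul_nonneg ?_ (sq_nonneg _)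
    rw [hdk]
    exact hlam.le.trans (hd0 k)
  have hHnn : 0 ≤ (inner ℂ (H (u - v)) (u - v)).re := hH.re_inner_nonneg_left _
  have hsymH : (inner ℂ (H v) u).re = (inner ℂ (H u) v).re := by
    have h1 : inner ℂ (H v) u = inner ℂ v (H u) := hH.isSymmetric v u
    rw [h1]
    exact inner_re_symm (𝕜 := ℂ) v (H u)
  have hsymd : (inner ℂ (d.op n ⟨v, hvm⟩) u).re = (inner ℂ (d.op n ⟨u, hm⟩) v).re := by
    have h1 := FourierMult.inner_op d n ⟨v, hvm⟩ ⟨u, hm⟩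
    have h2 : (inner ℂ (d.op n ⟨v, hvm⟩) u).re = (inner ℂ v (d.op n ⟨u, hm⟩)).re :=
      congrArg Complex.re h1
    rw [h2]
    exact inner_re_symm (𝕜 := ℂ) v _
  rw [LinearPMap.map_sub] at hnn
  simp only [map_sub, inner_sub_left, inner_sub_right, Complex.sub_re] at hnn hHnn
  have huψ : (inner ℂ u ψ).re = (inner ℂ (H u) u).re + (inner ℂ (d.op n ⟨u, hm⟩) u).re := by
    have : (inner ℂ u ψ).re = (inner ℂ ψ u).re := inner_re_symm (𝕜 := ℂ) u ψ
    rw [this]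
    conv_lhs => rw [e1]
    rw [inner_add_left, Complex.add_re]
  have hvψ : (inner ℂ v ψ).re = (inner ℂ (H u) v).re + (inner ℂ (d.op n ⟨u, hm⟩) v).re := by
    have : (inner ℂ v ψ).re = (inner ℂ ψ v).re := inner_re_symm (𝕜 := ℂ) v ψ
    rw [this]
    conv_lhs => rw [e1]
    rw [inner_add_left, Complex.add_re]
  have hvψ' : (inner ℂ v ψ).re = ∑' k, (lam - laplacian n k + g k)⁻¹ * ‖(ψ : L2Seq n) k‖ ^ 2 := by
    have h := hasSum_re_inner v ψ
    rw [← h.tsum_eq]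
    refine tsum_congr fun k => ?_
    rw [hvk, hmk]
    simp only [RCLike.inner_apply, map_mul, Complex.conj_ofReal]
    rw [mul_left_comm, Complex.mul_conj, ← Complex.ofReal_mul, Complex.ofReal_re,
      Complex.normSq_eq_norm_sq]
  have hsum : (inner ℂ (d.op n ⟨v, hvm⟩) v).re + (inner ℂ (H v) v).re ≤
      ∑' k, (lam - laplacian n k + g k)⁻¹ * ‖(ψ : L2Seq n) k‖ ^ 2 := by
    simp only [← hvn, add_mul]
    rw [hdv.summable.tsum_add hgv, hdv.tsum_eq]
    linarith [hgH v hgv]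
  linarith

/-- Adjointness in the Fock inner products moves the outer 𝒜₊* to the other side; the weight becomes
(n+1)! because the form now lives one chaos higher. -/
theorem fockInner_opH (w : EuclideanSpace ℝ (Fin 2)) (N : ℕ) (lam : ℝ) (k n : ℕ) (φ : chaos n) :
    (fockInner n (opH w N lam (k + 3) n φ) φ).re = ((n + 1).factorial : ℝ) *
      (inner ℂ (boundedInverse (resolventArg lam (n + 1) (opH w N lam (k + 2) (n + 1)))
        (creation w N n φ)) (creation w N n φ)).re := by
  set R := boundedInverse (resolventArg lam (n + 1) (opH w N lam (k + 2) (n + 1)))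
  set ψ := creation w N n φ
  have h := fockInner_creation w N n φ (R ψ)
  have e : opH w N lam (k + 3) n φ = creationAdj w N n (R ψ) := rfl
  have h1 : (fockInner n (creationAdj w N n (R ψ)) φ).re =
      (fockInner n φ (creationAdj w N n (R ψ))).re := by
    simp only [fockInner, ← Complex.ofReal_natCast, Complex.re_ofReal_mul]
    congr 1
    exact inner_re_symm (𝕜 := ℂ) _ _
  rw [e, h1, ← h]
  simp only [fockInner, ← Complex.ofReal_natCast, Complex.re_ofReal_mul]
  congr 1
  exact inner_re_symm (𝕜 := ℂ) _ _

/-! ### Planar integrals in polar coordinates -/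

/-- The usual primitive arctan(t tan x), t = √(a/(a+b)), jumps at the poles of the tangent. Writing
arctan(t tan x) = x + arctan of the tangent of the difference gives a primitive that is smooth on
the whole line. -/
theorem hasDerivAt_angular {a b : ℝ} (ha : 0 < a) (hb : 0 ≤ b) (x₀ x : ℝ) :
    HasDerivAt (fun x => ((x - x₀) + Real.arctan
      ((√(a / (a + b)) - 1) * (Real.sin (x - x₀) * Real.cos (x - x₀)) /
        (Real.cos (x - x₀) ^ 2 + √(a / (a + b)) * Real.sin (x - x₀) ^ 2))) / √(a * (a + b)))
      (1 / (a + b * Real.cos (x - x₀) ^ 2)) x := by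
  set t := √(a / (a + b)) with ht
  have hab : 0 < a + b := by linarith
  have ht0 : 0 < t := Real.sqrt_pos.mpr (div_pos ha hab)
  have ht2 : t ^ 2 * (a + b) = a := by
    rw [ht, Real.sq_sqrt (div_pos ha hab).le]
    field_simp
  have hs : √(a * (a + b)) = t * (a + b) := by
    rw [Real.sqrt_eq_iff_mul_self_eq (by positivity) (by positivity)]
    nlinarith
  set s := Real.sin (x - x₀) with hsdef
  set c := Real.cos (x - x₀) with hcdef
  have hsc : s ^ 2 + c ^ 2 = 1 := Real.sin_sq_add_cos_sq _
  have hv : 0 < c ^ 2 + t * s ^ 2 := by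
    by_cases h : s = 0
    · have : c ^ 2 = 1 := by rw [h] at hsc; linarith
      rw [h, this]; norm_num
    · positivity
  have hv2 : 0 < c ^ 2 + t ^ 2 * s ^ 2 := by
    by_cases h : s = 0
    · have : c ^ 2 = 1 := by rw [h] at hsc; linarith
      rw [h, this]; norm_num
    · positivity
  have hx : HasDerivAt (fun x => x - x₀) 1 x := (hasDerivAt_id x).sub_const x₀
  have h1 : HasDerivAt (fun x => Real.sin (x - x₀)) c x :=
    hx.sin.congr_deriv (mul_one _)
  have h2 : HasDerivAt (fun x => Real.cos (x - x₀)) (-s) x :=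
    hx.cos.congr_deriv (mul_one _)
  have hu : HasDerivAt (fun x => (t - 1) * (Real.sin (x - x₀) * Real.cos (x - x₀)))
      ((t - 1) * (c * c + s * (-s))) x := (h1.mul h2).const_mul (t - 1)
  have hvd : HasDerivAt (fun x => Real.cos (x - x₀) ^ 2 + t * Real.sin (x - x₀) ^ 2)
      (2 * c * (-s) + t * (2 * s * c)) x := by
    refine ((h2.pow 2).add ((h1.pow 2).const_mul t)).congr_deriv ?_
    simp only [← hsdef, ← hcdef]
    norm_num
  have h3 := ((hx.add ((hu.div hvd hv.ne').arctan)).div_const √(a * (a + b)))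
  refine h3.congr_deriv ?_
  simp only [← hsdef, ← hcdef]
  rw [hs]
  have hden : 1 + ((t - 1) * (s * c) / (c ^ 2 + t * s ^ 2)) ^ 2 =
      (c ^ 2 + t ^ 2 * s ^ 2) / (c ^ 2 + t * s ^ 2) ^ 2 := by
    field_simp
    have : c ^ 2 + t ^ 2 * s ^ 2 = (s ^ 2 + c ^ 2) * (c ^ 2 + t ^ 2 * s ^ 2) := by rw [hsc, one_mul]
    rw [this]
    ring
  simp only [Pi.div_apply]
  rw [hden]
  have hnum : (t - 1) * (c * c + s * -s) * (c ^ 2 + t * s ^ 2) -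
      (t - 1) * (s * c) * (2 * c * -s + t * (2 * s * c)) = (t - 1) * (c ^ 2 - t * s ^ 2) := by
    have : (t - 1) * (c ^ 2 - t * s ^ 2) = (s ^ 2 + c ^ 2) * ((t - 1) * (c ^ 2 - t * s ^ 2)) := by
      rw [hsc, one_mul]
    rw [this]
    ring
  rw [hnum]
  have hden2 : a + b * c ^ 2 = (a + b) * (c ^ 2 + t ^ 2 * s ^ 2) := by
    have : a = a * (s ^ 2 + c ^ 2) := by rw [hsc, mul_one]
    linear_combination this - s ^ 2 * ht2
  rw [hden2]
  have := hab.ne'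
  field_simp
  linear_combination (t) * hsc

/-- Over a full period the arctangent part returns to its value, and only the linear term
contributes. -/
theorem integral_angular {a b : ℝ} (ha : 0 < a) (hb : 0 ≤ b) (x₀ : ℝ) :
    ∫ x in (-Real.pi)..Real.pi, 1 / (a + b * Real.cos (x - x₀) ^ 2) =
      2 * Real.pi / √(a * (a + b)) := by
  rw [intervalIntegral.integral_eq_sub_of_hasDerivAt
    (fun x _ => hasDerivAt_angular ha hb x₀ x)]
  · have e1 : Real.sin (Real.pi - x₀) = Real.sin (-Real.pi - x₀) := by
      rw [show Real.pi - x₀ = -Real.pi - x₀ + 2 * Real.pi by ring, Real.sin_add_two_pi]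
    have e2 : Real.cos (Real.pi - x₀) = Real.cos (-Real.pi - x₀) := by
      rw [show Real.pi - x₀ = -Real.pi - x₀ + 2 * Real.pi by ring, Real.cos_add_two_pi]
    rw [e1, e2]
    ring
  · refine Continuous.intervalIntegrable ?_ _ _
    refine continuous_const.div (by fun_prop) fun x => ?_
    positivity

/-- The point of the Euclidean plane with coordinates `y`. -/
def planePoint (y : ℝ × ℝ) : EuclideanSpace ℝ (Fin 2) := !₂[y.1, y.2]

theorem norm_planePoint (y : ℝ × ℝ) : ‖planePoint y‖ = √(y.1 ^ 2 + y.2 ^ 2) := by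
  simp [planePoint, EuclideanSpace.norm_eq, Fin.sum_univ_two]

theorem inner_planePoint (w : EuclideanSpace ℝ (Fin 2)) (y : ℝ × ℝ) :
    inner ℝ w (planePoint y) = w 0 * y.1 + w 1 * y.2 := by
  simp [planePoint, PiLp.inner_apply, Fin.sum_univ_two, mul_comm]

theorem measurable_planePoint : Measurable planePoint := by
  have : Continuous planePoint := by
    unfold planePoint
    fun_prop
  exact this.measurable

theorem exists_eq_norm_mul_cos (w : EuclideanSpace ℝ (Fin 2)) :
    ∃ x₀, w 0 = ‖w‖ * Real.cos x₀ ∧ w 1 = ‖w‖ * Real.sin x₀ := by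
  have h : ‖(⟨w 0, w 1⟩ : ℂ)‖ = ‖w‖ := by
    rw [Complex.norm_def, Complex.normSq_mk, EuclideanSpace.norm_eq, Fin.sum_univ_two]
    congr 1
    simp [sq]
  refine ⟨Complex.arg ⟨w 0, w 1⟩, ?_, ?_⟩
  · rw [← h, Complex.norm_mul_cos_arg]
  · rw [← h, Complex.norm_mul_sin_arg]

theorem lintegral_angular {a b : ℝ} (ha : 0 < a) (hb : 0 ≤ b) (w : EuclideanSpace ℝ (Fin 2)) (c : ℝ) :
    ∫⁻ x in Set.Ioo (-Real.pi) Real.pi,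
      ENNReal.ofReal (c / (a + b * (w 0 * Real.cos x + w 1 * Real.sin x) ^ 2)) =
      ENNReal.ofReal (2 * Real.pi * c / √(a * (a + b * ‖w‖ ^ 2))) := by
  -- Negative numerators occur in the lower bound, where 1 - 2t may change sign; then both sides are
  -- 0.
  rcases le_or_gt c 0 with hc | hc
  · have h1 : ∀ x, ENNReal.ofReal (c / (a + b * (w 0 * Real.cos x + w 1 * Real.sin x) ^ 2)) = 0 :=
      fun x => ENNReal.ofReal_of_nonpos (div_nonpos_of_nonpos_of_nonneg hc (by positivity))
    simp only [h1, lintegral_zero]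
    refine (ENNReal.ofReal_of_nonpos (div_nonpos_of_nonpos_of_nonneg ?_ (by positivity))).symm
    exact mul_nonpos_of_nonneg_of_nonpos (by positivity) hc
  obtain ⟨x₀, h0, h1⟩ := exists_eq_norm_mul_cos w
  have e : ∀ x, c / (a + b * (w 0 * Real.cos x + w 1 * Real.sin x) ^ 2) =
      c * (1 / (a + b * ‖w‖ ^ 2 * Real.cos (x - x₀) ^ 2)) := fun x => by
    rw [h0, h1, Real.cos_sub, mul_one_div]
    congr 2
    ring
  have hb' : 0 ≤ b * ‖w‖ ^ 2 := by positivity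
  have hcont : Continuous fun x => c * (1 / (a + b * ‖w‖ ^ 2 * Real.cos (x - x₀) ^ 2)) := by
    refine continuous_const.mul (continuous_const.div (by fun_prop) fun x => ?_)
    positivity
  simp only [e]
  rw [← ofReal_integral_eq_lintegral_ofReal]
  · rw [← integral_Ioc_eq_integral_Ioo, ← intervalIntegral.integral_of_le
      (by linarith [Real.pi_pos]), intervalIntegral.integral_const_mul, integral_angular ha hb']
    congr 1
    ring
  · exact (hcont.integrableOn_Icc (a := -Real.pi) (b := Real.pi)).mono_set Set.Ioo_subset_Icc_self
  · exact Filter.Eventually.of_forall fun x => by positivity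

/-- All planar integrals that occur are of this shape: radial coefficients, with the angle entering
only through (w·y)². Working with `ENNReal` integrals removes integrability conditions. -/
theorem lintegral_polar (w : EuclideanSpace ℝ (Fin 2)) {α β γ : ℝ → ℝ} (hα : Measurable α)
    (hβ : Measurable β) (hγ : Measurable γ) (hα0 : ∀ r, 0 < r → 0 < α r)
    (hβ0 : ∀ r, 0 < r → 0 ≤ β r) :
    ∫⁻ y : ℝ × ℝ, ENNReal.ofReal (γ ‖planePoint y‖ /
      (α ‖planePoint y‖ + β ‖planePoint y‖ * (inner ℝ w (planePoint y)) ^ 2)) =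
    ∫⁻ r in Set.Ioi (0 : ℝ), ENNReal.ofReal
      (2 * Real.pi * (r * γ r) / √(α r * (α r + β r * r ^ 2 * ‖w‖ ^ 2))) := by
  rw [← lintegral_comp_polarCoord_symm, polarCoord_target]
  have hmeas : Measurable fun p : ℝ × ℝ => ENNReal.ofReal p.1 • ENNReal.ofReal
      (γ ‖planePoint (polarCoord.symm p)‖ / (α ‖planePoint (polarCoord.symm p)‖ +
        β ‖planePoint (polarCoord.symm p)‖ * (inner ℝ w (planePoint (polarCoord.symm p))) ^ 2)) := by
    have hp : Measurable fun p : ℝ × ℝ => planePoint (polarCoord.symm p) :=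
      measurable_planePoint.comp continuous_polarCoord_symm.measurable
    have hn := hp.norm
    have hi : Measurable fun p : ℝ × ℝ => (inner ℝ w (planePoint (polarCoord.symm p)) : ℝ) :=
      measurable_const.inner hp
    refine measurable_fst.ennreal_ofReal.smul (Measurable.ennreal_ofReal ?_)
    exact (hγ.comp hn).div ((hα.comp hn).add ((hβ.comp hn).mul (hi.pow_const 2)))
  rw [Measure.volume_eq_prod, setLIntegral_prod _ hmeas.aemeasurable]
  refine setLIntegral_congr_fun measurableSet_Ioi fun r hr => ?_
  have hr0 : (0 : ℝ) < r := hr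
  have hnorm : ∀ x, ‖planePoint (polarCoord.symm (r, x))‖ = r := fun x => by
    rw [norm_planePoint, polarCoord_symm_apply]
    have : (r * Real.cos x) ^ 2 + (r * Real.sin x) ^ 2 = r ^ 2 := by
      linear_combination r ^ 2 * Real.sin_sq_add_cos_sq x
    simp only [this, Real.sqrt_sq hr0.le]
  have hin : ∀ x, inner ℝ w (planePoint (polarCoord.symm (r, x))) =
      r * (w 0 * Real.cos x + w 1 * Real.sin x) := fun x => by
    rw [inner_planePoint, polarCoord_symm_apply]
    ring
  simp only [hnorm, hin]
  rw [← lintegral_angular (hα0 r hr0) (mul_nonneg (hβ0 r hr0) (sq_nonneg r)) w (r * γ r)]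
  refine lintegral_congr fun x => ?_
  rw [smul_eq_mul, ← ENNReal.ofReal_mul hr0.le]
  congr 1
  rw [mul_div_assoc]
  congr 3
  ring

theorem ofReal_integral_le_lintegral {μ : Measure ℝ} {f : ℝ → ℝ} (hf : Integrable f μ) :
    ENNReal.ofReal (∫ x, f x ∂μ) ≤ ∫⁻ x, ENNReal.ofReal (f x) ∂μ := by
  refine ENNReal.ofReal_le_of_le_toReal ?_
  rw [integral_eq_lintegral_pos_part_sub_lintegral_neg_part hf]
  linarith [ENNReal.toReal_nonneg (a := ∫⁻ a, ENNReal.ofReal (-f a) ∂μ)]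

/-- Lower bound of an integral by a primitive. -/
theorem ofReal_sub_le_lintegral {a b : ℝ} (hab : a ≤ b) {F F' h : ℝ → ℝ}
    (hF : ∀ r ∈ Set.Icc a b, HasDerivAt F (F' r) r) (hF' : ContinuousOn F' (Set.Icc a b))
    (hle : ∀ r ∈ Set.Icc a b, F' r ≤ h r) :
    ENNReal.ofReal (F b - F a) ≤ ∫⁻ r in Set.Ioc a b, ENNReal.ofReal (h r) := by
  have hInt : IntervalIntegrable F' volume a b := by
    refine ContinuousOn.intervalIntegrable ?_
    rwa [Set.uIcc_of_le hab]
  rw [← intervalIntegral.integral_eq_sub_of_hasDerivAt (by rwa [Set.uIcc_of_le hab]) hInt,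
    intervalIntegral.integral_of_le hab]
  refine (ofReal_integral_le_lintegral hInt.1).trans ?_
  refine setLIntegral_mono' measurableSet_Ioc fun r hr => ?_
  exact ENNReal.ofReal_le_ofReal (hle r (Set.Ioc_subset_Icc_self hr))

/-- Upper bound of an integral by a primitive. -/
theorem lintegral_le_ofReal_sub {a b : ℝ} (hab : a ≤ b) {F F' h : ℝ → ℝ}
    (hF : ∀ r ∈ Set.Icc a b, HasDerivAt F (F' r) r) (hF' : ContinuousOn F' (Set.Icc a b))
    (hle : ∀ r ∈ Set.Ioc a b, h r ≤ F' r) (h0 : ∀ r ∈ Set.Ioc a b, 0 ≤ F' r) :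
    ∫⁻ r in Set.Ioc a b, ENNReal.ofReal (h r) ≤ ENNReal.ofReal (F b - F a) := by
  have hInt : IntervalIntegrable F' volume a b := by
    refine ContinuousOn.intervalIntegrable ?_
    rwa [Set.uIcc_of_le hab]
  rw [← intervalIntegral.integral_eq_sub_of_hasDerivAt (by rwa [Set.uIcc_of_le hab]) hInt,
    intervalIntegral.integral_of_le hab, ofReal_integral_eq_lintegral_ofReal hInt.1]
  · refine setLIntegral_mono' measurableSet_Ioc fun r hr => ?_
    exact ENNReal.ofReal_le_ofReal (hle r hr)
  · exact (ae_restrict_iff' measurableSet_Ioc).mpr (Filter.Eventually.of_forall h0)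

/-! ### Lattice sums and integrals over unit cells -/

/-- The unit cell with lower left corner `l`. -/
def cell (l : Mode) : Set (ℝ × ℝ) :=
  Set.Ico (l 0 : ℝ) (l 0 + 1) ×ˢ Set.Ico (l 1 : ℝ) (l 1 + 1)

theorem measurableSet_cell (l : Mode) : MeasurableSet (cell l) :=
  measurableSet_Ico.prod measurableSet_Ico

theorem volume_cell (l : Mode) : volume (cell l) = 1 := by
  rw [cell, Measure.volume_eq_prod, Measure.prod_prod]
  simp

theorem mem_cell_iff (l : Mode) (y : ℝ × ℝ) : y ∈ cell l ↔ l = ![⌊y.1⌋, ⌊y.2⌋] := by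
  simp only [cell, Set.mem_prod, Set.mem_Ico, ← Int.floor_eq_iff]
  constructor
  · rintro ⟨h0, h1⟩
    funext i
    fin_cases i <;> simp [h0, h1]
  · rintro rfl
    simp

theorem norm_planePoint_sub_le {l : Mode} {y : ℝ × ℝ} (hy : y ∈ cell l) :
    ‖planePoint y - l.vec‖ ^ 2 ≤ 2 := by
  rw [EuclideanSpace.norm_sq_eq, Fin.sum_univ_two]
  obtain ⟨⟨h1, h2⟩, h3, h4⟩ := hy
  simp only [planePoint, Mode.vec, PiLp.sub_apply, Real.norm_eq_abs, sq_abs]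
  simp
  nlinarith

theorem iUnion_cell : ⋃ l, cell l = Set.univ := by
  ext y
  simp [mem_cell_iff]

theorem lintegral_le_tsum_of_le_on_cell {g : ℝ × ℝ → ENNReal} {F : Mode → ENNReal}
    (h : ∀ l, ∀ y ∈ cell l, g y ≤ F l) : ∫⁻ y, g y ≤ ∑' l, F l := by
  rw [← setLIntegral_univ, ← iUnion_cell]
  refine (lintegral_iUnion_le _ _).trans (ENNReal.tsum_le_tsum fun l => ?_)
  refine (setLIntegral_mono' (measurableSet_cell l) (h l)).trans ?_
  rw [setLIntegral_const, volume_cell, mul_one]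

theorem tsum_le_lintegral_of_le_on_cell {g : ℝ × ℝ → ENNReal} {F : Mode → ENNReal}
    (h : ∀ l, ∀ y ∈ cell l, F l ≤ g y) : ∑' l, F l ≤ ∫⁻ y, g y := by
  rw [← setLIntegral_univ, ← iUnion_cell, lintegral_iUnion measurableSet_cell]
  · refine ENNReal.tsum_le_tsum fun l => ?_
    refine le_trans ?_ (setLIntegral_mono' (measurableSet_cell l) (h l))
    rw [setLIntegral_const, volume_cell, mul_one]
  · intro l l' hl
    refine Set.disjoint_left.mpr fun y hy hy' => hl ?_
    rw [mem_cell_iff] at hy hy'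
    rw [hy, hy']

theorem one_le_norm_vec {m : Mode} (hm : m ≠ 0) : 1 ≤ ‖m.vec‖ := by
  have hi : ∃ i, m i ≠ 0 := by
    by_contra h
    push Not at h
    exact hm (funext h)
  obtain ⟨i, hi⟩ := hi
  refine le_trans ?_ (PiLp.norm_apply_le m.vec i)
  have : ‖m.vec i‖ = ((|m i| : ℤ) : ℝ) := by rw [Real.norm_eq_abs, Int.cast_abs]; rfl
  rw [this]
  exact_mod_cast Int.one_le_abs hi

theorem vec_zero : Mode.vec 0 = 0 := by ext b; simp [Mode.vec]

theorem vec_sub (l m : Mode) : (l - m).vec = l.vec - m.vec := by ext b; simp [Mode.vec]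

/-- Uniformity in ρ comes from scaling: the integral of ρ/(|y|(|y|² + ρ²)) over the plane is π² for
every ρ. The factor 36 = 4 · 9 is the loss in passing from a lattice point to its cell, where |y| is
also replaced by 1 + |y|. -/
theorem tsum_lattice_kernel_le {ρ : ℝ} (hρ : 0 < ρ) :
    ∑' m : Mode, ENNReal.ofReal (ρ / (‖m.vec‖ * (‖m.vec‖ ^ 2 + ρ ^ 2))) ≤
      ENNReal.ofReal (36 * Real.pi ^ 2) := by
  have hmain : ∀ m : Mode, ∀ y ∈ cell m,
      ENNReal.ofReal (ρ / (‖m.vec‖ * (‖m.vec‖ ^ 2 + ρ ^ 2))) ≤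
      ENNReal.ofReal (36 * ρ / ((1 + ‖planePoint y‖) * (‖planePoint y‖ ^ 2 + ρ ^ 2) +
        0 * (inner ℝ (0 : EuclideanSpace ℝ (Fin 2)) (planePoint y)) ^ 2)) := by
    intro m y hy
    refine ENNReal.ofReal_le_ofReal ?_
    rw [zero_mul, add_zero]
    -- At the origin the kernel is a division by zero, that is 0.
    by_cases hm : m = 0
    · rw [hm, vec_zero, norm_zero, zero_mul, div_zero]
      positivity
    have h1 := one_le_norm_vec hm
    have h2 : ‖planePoint y - m.vec‖ ≤ 3 / 2 := by
      have := norm_planePoint_sub_le hy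
      nlinarith [norm_nonneg (planePoint y - m.vec)]
    have h3 : ‖planePoint y‖ ≤ ‖m.vec‖ + 3 / 2 := by
      have := norm_sub_norm_le (planePoint y) m.vec
      linarith
    have h0 := norm_nonneg (planePoint y)
    rw [div_le_div_iff₀ (by positivity) (by positivity), mul_assoc 36, mul_comm 36, mul_assoc ρ]
    refine mul_le_mul_of_nonneg_left ?_ hρ.le
    have h4 : 1 + ‖planePoint y‖ ≤ 4 * ‖m.vec‖ := by linarith
    have h5 : ‖planePoint y‖ ^ 2 + ρ ^ 2 ≤ 9 * (‖m.vec‖ ^ 2 + ρ ^ 2) := by nlinarith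
    calc (1 + ‖planePoint y‖) * (‖planePoint y‖ ^ 2 + ρ ^ 2)
        ≤ (4 * ‖m.vec‖) * (9 * (‖m.vec‖ ^ 2 + ρ ^ 2)) := by gcongr
      _ = _ := by ring
  refine (tsum_le_lintegral_of_le_on_cell hmain).trans ?_
  rw [lintegral_polar (0 : EuclideanSpace ℝ (Fin 2)) (α := fun r => (1 + r) * (r ^ 2 + ρ ^ 2))
    (β := fun _ => 0) (γ := fun _ => 36 * ρ) (by fun_prop) (by fun_prop) (by fun_prop)
    (fun r hr => by positivity) (fun r hr => le_rfl)]
  have hderiv : ∀ r ∈ Set.Ioi (0 : ℝ), HasDerivAt (fun r => 72 * Real.pi * Real.arctan (r / ρ))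
      (72 * Real.pi * (1 / (1 + (r / ρ) ^ 2) * (1 / ρ))) r := fun r _ =>
    (((hasDerivAt_id r).div_const ρ).arctan).const_mul _
  have hcont : ContinuousWithinAt (fun r => 72 * Real.pi * Real.arctan (r / ρ)) (Set.Ici 0) 0 := by
    refine Continuous.continuousWithinAt ?_
    fun_prop
  have hlim : Filter.Tendsto (fun r => 72 * Real.pi * Real.arctan (r / ρ)) Filter.atTop
      (nhds (72 * Real.pi * (Real.pi / 2))) := by
    refine Filter.Tendsto.const_mul _ ?_
    exact ((Real.tendsto_arctan_atTop.mono_right nhdsWithin_le_nhds).comp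
      (Filter.tendsto_id.atTop_div_const hρ))
  have hnn : ∀ r ∈ Set.Ioi (0 : ℝ), 0 ≤ 72 * Real.pi * (1 / (1 + (r / ρ) ^ 2) * (1 / ρ)) :=
    fun r _ => by positivity
  have hInt := integrableOn_Ioi_deriv_of_nonneg hcont hderiv hnn hlim
  have hval := integral_Ioi_of_hasDerivAt_of_nonneg hcont hderiv hnn hlim
  have hval' : 36 * Real.pi ^ 2 =
      ∫ r in Set.Ioi (0 : ℝ), 72 * Real.pi * (1 / (1 + (r / ρ) ^ 2) * (1 / ρ)) := by
    rw [hval]; simp; ring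
  rw [hval', ofReal_integral_eq_lintegral_ofReal hInt
    ((ae_restrict_iff' measurableSet_Ioi).mpr (Filter.Eventually.of_forall hnn))]
  refine setLIntegral_mono' measurableSet_Ioi fun r hr => ENNReal.ofReal_le_ofReal ?_
  have hr0 : (0 : ℝ) < r := hr
  rw [zero_mul, zero_mul, add_zero, Real.sqrt_mul_self (by positivity)]
  have : 72 * Real.pi * (1 / (1 + (r / ρ) ^ 2) * (1 / ρ)) =
      2 * Real.pi * (r * (36 * ρ)) / (r * (r ^ 2 + ρ ^ 2)) := by
    field_simp
    ring
  rw [this]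
  gcongr
  linarith

/-! ### Splitting one mode into two -/

/-- The inverse operation of `merge (j.succAbove b) j`: the mode `q b` is split into `q b - l` and
`l`, and `l` is inserted in position `j`. -/
def split {n : ℕ} (j : Fin (n + 1)) (b : Fin n) (q : Fin n → Mode) (l : Mode) :
    Fin (n + 1) → Mode :=
  Fin.insertNth (α := fun _ => Mode) j l (Function.update q b (q b - l))

section split

variable {n : ℕ} (j : Fin (n + 1)) (b : Fin n) (q : Fin n → Mode) (l : Mode)

theorem split_self : split j b q l j = l := by simp [split]

theorem split_succAbove : split j b q l (j.succAbove b) = q b - l := by simp [split]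

theorem split_succAbove_of_ne {b' : Fin n} (h : b' ≠ b) : split j b q l (j.succAbove b') = q b' := by
  simp [split, h]

theorem merge_split : merge (j.succAbove b) j (split j b q l) = q := by
  funext b'
  simp only [merge, Fin.removeNth_apply]
  by_cases h : b' = b
  · rw [h, Function.update_self, split_succAbove, split_self, sub_add_cancel]
  · rw [Function.update_of_ne (fun e => h (Fin.succAbove_right_injective e)),
      split_succAbove_of_ne _ _ _ _ h]

theorem split_merge (k : Fin (n + 1) → Mode) :
    split j b (merge (j.succAbove b) j k) (k j) = k := by
  refine merge_injective (j.succAbove b) j ?_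
  simp only [merge_split, split_self]

/-- Splitting and merging as a bijection. -/
def splitEquiv : (Fin n → Mode) × Mode ≃ (Fin (n + 1) → Mode) where
  toFun p := split j b p.1 p.2
  invFun k := (merge (j.succAbove b) j k, k j)
  left_inv p := by simp only [merge_split, split_self]
  right_inv k := split_merge j b k

theorem sum_split (F : Mode → ℝ) :
    ∑ i, F (split j b q l i) + F (q b) = F l + F (q b - l) + ∑ i, F (q i) := by
  rw [Fin.sum_univ_succAbove _ j, split_self, ← Finset.add_sum_erase _ _ (Finset.mem_univ b),
    split_succAbove, ← Finset.add_sum_erase Finset.univ (fun i => F (q i)) (Finset.mem_univ b)]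
  have : ∑ i ∈ Finset.univ.erase b, F (split j b q l (j.succAbove i)) =
      ∑ i ∈ Finset.univ.erase b, F (q i) :=
    Finset.sum_congr rfl fun i hi => by
      rw [split_succAbove_of_ne _ _ _ _ (Finset.ne_of_mem_erase hi)]
  rw [this]
  ring

end split

/-! ### The terms of the creation operator -/

/-- `(w·p)²`, restricted to `|p| ≤ N`. -/
def bandSq (w : EuclideanSpace ℝ (Fin 2)) (N : ℕ) (p : Mode) : ℝ :=
  open Classical in if ‖p.vec‖ ≤ N then (inner ℝ w p.vec) ^ 2 else 0

theorem bandSq_nonneg (w : EuclideanSpace ℝ (Fin 2)) (N : ℕ) (p : Mode) : 0 ≤ bandSq w N p := by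
  unfold bandSq
  split_ifs <;> positivity

theorem bandSq_le (w : EuclideanSpace ℝ (Fin 2)) (N : ℕ) (p : Mode) :
    bandSq w N p ≤ (inner ℝ w p.vec) ^ 2 := by
  unfold bandSq
  split_ifs
  · exact le_rfl
  · positivity

theorem bandSq_le_const (w : EuclideanSpace ℝ (Fin 2)) (N : ℕ) (p : Mode) :
    bandSq w N p ≤ (‖w‖ * N) ^ 2 := by
  unfold bandSq
  split_ifs with h
  · rw [← sq_abs]
    refine pow_le_pow_left₀ (abs_nonneg _) ?_ 2
    exact (abs_real_inner_le_norm _ _).trans (mul_le_mul_of_nonneg_left h (norm_nonneg _))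
  · positivity

theorem cutoff_nonneg (N : ℕ) (l m : Mode) : 0 ≤ cutoff N l m := by
  unfold cutoff
  split_ifs <;> norm_num

theorem cutoff_le_one (N : ℕ) (l m : Mode) : cutoff N l m ≤ 1 := by
  unfold cutoff
  split_ifs <;> norm_num

theorem of_cutoff_ne_zero {N : ℕ} {l m : Mode} (h : cutoff N l m ≠ 0) :
    (0 < ‖l.vec‖ ∧ ‖l.vec‖ ≤ N) ∧ (0 < ‖m.vec‖ ∧ ‖m.vec‖ ≤ N) ∧
    (0 < ‖(l + m).vec‖ ∧ ‖(l + m).vec‖ ≤ N) := by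
  unfold cutoff at h
  by_contra hc
  rw [if_neg hc] at h
  exact h rfl

/-- The cutoff is idempotent and contains the condition |l + m| ≤ N. Putting that condition into
`bandSq` keeps the symbol bounded, so the later sums converge for every φ. -/
theorem creationCoeff_sq (w : EuclideanSpace ℝ (Fin 2)) (N : ℕ) (l m : Mode) :
    creationCoeff w N l m ^ 2 = bandSq w N (l + m) * cutoff N l m := by
  by_cases h : cutoff N l m = 0
  · simp [creationCoeff, h]
  · have h1 := (of_cutoff_ne_zero h).2.2.2
    have h2 : cutoff N l m = 1 := by
      unfold cutoff at h ⊢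
      split_ifs at h ⊢ with hc
      · rfl
      · exact absurd rfl h
    simp [creationCoeff, bandSq, h1, h2]

theorem creationPair_apply (w : EuclideanSpace ℝ (Fin 2)) (N : ℕ) {n : ℕ} (i j : Fin (n + 1))
    (φ : L2Seq n) (k : Fin (n + 1) → Mode) :
    creationPair w N i j φ k = (creationCoeff w N (k i) (k j) : ℂ) * φ (merge i j k) := rfl

theorem norm_creationPair_split (w : EuclideanSpace ℝ (Fin 2)) (N : ℕ) {n : ℕ} (j : Fin (n + 1))
    (b : Fin n) (φ : L2Seq n) (q : Fin n → Mode) (l : Mode) :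
    ‖creationPair w N (j.succAbove b) j φ (split j b q l)‖ ^ 2 =
      bandSq w N (q b) * cutoff N (q b - l) l * ‖φ q‖ ^ 2 := by
  rw [creationPair_apply, merge_split, split_succAbove, split_self, norm_mul, mul_pow,
    Complex.norm_real, Real.norm_eq_abs, sq_abs, creationCoeff_sq, sub_add_cancel]

theorem finite_support_cutoff (N : ℕ) (p : Mode) :
    (Function.support fun l : Mode => cutoff N (p - l) l).Finite := by
  refine Set.Finite.subset (Finset.finite_toSet
    (Finset.Icc (fun _ => -(N : ℤ) : Mode) (fun _ => (N : ℤ)))) fun (l : Mode) hl => ?_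
  have hm := (of_cutoff_ne_zero hl).2.1.2
  have hi : ∀ i, |l i| ≤ (N : ℤ) := fun i => by
    have h1 := (PiLp.norm_apply_le l.vec i).trans hm
    have h2 : ‖l.vec i‖ = ((|l i| : ℤ) : ℝ) := by
      rw [Real.norm_eq_abs, Int.cast_abs]; rfl
    rw [h2] at h1
    exact_mod_cast h1
  rw [Finset.mem_coe, Finset.mem_Icc]
  exact ⟨fun i => (abs_le.mp (hi i)).1, fun i => (abs_le.mp (hi i)).2⟩

theorem summable_cutoff_mul (N : ℕ) (p : Mode) (E : Mode → ℝ) :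
    Summable fun l => cutoff N (p - l) l * E l := by
  refine summable_of_hasFiniteSupport ((finite_support_cutoff N p).subset fun l hl => ?_)
  exact left_ne_zero_of_mul hl

/-! ### The quadratic form of a single merged pair. -/

section pairs

variable {w : EuclideanSpace ℝ (Fin 2)} {N n : ℕ} (φ : chaos n) {E : (Fin (n + 1) → Mode) → ℝ}

/-- For a fixed pair, k corresponds bijectively to the merged configuration q and the mode l at
position j, and φ is evaluated at q only. Summing over l first therefore leaves a Fourier multiplier
in q. -/
theorem hasSum_pair {C : ℝ} (hE : ∀ k, |E k| ≤ C) (j : Fin (n + 1)) (b : Fin n) :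
    HasSum (fun q => bandSq w N (q b) * (∑' l, cutoff N (q b - l) l * E (split j b q l)) *
      ‖(φ : L2Seq n) q‖ ^ 2)
      (∑' k, E k * ‖creationPair w N (j.succAbove b) j (φ : L2Seq n) k‖ ^ 2) := by
  have hs := summable_mul_norm_sq (creationPair w N (j.succAbove b) j (φ : L2Seq n)) hE
  rw [← (splitEquiv j b).tsum_eq]
  have hs' := (splitEquiv j b).summable_iff.mpr hs
  have h := hs'.prod.hasSum
  rw [← hs'.tsum_prod] at h
  refine Eq.mp (congrArg (fun F => HasSum F _) ?_) h
  funext q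
  rw [← tsum_mul_left, ← tsum_mul_right]
  refine tsum_congr fun l => ?_
  simp only [Function.comp_apply]
  change E (split j b q l) * ‖creationPair w N (j.succAbove b) j (φ : L2Seq n) (split j b q l)‖ ^ 2 = _
  rw [norm_creationPair_split]
  ring

theorem abs_bandSq_mul_le {s : (Fin n → Mode) → ℝ} {Cs : ℝ} (hs : ∀ q, |s q| ≤ Cs) (b : Fin n)
    (q : Fin n → Mode) : |bandSq w N (q b) * s q| ≤ (‖w‖ * N) ^ 2 * Cs := by
  rw [abs_mul, abs_of_nonneg (bandSq_nonneg _ _ _)]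
  exact mul_le_mul (bandSq_le_const _ _ _) (hs q) (abs_nonneg _) (by positivity)

theorem le_tsum_pair {C : ℝ} (hE : ∀ k, |E k| ≤ C) (j : Fin (n + 1)) (b : Fin n)
    {s : (Fin n → Mode) → ℝ} {Cs : ℝ} (hsC : ∀ q, |s q| ≤ Cs)
    (hs : ∀ q, (∀ i, q i ≠ 0) → ‖(q b).vec‖ ≤ N →
      s q ≤ ∑' l, cutoff N (q b - l) l * E (split j b q l)) :
    ∑' q, bandSq w N (q b) * s q * ‖(φ : L2Seq n) q‖ ^ 2 ≤
      ∑' k, E k * ‖creationPair w N (j.succAbove b) j (φ : L2Seq n) k‖ ^ 2 := by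
  refine hasSum_le (fun q => ?_)
    (summable_mul_norm_sq (φ : L2Seq n) (abs_bandSq_mul_le hsC b)).hasSum (hasSum_pair φ hE j b)
  by_cases hq : ∀ i, q i ≠ 0
  · by_cases hN : ‖(q b).vec‖ ≤ N
    · exact mul_le_mul_of_nonneg_right (mul_le_mul_of_nonneg_left (hs q hq hN)
        (bandSq_nonneg _ _ _)) (sq_nonneg _)
    · simp [bandSq, hN]
  · push Not at hq
    obtain ⟨i, hi⟩ := hq
    simp [φ.2.2 q i hi]

theorem tsum_pair_le {C : ℝ} (hE : ∀ k, |E k| ≤ C) (j : Fin (n + 1)) (b : Fin n)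
    {s : (Fin n → Mode) → ℝ} {Cs : ℝ} (hsC : ∀ q, |s q| ≤ Cs)
    (hs : ∀ q, (∀ i, q i ≠ 0) → ‖(q b).vec‖ ≤ N →
      ∑' l, cutoff N (q b - l) l * E (split j b q l) ≤ s q) :
    ∑' k, E k * ‖creationPair w N (j.succAbove b) j (φ : L2Seq n) k‖ ^ 2 ≤
      ∑' q, bandSq w N (q b) * s q * ‖(φ : L2Seq n) q‖ ^ 2 := by
  refine hasSum_le (fun q => ?_) (hasSum_pair φ hE j b)
    (summable_mul_norm_sq (φ : L2Seq n) (abs_bandSq_mul_le hsC b)).hasSum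
  by_cases hq : ∀ i, q i ≠ 0
  · by_cases hN : ‖(q b).vec‖ ≤ N
    · exact mul_le_mul_of_nonneg_right (mul_le_mul_of_nonneg_left (hs q hq hN)
        (bandSq_nonneg _ _ _)) (sq_nonneg _)
    · simp [bandSq, hN]
  · push Not at hq
    obtain ⟨i, hi⟩ := hq
    simp [φ.2.2 q i hi]

/-- Exchanging two positions changes neither |φ̂|² nor s, so every b gives the same sum. -/
theorem mul_tsum_bandSq {s : (Fin n → Mode) → ℝ} {Cs : ℝ} (hsC : ∀ q, |s q| ≤ Cs)
    (hsymm : ∀ (σ : Equiv.Perm (Fin n)) q, s (q ∘ σ) = s q) (b : Fin n) :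
    n * ∑' q, bandSq w N (q b) * s q * ‖(φ : L2Seq n) q‖ ^ 2 =
      ∑' q, (∑ b, bandSq w N (q b)) * s q * ‖(φ : L2Seq n) q‖ ^ 2 := by
  have h : ∀ b', ∑' q, bandSq w N (q b') * s q * ‖(φ : L2Seq n) q‖ ^ 2 =
      ∑' q, bandSq w N (q b) * s q * ‖(φ : L2Seq n) q‖ ^ 2 := fun b' => by
    rw [← (Equiv.arrowCongr (Equiv.swap b b') (Equiv.refl Mode)).tsum_eq]
    refine tsum_congr fun q => ?_
    have e : (Equiv.arrowCongr (Equiv.swap b b') (Equiv.refl Mode)) q = q ∘ Equiv.swap b b' := by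
      funext i
      simp [Equiv.arrowCongr]
    rw [e, hsymm, φ.2.1]
    simp
  simp only [Finset.sum_mul]
  rw [Summable.tsum_finsetSum fun b' _ =>
    summable_mul_norm_sq (φ : L2Seq n) (abs_bandSq_mul_le hsC b')]
  simp [h]

end pairs

/-! ### Off-diagonal terms -/

/-- The difference is the sum of the inner products with P ≠ P'. Each is bounded by half of two
weighted squares, and exchanging the names P and P' identifies the two halves. -/
theorem abs_norm_sum_sq_sub_le {ι : Type*} [DecidableEq ι] (S : Finset ι) (x : ι → ℂ) (ρ : ι → ι → ℝ)
    (h : ∀ P ∈ S, ∀ P' ∈ S, P ≠ P' →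
      2 * (‖x P‖ * ‖x P'‖) ≤ ρ P P' * ‖x P‖ ^ 2 + ρ P' P * ‖x P'‖ ^ 2) :
    |‖∑ P ∈ S, x P‖ ^ 2 - ∑ P ∈ S, ‖x P‖ ^ 2| ≤
      ∑ P ∈ S, ∑ P' ∈ S.erase P, ρ P P' * ‖x P‖ ^ 2 := by
  have e1 : ‖∑ P ∈ S, x P‖ ^ 2 = ∑ P ∈ S, ∑ P' ∈ S, (inner ℝ (x P) (x P') : ℝ) := by
    rw [← real_inner_self_eq_norm_sq, sum_inner]
    exact Finset.sum_congr rfl fun P _ => by rw [inner_sum]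
  have e2 : ‖∑ P ∈ S, x P‖ ^ 2 - ∑ P ∈ S, ‖x P‖ ^ 2 =
      ∑ P ∈ S, ∑ P' ∈ S.erase P, (inner ℝ (x P) (x P') : ℝ) := by
    rw [e1, ← Finset.sum_sub_distrib]
    refine Finset.sum_congr rfl fun P hP => ?_
    rw [← Finset.add_sum_erase _ _ hP, real_inner_self_eq_norm_sq]
    ring
  have hcomm : ∑ P ∈ S, ∑ P' ∈ S.erase P, ρ P' P * ‖x P'‖ ^ 2 =
      ∑ P ∈ S, ∑ P' ∈ S.erase P, ρ P P' * ‖x P‖ ^ 2 := by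
    refine Finset.sum_comm' fun P P' => ?_
    simp only [Finset.mem_erase]
    tauto
  rw [e2]
  calc |∑ P ∈ S, ∑ P' ∈ S.erase P, (inner ℝ (x P) (x P') : ℝ)|
      ≤ ∑ P ∈ S, ∑ P' ∈ S.erase P, (ρ P P' * ‖x P‖ ^ 2 + ρ P' P * ‖x P'‖ ^ 2) / 2 := by
        refine (Finset.abs_sum_le_sum_abs _ _).trans (Finset.sum_le_sum fun P hP => ?_)
        refine (Finset.abs_sum_le_sum_abs _ _).trans (Finset.sum_le_sum fun P' hP' => ?_)
        have h1 := h P hP P' (Finset.mem_of_mem_erase hP') (Finset.ne_of_mem_erase hP').symm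
        have h2 := abs_real_inner_le_norm (x P) (x P')
        linarith
    _ = _ := by
        simp only [← Finset.sum_div, Finset.sum_add_distrib]
        rw [hcomm]
        ring

/-- The pairs `i < j`. -/
def pairs (n : ℕ) : Finset (Fin (n + 1) × Fin (n + 1)) := {P | P.1 < P.2}

theorem sum_pairs {M : Type*} [AddCommMonoid M] {n : ℕ} (g : Fin (n + 1) → Fin (n + 1) → M) :
    ∑ i, ∑ j ∈ Finset.Ioi i, g i j = ∑ P ∈ pairs n, g P.1 P.2 := by
  rw [pairs, Finset.sum_filter, ← Finset.univ_product_univ, Finset.sum_product]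
  refine Finset.sum_congr rfl fun i _ => ?_
  rw [← Finset.sum_filter]
  congr 1
  ext j
  simp

theorem card_pairs (n : ℕ) : ((pairs n).card : ℝ) = n * (n + 1) / 2 := by
  have h1 : (pairs n).card = ∑ i : Fin (n + 1), (n - (i : ℕ)) := by
    have := sum_pairs (n := n) (fun _ _ => (1 : ℕ))
    simp only [Finset.sum_const, smul_eq_mul, mul_one, Fin.card_Ioi] at this
    rw [← this]
    exact Finset.sum_congr rfl fun i _ => by omega
  have h2 : ∑ i : Fin (n + 1), (n - (i : ℕ)) = ∑ i ∈ Finset.range (n + 1), i := by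
    rw [Fin.sum_univ_eq_sum_range (fun i => n - i) (n + 1)]
    exact Finset.sum_range_reflect (fun i => i) (n + 1)
  have h3 := Finset.sum_range_id_mul_two (n + 1)
  rw [h1, h2]
  have h4 : ((∑ i ∈ Finset.range (n + 1), i : ℕ) : ℝ) * 2 = (n + 1) * n := by exact_mod_cast h3
  linarith

/-- An element of the pair `P` that is not in the pair `P'`. -/
def excl {n : ℕ} (P P' : Fin (n + 1) × Fin (n + 1)) : Fin (n + 1) :=
  if P.1 = P'.1 ∨ P.1 = P'.2 then P.2 else P.1

theorem excl_mem {n : ℕ} (P P' : Fin (n + 1) × Fin (n + 1)) : excl P P' = P.1 ∨ excl P P' = P.2 := by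
  unfold excl
  split_ifs <;> simp

theorem excl_ne {n : ℕ} {P P' : Fin (n + 1) × Fin (n + 1)} (hP : P ∈ pairs n) (hP' : P' ∈ pairs n)
    (h : P ≠ P') : excl P P' ≠ P'.1 ∧ excl P P' ≠ P'.2 := by
  obtain ⟨a, b⟩ := P
  obtain ⟨a', b'⟩ := P'
  simp only [pairs, Finset.mem_filter, Finset.mem_univ, true_and] at hP hP'
  simp only [ne_eq, Prod.mk.injEq, not_and] at h
  unfold excl
  simp only
  split_ifs with hc
  · rcases hc with rfl | rfl
    · exact ⟨hP.ne', h rfl⟩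
    · exact ⟨(hP'.trans hP).ne', hP.ne'⟩
  · push Not at hc
    exact hc

/-- The weights in the Cauchy-Schwarz inequality for the off-diagonal terms. -/
def pairWeight {n : ℕ} (P P' : Fin (n + 1) × Fin (n + 1)) (k : Fin (n + 1) → Mode) : ℝ :=
  ‖(k (excl P' P)).vec‖ / ‖(k (excl P P')).vec‖

theorem creationPair_eq_zero {w : EuclideanSpace ℝ (Fin 2)} {N n : ℕ} {i j : Fin (n + 1)}
    (φ : L2Seq n) {k : Fin (n + 1) → Mode} {e : Fin (n + 1)} (he : e = i ∨ e = j) (hk : k e = 0) :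
    creationPair w N i j φ k = 0 := by
  rw [creationPair_apply]
  have : cutoff N (k i) (k j) = 0 := by
    by_contra h
    have h' := of_cutoff_ne_zero h
    rcases he with rfl | rfl
    · simp [hk, vec_zero] at h'
    · simp [hk, vec_zero] at h'
  simp [creationCoeff, this]

/-- The two weights are reciprocal to each other when both modes are nonzero, so this is Young's
inequality. If one of the modes vanishes, so does the term of the pair containing it, by the cutoff.
-/
theorem two_mul_norm_creationPair_le {w : EuclideanSpace ℝ (Fin 2)} {N n : ℕ} (φ : L2Seq n)
    (k : Fin (n + 1) → Mode) (P P' : Fin (n + 1) × Fin (n + 1)) :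
    2 * (‖creationPair w N P.1 P.2 φ k‖ * ‖creationPair w N P'.1 P'.2 φ k‖) ≤
      pairWeight P P' k * ‖creationPair w N P.1 P.2 φ k‖ ^ 2 +
      pairWeight P' P k * ‖creationPair w N P'.1 P'.2 φ k‖ ^ 2 := by
  have hnn : ∀ P P', 0 ≤ pairWeight (n := n) P P' k := fun P P' => by
    unfold pairWeight; positivity
  by_cases h1 : k (excl P P') = 0
  · rw [creationPair_eq_zero φ (excl_mem P P') h1]
    simpa using mul_nonneg (hnn P' P) (sq_nonneg ‖creationPair w N P'.1 P'.2 φ k‖)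
  by_cases h2 : k (excl P' P) = 0
  · rw [creationPair_eq_zero φ (excl_mem P' P) h2]
    simpa using mul_nonneg (hnn P P') (sq_nonneg ‖creationPair w N P.1 P.2 φ k‖)
  have h1' := one_le_norm_vec h1
  have h2' := one_le_norm_vec h2
  unfold pairWeight
  set a := ‖creationPair w N P.1 P.2 φ k‖
  set b := ‖creationPair w N P'.1 P'.2 φ k‖
  set u := ‖(k (excl P P')).vec‖
  set v := ‖(k (excl P' P)).vec‖
  have hu : 0 < u := by linarith
  have hv : 0 < v := by linarith
  have : v / u * a ^ 2 + u / v * b ^ 2 - 2 * (a * b) = (v * a - u * b) ^ 2 / (u * v) := by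
    field_simp
    ring
  have h3 : 0 ≤ (v * a - u * b) ^ 2 / (u * v) := by positivity
  linarith

theorem tsum_le_of_tsum_ofReal_le {f : Mode → ℝ} (hf : Summable f) (h0 : ∀ l, 0 ≤ f l) {C : ℝ}
    (hC : 0 ≤ C) (h : ∑' l, ENNReal.ofReal (f l) ≤ ENNReal.ofReal C) : ∑' l, f l ≤ C := by
  rw [← ENNReal.ofReal_tsum_of_nonneg h0 hf] at h
  exact (ENNReal.ofReal_le_ofReal_iff hC).mp h

/-! ### Comparison of the form of 𝒜₊* D 𝒜₊ with its diagonal part. -/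

section form

variable {w : EuclideanSpace ℝ (Fin 2)} {N n : ℕ} (φ : chaos n) {D : (Fin (n + 1) → Mode) → ℝ}

theorem mul_pairWeight_le {CD : ℝ} (hDsq : ∀ k, D k * ∑ i, ‖(k i).vec‖ ^ 2 ≤ CD)
    (hD0 : ∀ k, 0 ≤ D k) {P P' : Fin (n + 1) × Fin (n + 1)}
    (hne : excl P P' ≠ excl P' P) (k : Fin (n + 1) → Mode) :
    D k * pairWeight P P' k ≤ CD * (‖(k (excl P' P)).vec‖ / (‖(k (excl P P')).vec‖ *
      (‖(k (excl P P')).vec‖ ^ 2 + ‖(k (excl P' P)).vec‖ ^ 2))) := by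
  unfold pairWeight
  by_cases h1 : k (excl P P') = 0
  · simp [h1, vec_zero]
  have h1' := one_le_norm_vec h1
  have h3 : ‖(k (excl P P')).vec‖ ^ 2 + ‖(k (excl P' P)).vec‖ ^ 2 ≤ ∑ i, ‖(k i).vec‖ ^ 2 := by
    rw [← Finset.sum_pair (f := fun i => ‖(k i).vec‖ ^ 2) hne]
    exact Finset.sum_le_sum_of_subset_of_nonneg (Finset.subset_univ _) fun _ _ _ => by positivity
  set u := ‖(k (excl P P')).vec‖
  set v := ‖(k (excl P' P)).vec‖
  have hv : 0 ≤ v := norm_nonneg _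
  have hu : 0 < u := by linarith
  have h4 : D k * (u ^ 2 + v ^ 2) ≤ CD := (mul_le_mul_of_nonneg_left h3 (hD0 k)).trans (hDsq k)
  have h5 : D k ≤ CD / (u ^ 2 + v ^ 2) := by rwa [le_div_iff₀ (by positivity)]
  calc D k * (v / u) ≤ CD / (u ^ 2 + v ^ 2) * (v / u) := by gcongr
    _ = _ := by field_simp

/-- Once the pair P is merged, the exclusive mode of P' is a spectator: it is an entry q c of the
merged configuration, independent of l. The exclusive mode of P is l or q b - l. The sum over l is
thus the kernel of `tsum_lattice_kernel_le` at scale ρ = |q c|, which is bounded uniformly in q. -/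
theorem tsum_offDiagonal_le {CD : ℝ} (hDsq : ∀ k, D k * ∑ i, ‖(k i).vec‖ ^ 2 ≤ CD)
    (hD0 : ∀ k, 0 ≤ D k) {P P' : Fin (n + 1) × Fin (n + 1)}
    (hP : P ∈ pairs n) (hP' : P' ∈ pairs n) (h : P ≠ P') :
    (Summable fun k => D k * pairWeight P P' k * ‖creationPair w N P.1 P.2 (φ : L2Seq n) k‖ ^ 2) ∧
    n * ∑' k, D k * pairWeight P P' k * ‖creationPair w N P.1 P.2 (φ : L2Seq n) k‖ ^ 2 ≤
      CD * (36 * Real.pi ^ 2) * ∑' q, (∑ b, bandSq w N (q b)) * ‖(φ : L2Seq n) q‖ ^ 2 := by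
  have hCD : 0 ≤ CD := (mul_nonneg (hD0 0) (by positivity)).trans (hDsq 0)
  have hex := excl_ne hP hP' h
  have hex' := excl_ne hP' hP h.symm
  have hne : excl P P' ≠ excl P' P := by
    rcases excl_mem P' P with e | e
    · rw [e]; exact hex.1
    · rw [e]; exact hex.2
  have hE0 : ∀ k, 0 ≤ D k * pairWeight P P' k := fun k =>
    mul_nonneg (hD0 k) (by unfold pairWeight; positivity)
  have hle := fun k => mul_pairWeight_le hDsq hD0 hne k
  have hEC : ∀ k, |D k * pairWeight P P' k| ≤ CD := fun k => by
    rw [abs_of_nonneg (hE0 k)]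
    refine (hle k).trans (mul_le_of_le_one_right hCD ?_)
    by_cases h1 : k (excl P P') = 0
    · simp [h1, vec_zero]
    have h1' := one_le_norm_vec h1
    rw [div_le_one (by positivity)]
    nlinarith [sq_nonneg (‖(k (excl P P')).vec‖ - ‖(k (excl P' P)).vec‖),
      norm_nonneg (k (excl P' P)).vec]
  refine ⟨summable_mul_norm_sq _ hEC, ?_⟩
  have hij : P.1 ≠ P.2 := by
    simp only [pairs, Finset.mem_filter, Finset.mem_univ, true_and] at hP
    exact hP.ne
  obtain ⟨b, hb⟩ := Fin.exists_succAbove_eq hij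
  obtain ⟨c, hc⟩ := Fin.exists_succAbove_eq hex'.2
  have hcb : c ≠ b := by
    rintro rfl
    exact hex'.1 (hc.symm.trans hb)
  have hsum : ∀ q : Fin n → Mode, (∀ i, q i ≠ 0) → ‖(q b).vec‖ ≤ N →
      ∑' l, cutoff N (q b - l) l * (D (split P.2 b q l) * pairWeight P P' (split P.2 b q l)) ≤
        CD * (36 * Real.pi ^ 2) := by
    intro q hq _
    have hρ : 0 < ‖(q c).vec‖ := by linarith [one_le_norm_vec (hq c)]
    have hker := tsum_lattice_kernel_le hρ
    refine tsum_le_of_tsum_ofReal_le (summable_cutoff_mul N (q b) _)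
      (fun l => mul_nonneg (cutoff_nonneg _ _ _) (hE0 _)) (by positivity) ?_
    have hkc : ∀ l, split P.2 b q l (excl P' P) = q c := fun l => by
      rw [← hc, split_succAbove_of_ne _ _ _ _ hcb]
    -- Both l ↦ l and l ↦ q b - l permute the lattice, so the kernel sum does not see which of the
    -- two occurs.
    obtain ⟨σ, hσ⟩ : ∃ σ : Mode ≃ Mode, ∀ l, split P.2 b q l (excl P P') = σ l := by
      rcases excl_mem P P' with e | e
      · refine ⟨Equiv.subLeft (q b), fun l => ?_⟩
        rw [e, ← hb, split_succAbove]
        rfl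
      · exact ⟨Equiv.refl _, fun l => by rw [e, split_self]; rfl⟩
    rw [← Equiv.tsum_eq σ] at hker
    rw [ENNReal.ofReal_mul hCD]
    refine le_trans ?_ (mul_le_mul_right hker _)
    rw [← ENNReal.tsum_mul_left]
    refine ENNReal.tsum_le_tsum fun l => ?_
    rw [← ENNReal.ofReal_mul hCD]
    refine ENNReal.ofReal_le_ofReal ?_
    have h1 := hle (split P.2 b q l)
    rw [hkc, hσ] at h1
    exact (mul_le_of_le_one_left (hE0 _) (cutoff_le_one _ _ _)).trans h1
  have hmain := tsum_pair_le (w := w) φ hEC P.2 b (s := fun _ => CD * (36 * Real.pi ^ 2))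
    (Cs := |CD * (36 * Real.pi ^ 2)|) (fun _ => le_rfl) hsum
  rw [hb] at hmain
  refine (mul_le_mul_of_nonneg_left hmain (Nat.cast_nonneg n)).trans (le_of_eq ?_)
  rw [mul_tsum_bandSq φ (s := fun _ => CD * (36 * Real.pi ^ 2)) (fun _ => le_rfl)
    (fun _ _ => rfl) b, ← tsum_mul_left]
  exact tsum_congr fun q => by ring

theorem norm_creation_sq (k : Fin (n + 1) → Mode) :
    ‖(creation w N n φ : L2Seq (n + 1)) k‖ ^ 2 = (Real.pi * (n + 1))⁻¹ ^ 2 *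
      ‖∑ P ∈ pairs n, creationPair w N P.1 P.2 (φ : L2Seq n) k‖ ^ 2 := by
  have e : (creation w N n φ : L2Seq (n + 1)) k = -(Complex.I / (Real.pi * (n + 1))) *
      ∑ P ∈ pairs n, creationPair w N P.1 P.2 (φ : L2Seq n) k := by
    rw [← sum_pairs (fun i j => creationPair w N i j (φ : L2Seq n) k)]
    change creationSeq w N n (φ : L2Seq n) k = _
    simp only [creationSeq, smul_apply, sum_apply,
      lp.coeFn_smul, lp.coeFn_sum, Pi.smul_apply, Finset.sum_apply, smul_eq_mul]
  have hn : ‖(n : ℂ) + 1‖ = n + 1 := by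
    rw [← Nat.cast_one, ← Nat.cast_add, Complex.norm_natCast, Nat.cast_add, Nat.cast_one]
  rw [e, norm_mul, mul_pow, norm_neg, norm_div, Complex.norm_I, norm_mul, hn, Complex.norm_real,
    Real.norm_of_nonneg Real.pi_pos.le, one_div]

/-- Up to off-diagonal terms, the quadratic form of `𝒜₊* D 𝒜₊` is the sum over the pairs. -/
theorem abs_tsum_creation_sub_le {C CD : ℝ} (hD0 : ∀ k, 0 ≤ D k) (hDC : ∀ k, D k ≤ C)
    (hDsq : ∀ k, D k * ∑ i, ‖(k i).vec‖ ^ 2 ≤ CD) :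
    n * |(Real.pi * (n + 1)) ^ 2 * ∑' k, D k * ‖(creation w N n φ : L2Seq (n + 1)) k‖ ^ 2 -
      ∑ P ∈ pairs n, ∑' k, D k * ‖creationPair w N P.1 P.2 (φ : L2Seq n) k‖ ^ 2| ≤
    (n * (n + 1) / 2) ^ 2 * (CD * (36 * Real.pi ^ 2) *
      ∑' q, (∑ b, bandSq w N (q b)) * ‖(φ : L2Seq n) q‖ ^ 2) := by
  have hCD : 0 ≤ CD := (mul_nonneg (hD0 0) (by positivity)).trans (hDsq 0)
  have hDabs : ∀ k, |D k| ≤ C := fun k => by rw [abs_of_nonneg (hD0 k)]; exact hDC k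
  have hsP := fun P : Fin (n + 1) × Fin (n + 1) =>
    summable_mul_norm_sq (creationPair w N P.1 P.2 (φ : L2Seq n)) hDabs
  have hpi : (0 : ℝ) < Real.pi * (n + 1) := by positivity
  have e0 : (Real.pi * (n + 1)) ^ 2 * ∑' k, D k * ‖(creation w N n φ : L2Seq (n + 1)) k‖ ^ 2 =
      ∑' k, D k * ‖∑ P ∈ pairs n, creationPair w N P.1 P.2 (φ : L2Seq n) k‖ ^ 2 := by
    rw [← tsum_mul_left]
    refine tsum_congr fun k => ?_
    rw [norm_creation_sq]
    field_simp
  have hsum : Summable fun k => D k * ‖∑ P ∈ pairs n, creationPair w N P.1 P.2 (φ : L2Seq n) k‖ ^ 2 := by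
    have := (summable_mul_norm_sq (creation w N n φ : L2Seq (n + 1)) hDabs).mul_left
      ((Real.pi * (n + 1)) ^ 2)
    refine this.congr fun k => ?_
    rw [norm_creation_sq]
    field_simp
  set T := ∑' q, (∑ b, bandSq w N (q b)) * ‖(φ : L2Seq n) q‖ ^ 2 with hT
  have hT0 : 0 ≤ T := tsum_nonneg fun q =>
    mul_nonneg (Finset.sum_nonneg fun b _ => bandSq_nonneg _ _ _) (sq_nonneg _)
  have hoff := fun P (hP : P ∈ pairs n) P' (hP' : P' ∈ (pairs n).erase P) =>
    tsum_offDiagonal_le (w := w) (N := N) φ hDsq hD0 hP (Finset.mem_of_mem_erase hP')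
      (Finset.ne_of_mem_erase hP').symm
  have hsoff : Summable fun k => ∑ P ∈ pairs n, ∑ P' ∈ (pairs n).erase P,
      D k * pairWeight P P' k * ‖creationPair w N P.1 P.2 (φ : L2Seq n) k‖ ^ 2 :=
    summable_sum fun P hP => summable_sum fun P' hP' => (hoff P hP P' hP').1
  have hdiff : |∑' k, D k * ‖∑ P ∈ pairs n, creationPair w N P.1 P.2 (φ : L2Seq n) k‖ ^ 2 -
      ∑ P ∈ pairs n, ∑' k, D k * ‖creationPair w N P.1 P.2 (φ : L2Seq n) k‖ ^ 2| ≤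
      ∑' k, ∑ P ∈ pairs n, ∑ P' ∈ (pairs n).erase P,
        D k * pairWeight P P' k * ‖creationPair w N P.1 P.2 (φ : L2Seq n) k‖ ^ 2 := by
    rw [← Summable.tsum_finsetSum fun P _ => hsP P,
      ← hsum.tsum_sub (summable_sum fun P _ => hsP P), ← Real.norm_eq_abs]
    refine tsum_of_norm_bounded hsoff.hasSum fun k => ?_
    have h1 := abs_norm_sum_sq_sub_le (pairs n)
      (fun P => creationPair w N P.1 P.2 (φ : L2Seq n) k) (fun P P' => pairWeight P P' k)
      (fun P _ P' _ _ => two_mul_norm_creationPair_le (φ : L2Seq n) k P P')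
    rw [← Finset.mul_sum, ← mul_sub, Real.norm_eq_abs, abs_mul, abs_of_nonneg (hD0 k)]
    refine (mul_le_mul_of_nonneg_left h1 (hD0 k)).trans (le_of_eq ?_)
    simp only [Finset.mul_sum, mul_assoc]
  rw [e0]
  refine (mul_le_mul_of_nonneg_left hdiff (Nat.cast_nonneg n)).trans ?_
  rw [Summable.tsum_finsetSum fun P hP => summable_sum fun P' hP' => (hoff P hP P' hP').1,
    Finset.mul_sum]
  have hA : 0 ≤ CD * (36 * Real.pi ^ 2) * T := by positivity
  calc ∑ P ∈ pairs n, (n : ℝ) * ∑' k, ∑ P' ∈ (pairs n).erase P,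
        D k * pairWeight P P' k * ‖creationPair w N P.1 P.2 (φ : L2Seq n) k‖ ^ 2
      ≤ ∑ P ∈ pairs n, ∑ P' ∈ (pairs n).erase P, CD * (36 * Real.pi ^ 2) * T := by
        refine Finset.sum_le_sum fun P hP => ?_
        rw [Summable.tsum_finsetSum fun P' hP' => (hoff P hP P' hP').1, Finset.mul_sum]
        exact Finset.sum_le_sum fun P' hP' => (hoff P hP P' hP').2
    -- Crude count: all ordered couples of pairs, at most (n(n+1)/2)² of them.
    _ ≤ ∑ P ∈ pairs n, ∑ P' ∈ pairs n, CD * (36 * Real.pi ^ 2) * T := by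
        refine Finset.sum_le_sum fun P hP => ?_
        exact Finset.sum_le_sum_of_subset_of_nonneg (Finset.erase_subset _ _) fun _ _ _ => hA
    _ = _ := by
        simp only [Finset.sum_const, nsmul_eq_mul, card_pairs]
        ring

end form

/-! ### Bounds of the form of 𝒜₊* D 𝒜₊ by Fourier multipliers. -/

section form

variable {w : EuclideanSpace ℝ (Fin 2)} {N n : ℕ} (φ : chaos n) {D : (Fin (n + 1) → Mode) → ℝ}
  {s : (Fin n → Mode) → ℝ}

theorem creation_zero_apply (φ : chaos 0) (k : Fin 1 → Mode) :
    (creation w N 0 φ : L2Seq 1) k = 0 := by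
  have h := norm_creation_sq (w := w) (N := N) φ k
  have hp : pairs 0 = ∅ := by
    rw [← Finset.card_eq_zero]
    have := card_pairs 0
    simpa using this
  rw [hp] at h
  simpa using h

theorem summable_bandSq_mul {Cs : ℝ} (hsC : ∀ q, |s q| ≤ Cs) :
    Summable fun q => (∑ b, bandSq w N (q b)) * s q * ‖(φ : L2Seq n) q‖ ^ 2 := by
  simp only [Finset.sum_mul]
  exact summable_sum fun b _ => summable_mul_norm_sq (φ : L2Seq n) (abs_bandSq_mul_le hsC b)

theorem hasSum_bandSq_mul {Cs : ℝ} (hsC : ∀ q, |s q| ≤ Cs) (a : ℝ) :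
    HasSum (fun q => (∑ b, bandSq w N (q b)) / 2 * (s q / Real.pi ^ 2 + a) *
      ‖(φ : L2Seq n) q‖ ^ 2)
      (1 / (2 * Real.pi ^ 2) * ∑' q, (∑ b, bandSq w N (q b)) * s q * ‖(φ : L2Seq n) q‖ ^ 2 +
        a / 2 * ∑' q, (∑ b, bandSq w N (q b)) * ‖(φ : L2Seq n) q‖ ^ 2) := by
  have h1 := (summable_bandSq_mul (w := w) (N := N) φ hsC).hasSum
  have h2 := (summable_bandSq_mul (w := w) (N := N) φ (s := fun _ => 1) (Cs := 1)
    (fun _ => by simp)).hasSum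
  simp only [mul_one] at h2
  refine Eq.mp (congrArg (fun F => HasSum F _) ?_)
    ((h1.mul_left (1 / (2 * Real.pi ^ 2))).add (h2.mul_left (a / 2)))
  funext q
  have := Real.pi_pos.ne'
  field_simp

/-- Lower bound of the quadratic form of `𝒜₊* D 𝒜₊` by the one of a Fourier multiplier `g`. -/
theorem tsum_le_tsum_creation {C CD Cs : ℝ} (hD0 : ∀ k, 0 ≤ D k) (hDC : ∀ k, D k ≤ C)
    (hDsq : ∀ k, D k * ∑ i, ‖(k i).vec‖ ^ 2 ≤ CD)
    (hsC : ∀ q, |s q| ≤ Cs) (hsymm : ∀ (σ : Equiv.Perm (Fin n)) q, s (q ∘ σ) = s q)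
    (hs : ∀ j b q, (∀ i, q i ≠ 0) → ‖(q b).vec‖ ≤ N →
      s q ≤ ∑' l, cutoff N (q b - l) l * D (split j b q l))
    {g : (Fin n → Mode) → ℝ} (hg : Summable fun q => g q * ‖(φ : L2Seq n) q‖ ^ 2)
    (hgs : ∀ q, (∀ i, q i ≠ 0) →
      g q ≤ (∑ b, bandSq w N (q b)) / 2 * (s q / Real.pi ^ 2 - 18 * (n * (n + 1)) * CD)) :
    n.factorial * ∑' q, g q * ‖(φ : L2Seq n) q‖ ^ 2 ≤
      (n + 1).factorial * ∑' k, D k * ‖(creation w N n φ : L2Seq (n + 1)) k‖ ^ 2 := by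
  set X := ∑' k, D k * ‖(creation w N n φ : L2Seq (n + 1)) k‖ ^ 2 with hX
  have hX0 : 0 ≤ X := tsum_nonneg fun k => mul_nonneg (hD0 k) (sq_nonneg _)
  have hDabs : ∀ k, |D k| ≤ C := fun k => by rw [abs_of_nonneg (hD0 k)]; exact hDC k
  have hsum := hasSum_bandSq_mul (w := w) (N := N) φ hsC (-(18 * (n * (n + 1)) * CD))
  set T1 := ∑' q, (∑ b, bandSq w N (q b)) * ‖(φ : L2Seq n) q‖ ^ 2
  set Ts := ∑' q, (∑ b, bandSq w N (q b)) * s q * ‖(φ : L2Seq n) q‖ ^ 2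
  have hle : ∑' q, g q * ‖(φ : L2Seq n) q‖ ^ 2 ≤
      1 / (2 * Real.pi ^ 2) * Ts + -(18 * (n * (n + 1)) * CD) / 2 * T1 := by
    refine hasSum_le (fun q => ?_) hg.hasSum hsum
    by_cases hq : ∀ i, q i ≠ 0
    · exact mul_le_mul_of_nonneg_right (by rw [← sub_eq_add_neg]; exact hgs q hq) (sq_nonneg _)
    · push Not at hq
      obtain ⟨i, hi⟩ := hq
      simp [φ.2.2 q i hi]
  -- The symmetrisation over b divides by n. For n = 0 the left-hand side is nonpositive.
  rcases Nat.eq_zero_or_pos n with hn | hn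
  · subst hn
    have h1 : Ts = 0 := by simp [Ts]
    have h2 : T1 = 0 := by simp [T1]
    rw [h1, h2] at hle
    have : 0 ≤ ((0 + 1).factorial : ℝ) * X := by positivity
    refine le_trans ?_ this
    simpa using hle
  have hn' : (0 : ℝ) < n := by exact_mod_cast hn
  have habs := (abs_le.mp (le_of_mul_le_mul_left ((abs_tsum_creation_sub_le (w := w) (N := N) φ hD0
    hDC hDsq).trans (le_of_eq (by
      rw [show ((n : ℝ) * (n + 1) / 2) ^ 2 = n * (n * (n + 1) ^ 2 / 4) by ring, mul_assoc]))) hn')).1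
  have hP : ∀ P ∈ pairs n, Ts / n ≤
      ∑' k, D k * ‖creationPair w N P.1 P.2 (φ : L2Seq n) k‖ ^ 2 := by
    intro P hP
    have hij : P.1 ≠ P.2 := by
      simp only [pairs, Finset.mem_filter, Finset.mem_univ, true_and] at hP
      exact hP.ne
    obtain ⟨b, hb⟩ := Fin.exists_succAbove_eq hij
    have h1 := le_tsum_pair (w := w) φ hDabs P.2 b hsC (hs P.2 b)
    rw [hb] at h1
    rw [div_le_iff₀' hn']
    change ∑' q, (∑ b, bandSq w N (q b)) * s q * ‖(φ : L2Seq n) q‖ ^ 2 ≤ _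
    rw [← mul_tsum_bandSq φ hsC hsymm b]
    exact mul_le_mul_of_nonneg_left h1 hn'.le
  have hsumP := Finset.sum_le_sum hP
  rw [Finset.sum_const, nsmul_eq_mul, card_pairs] at hsumP
  have h3 : (n : ℝ) * (n + 1) / 2 * (Ts / n) = (n + 1) / 2 * Ts := by field_simp
  rw [h3] at hsumP
  have hpi := Real.pi_pos
  have h4 : (n + 1) / 2 * Ts - n * (n + 1) ^ 2 / 4 * (CD * (36 * Real.pi ^ 2) * T1) ≤
      (Real.pi * (n + 1)) ^ 2 * X := by linarith
  -- There are n(n+1)/2 pairs, each contributing at least Ts/n, the prefactor of 𝒜₊ squared is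
  -- (π(n+1))⁻², and (n+1)!/n! = n+1: together Ts/(2π²). The same bookkeeping turns the off-diagonal
  -- constant 36π²/4 into 9n(n+1) CD.
  have h5 : 1 / (2 * Real.pi ^ 2) * Ts + -(18 * (n * (n + 1)) * CD) / 2 * T1 ≤ (n + 1) * X := by
    have e : (Real.pi ^ 2 * (n + 1)) * (1 / (2 * Real.pi ^ 2) * Ts +
        -(18 * (n * (n + 1)) * CD) / 2 * T1) =
        (n + 1) / 2 * Ts - n * (n + 1) ^ 2 / 4 * (CD * (36 * Real.pi ^ 2) * T1) := by
      field_simp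
      ring
    have hpos : 0 < Real.pi ^ 2 * ((n : ℝ) + 1) := by positivity
    refine le_of_mul_le_mul_left ?_ hpos
    rw [e]
    refine h4.trans (le_of_eq ?_)
    ring
  rw [Nat.factorial_succ, Nat.cast_mul, mul_comm ((n + 1 : ℕ) : ℝ), mul_assoc]
  refine mul_le_mul_of_nonneg_left ?_ (Nat.cast_nonneg _)
  push_cast
  exact hle.trans h5

/-- Upper bound of the quadratic form of `𝒜₊* D 𝒜₊` by the one of a Fourier multiplier `g`. -/
theorem tsum_creation_le_tsum {C CD Cs : ℝ} (hD0 : ∀ k, 0 ≤ D k) (hDC : ∀ k, D k ≤ C)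
    (hDsq : ∀ k, D k * ∑ i, ‖(k i).vec‖ ^ 2 ≤ CD)
    (hsC : ∀ q, |s q| ≤ Cs) (hsymm : ∀ (σ : Equiv.Perm (Fin n)) q, s (q ∘ σ) = s q)
    (hs : ∀ j b q, (∀ i, q i ≠ 0) → ‖(q b).vec‖ ≤ N →
      ∑' l, cutoff N (q b - l) l * D (split j b q l) ≤ s q)
    {g : (Fin n → Mode) → ℝ} (hg : Summable fun q => g q * ‖(φ : L2Seq n) q‖ ^ 2)
    (hgs : ∀ q, (∀ i, q i ≠ 0) →
      (∑ b, bandSq w N (q b)) / 2 * (s q / Real.pi ^ 2 + 18 * (n * (n + 1)) * CD) ≤ g q) :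
    (n + 1).factorial * ∑' k, D k * ‖(creation w N n φ : L2Seq (n + 1)) k‖ ^ 2 ≤
      n.factorial * ∑' q, g q * ‖(φ : L2Seq n) q‖ ^ 2 := by
  set X := ∑' k, D k * ‖(creation w N n φ : L2Seq (n + 1)) k‖ ^ 2 with hX
  have hDabs : ∀ k, |D k| ≤ C := fun k => by rw [abs_of_nonneg (hD0 k)]; exact hDC k
  have hsum := hasSum_bandSq_mul (w := w) (N := N) φ hsC (18 * (n * (n + 1)) * CD)
  set T1 := ∑' q, (∑ b, bandSq w N (q b)) * ‖(φ : L2Seq n) q‖ ^ 2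
  set Ts := ∑' q, (∑ b, bandSq w N (q b)) * s q * ‖(φ : L2Seq n) q‖ ^ 2
  have hle : 1 / (2 * Real.pi ^ 2) * Ts + 18 * (n * (n + 1)) * CD / 2 * T1 ≤
      ∑' q, g q * ‖(φ : L2Seq n) q‖ ^ 2 := by
    refine hasSum_le (fun q => ?_) hsum hg.hasSum
    by_cases hq : ∀ i, q i ≠ 0
    · exact mul_le_mul_of_nonneg_right (hgs q hq) (sq_nonneg _)
    · push Not at hq
      obtain ⟨i, hi⟩ := hq
      simp [φ.2.2 q i hi]
  -- For n = 0 there is no pair to merge and 𝒜₊ vanishes.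
  rcases Nat.eq_zero_or_pos n with hn | hn
  · subst hn
    have h1 : Ts = 0 := by simp [Ts]
    have h2 : T1 = 0 := by simp [T1]
    have h3 : X = 0 := by
      rw [hX]
      refine (tsum_congr fun k => ?_).trans tsum_zero
      have : (creation w N 0 φ : L2Seq (0 + 1)) k = 0 := creation_zero_apply φ k
      rw [this]
      simp
    rw [h1, h2] at hle
    rw [h3]
    simpa using hle
  have hn' : (0 : ℝ) < n := by exact_mod_cast hn
  have habs := (abs_le.mp (le_of_mul_le_mul_left ((abs_tsum_creation_sub_le (w := w) (N := N) φ hD0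
    hDC hDsq).trans (le_of_eq (by
      rw [show ((n : ℝ) * (n + 1) / 2) ^ 2 = n * (n * (n + 1) ^ 2 / 4) by ring, mul_assoc]))) hn')).2
  have hP : ∀ P ∈ pairs n,
      ∑' k, D k * ‖creationPair w N P.1 P.2 (φ : L2Seq n) k‖ ^ 2 ≤ Ts / n := by
    intro P hP
    have hij : P.1 ≠ P.2 := by
      simp only [pairs, Finset.mem_filter, Finset.mem_univ, true_and] at hP
      exact hP.ne
    obtain ⟨b, hb⟩ := Fin.exists_succAbove_eq hij
    have h1 := tsum_pair_le (w := w) φ hDabs P.2 b hsC (hs P.2 b)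
    rw [hb] at h1
    rw [le_div_iff₀' hn']
    change _ ≤ ∑' q, (∑ b, bandSq w N (q b)) * s q * ‖(φ : L2Seq n) q‖ ^ 2
    rw [← mul_tsum_bandSq φ hsC hsymm b]
    exact mul_le_mul_of_nonneg_left h1 hn'.le
  have hsumP := Finset.sum_le_sum hP
  rw [Finset.sum_const, nsmul_eq_mul, card_pairs] at hsumP
  have h3 : (n : ℝ) * (n + 1) / 2 * (Ts / n) = (n + 1) / 2 * Ts := by field_simp
  rw [h3] at hsumP
  have hpi := Real.pi_pos
  have h4 : (Real.pi * (n + 1)) ^ 2 * X ≤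
      (n + 1) / 2 * Ts + n * (n + 1) ^ 2 / 4 * (CD * (36 * Real.pi ^ 2) * T1) := by linarith
  have h5 : (n + 1) * X ≤ 1 / (2 * Real.pi ^ 2) * Ts + 18 * (n * (n + 1)) * CD / 2 * T1 := by
    have e : (Real.pi ^ 2 * (n + 1)) * (1 / (2 * Real.pi ^ 2) * Ts +
        18 * (n * (n + 1)) * CD / 2 * T1) =
        (n + 1) / 2 * Ts + n * (n + 1) ^ 2 / 4 * (CD * (36 * Real.pi ^ 2) * T1) := by
      field_simp
      ring
    have hpos : 0 < Real.pi ^ 2 * ((n : ℝ) + 1) := by positivity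
    refine le_of_mul_le_mul_left ?_ hpos
    rw [e]
    refine le_trans (le_of_eq ?_) h4
    ring
  rw [Nat.factorial_succ, Nat.cast_mul, mul_comm ((n + 1 : ℕ) : ℝ), mul_assoc]
  refine mul_le_mul_of_nonneg_left ?_ (Nat.cast_nonneg _)
  push_cast
  exact h5.trans hle

end form

/-! ### Lower bound of the diagonal terms -/

theorem norm_add_sq_le {E : Type*} [SeminormedAddCommGroup E] {t : ℝ} (ht : 0 < t) (x y : E) :
    ‖x + y‖ ^ 2 ≤ (1 + t) * ‖x‖ ^ 2 + (1 + 1 / t) * ‖y‖ ^ 2 := by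
  have h1 : ‖x + y‖ ^ 2 ≤ (‖x‖ + ‖y‖) ^ 2 := by
    have := norm_add_le x y
    gcongr
  have h2 : (1 + t) * ‖x‖ ^ 2 + (1 + 1 / t) * ‖y‖ ^ 2 - (‖x‖ + ‖y‖) ^ 2 =
      (t * ‖x‖ - ‖y‖) ^ 2 / t := by
    field_simp
    ring
  have h3 : 0 ≤ (t * ‖x‖ - ‖y‖) ^ 2 / t := by positivity
  linarith

/-- The anisotropic quadratic form `a |x|² + B (w·x)²`. -/
def anisoForm (w : EuclideanSpace ℝ (Fin 2)) (a B : ℝ) (x : EuclideanSpace ℝ (Fin 2)) : ℝ :=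
  a * ‖x‖ ^ 2 + B * (inner ℝ w x) ^ 2

theorem inner_sq_le (w x : EuclideanSpace ℝ (Fin 2)) : (inner ℝ w x) ^ 2 ≤ ‖w‖ ^ 2 * ‖x‖ ^ 2 := by
  rw [← sq_abs, ← mul_pow]
  exact pow_le_pow_left₀ (abs_nonneg _) (abs_real_inner_le_norm _ _) 2

/-! ### The anisotropic form under splitting of a mode. -/

section aniso

variable {w : EuclideanSpace ℝ (Fin 2)} {a B : ℝ}

theorem anisoForm_add_le (ha : 0 ≤ a) (hB : 0 ≤ B) {t : ℝ} (ht : 0 < t)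
    (x y : EuclideanSpace ℝ (Fin 2)) :
    anisoForm w a B (x + y) ≤ (1 + t) * anisoForm w a B x + (1 + 1 / t) * anisoForm w a B y := by
  have h1 := mul_le_mul_of_nonneg_left (norm_add_sq_le ht x y) ha
  have h2 := mul_le_mul_of_nonneg_left (norm_add_sq_le ht (inner ℝ w x : ℝ) (inner ℝ w y)) hB
  simp only [Real.norm_eq_abs, sq_abs] at h2
  unfold anisoForm
  rw [inner_add_right]
  linarith

theorem anisoForm_le (hB : 0 ≤ B) (x : EuclideanSpace ℝ (Fin 2)) :
    anisoForm w a B x ≤ (a + B * ‖w‖ ^ 2) * ‖x‖ ^ 2 := by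
  unfold anisoForm
  have := mul_le_mul_of_nonneg_left (inner_sq_le w x) hB
  linarith

theorem anisoForm_neg (x : EuclideanSpace ℝ (Fin 2)) :
    anisoForm w a B (-x) = anisoForm w a B x := by
  simp [anisoForm]

/-- After the splitting the modes l and p - l are both close to ±u when |u| is much larger than ρ,
whence the factor 2. The remainders l - u and p - (l - u), the other modes and λ together cost at
most 8ρ²(a + B|w|²). -/
theorem anisoForm_split_le (ha : 0 < a) (hB : 0 ≤ B) {u l p : EuclideanSpace ℝ (Fin 2)}
    (hu : 0 < ‖u‖) (hul : ‖u - l‖ ^ 2 ≤ 2) {lam rs rk ρ : ℝ} (hlam : 0 ≤ lam) (hrs : 0 ≤ rs)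
    (hrk0 : 0 ≤ rk) (hrk : rk ≤ ‖w‖ ^ 2 * rs) (hρ : 1 ≤ ρ) (hρ2 : ρ ^ 2 = 2 * lam + ‖p‖ ^ 2 + rs) :
    a * (2 * lam + (‖l‖ ^ 2 + ‖p - l‖ ^ 2 + rs)) +
      B * ((inner ℝ w l) ^ 2 + (inner ℝ w (p - l)) ^ 2 + rk) ≤
    2 * anisoForm w a B u * (1 + 2 * ρ * √((a + B * ‖w‖ ^ 2) / a) / ‖u‖) ^ 2 := by
  set M := a + B * ‖w‖ ^ 2 with hM
  have hMa : a ≤ M := by rw [hM]; nlinarith [sq_nonneg ‖w‖]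
  have hM0 : 0 < M := ha.trans_le hMa
  -- This t balances Young's inequality: t² a|u|² = 4ρ²M, so the remainder (1 + 1/t)·8ρ²M is at most
  -- 2(t² + t) times the form at u. Added to 2(1 + t) this is 2(1 + t)².
  set t := 2 * ρ * √(M / a) / ‖u‖ with ht
  have ht0 : 0 < t := by
    have : 0 < √(M / a) := Real.sqrt_pos.mpr (by positivity)
    positivity
  have ht2 : t ^ 2 * (a * ‖u‖ ^ 2) = 4 * ρ ^ 2 * M := by
    rw [ht, div_pow, mul_pow, Real.sq_sqrt (by positivity)]
    field_simp
    ring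
  have h1 := anisoForm_add_le (w := w) ha.le hB ht0 u (l - u)
  have h2 := anisoForm_add_le (w := w) ha.le hB ht0 (-u) (p - (l - u))
  rw [anisoForm_neg] at h2
  have e1 : u + (l - u) = l := by abel
  have e2 : -u + (p - (l - u)) = p - l := by abel
  rw [e1] at h1
  rw [e2] at h2
  have h3 := anisoForm_le (w := w) (a := a) hB (l - u)
  have h4 := anisoForm_le (w := w) (a := a) hB (p - (l - u))
  have h5 : ‖l - u‖ ^ 2 ≤ 2 := by rwa [norm_sub_rev]
  have h6 : ‖p - (l - u)‖ ^ 2 ≤ 2 * ‖p‖ ^ 2 + 4 := by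
    have := norm_add_sq_le one_pos p (-(l - u))
    rw [norm_neg, ← sub_eq_add_neg] at this
    linarith
  have h7 : anisoForm w a B (l - u) + anisoForm w a B (p - (l - u)) +
      (a * (2 * lam + rs) + B * rk) ≤ M * (8 * ρ ^ 2) := by
    have h8 : B * rk ≤ B * (‖w‖ ^ 2 * rs) := mul_le_mul_of_nonneg_left hrk hB
    have h9 : a * (2 * lam + rs) + B * rk ≤ M * (2 * lam + rs) := by
      have : 0 ≤ B * ‖w‖ ^ 2 * (2 * lam) := by positivity
      rw [hM]
      linarith
    have h10 : M * ‖l - u‖ ^ 2 ≤ M * 2 := mul_le_mul_of_nonneg_left h5 hM0.le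
    have h11 : M * ‖p - (l - u)‖ ^ 2 ≤ M * (2 * ‖p‖ ^ 2 + 4) := mul_le_mul_of_nonneg_left h6 hM0.le
    have h12 : M * (2 * lam + rs + 2 * ‖p‖ ^ 2 + 6) ≤ M * (8 * ρ ^ 2) := by
      refine mul_le_mul_of_nonneg_left ?_ hM0.le
      nlinarith
    linarith
  have hlow : a * ‖u‖ ^ 2 ≤ anisoForm w a B u := by
    unfold anisoForm
    have : 0 ≤ B * (inner ℝ w u) ^ 2 := by positivity
    linarith
  have h13 : (1 + 1 / t) * (M * (8 * ρ ^ 2)) ≤ 2 * (t ^ 2 + t) * anisoForm w a B u := by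
    have e : (1 + 1 / t) * (M * (8 * ρ ^ 2)) = 2 * (t ^ 2 + t) * (a * ‖u‖ ^ 2) := by
      have : M * (8 * ρ ^ 2) = 2 * (t ^ 2 * (a * ‖u‖ ^ 2)) := by rw [ht2]; ring
      rw [this]
      field_simp
    rw [e]
    exact mul_le_mul_of_nonneg_left hlow (by positivity)
  have hR : 0 ≤ a * (2 * lam + rs) + B * rk := by positivity
  have hit : (0 : ℝ) ≤ 1 / t := by positivity
  have h15 : (1 + 1 / t) * (anisoForm w a B (l - u) + anisoForm w a B (p - (l - u))) +
      (a * (2 * lam + rs) + B * rk) ≤ (1 + 1 / t) * (M * (8 * ρ ^ 2)) := by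
    have h16 := mul_le_mul_of_nonneg_left h7 (by positivity : 0 ≤ 1 + 1 / t)
    have h17 := mul_nonneg hit hR
    linarith
  have e3 : a * (2 * lam + (‖l‖ ^ 2 + ‖p - l‖ ^ 2 + rs)) +
      B * ((inner ℝ w l) ^ 2 + (inner ℝ w (p - l)) ^ 2 + rk) =
      anisoForm w a B l + anisoForm w a B (p - l) + (a * (2 * lam + rs) + B * rk) := by
    unfold anisoForm
    ring
  rw [e3]
  linarith

end aniso

/-- The logarithm that replaces `L(x / N², z)` on the circle of radius `r`. -/
def radialLog (N : ℕ) (z r : ℝ) : ℝ := 2 * (Real.log N - Real.log r) + z + Real.log 9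

theorem hasDerivAt_radialLog (N : ℕ) (z : ℝ) {r : ℝ} (hr : r ≠ 0) :
    HasDerivAt (radialLog N z) (-2 / r) r := by
  unfold radialLog
  refine ((((Real.hasDerivAt_log hr).const_sub (Real.log N)).const_mul 2).add_const z
    |>.add_const (Real.log 9)).congr_deriv ?_
  ring

theorem le_radialLog {N : ℕ} {z r : ℝ} (hr : 0 < r) (hrN : r ≤ N) : z ≤ radialLog N z r := by
  have h1 : Real.log r ≤ Real.log N := Real.log_le_log hr hrN
  have h2 : 0 ≤ Real.log 9 := Real.log_nonneg (by norm_num)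
  unfold radialLog
  linarith

/-- With s = (N/r)² ≥ 1 one has 1 + 8s ≤ 9s; this is the log 9 in `radialLog`. -/
theorem logL_le_radialLog {N : ℕ} {z r x : ℝ} (hr : 0 < r) (hrN : r ≤ N) (hx : r ^ 2 / 8 ≤ x) :
    logL (x / (N : ℝ) ^ 2) z ≤ radialLog N z r := by
  have hN : (0 : ℝ) < N := hr.trans_le hrN
  have hx0 : 0 < x := lt_of_lt_of_le (by positivity) hx
  have h1 : 1 + (x / (N : ℝ) ^ 2)⁻¹ ≤ 9 * ((N : ℝ) / r) ^ 2 := by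
    have h2 : (x / (N : ℝ) ^ 2)⁻¹ ≤ 8 * ((N : ℝ) / r) ^ 2 := by
      rw [inv_div, div_pow, ← mul_div_assoc, div_le_div_iff₀ hx0 (by positivity)]
      nlinarith [sq_nonneg (N : ℝ)]
    have h3 : 1 ≤ ((N : ℝ) / r) ^ 2 := one_le_pow₀ ((one_le_div hr).mpr hrN)
    linarith
  have h4 : 0 < 1 + (x / (N : ℝ) ^ 2)⁻¹ := by positivity
  have h5 := Real.log_le_log h4 h1
  rw [Real.log_mul (by norm_num) (by positivity), Real.log_pow, Real.log_div hN.ne' hr.ne'] at h5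
  unfold logL radialLog
  push_cast at h5
  linarith

theorem cutoff_eq_one {N : ℕ} {l m : Mode} (h1 : 0 < ‖l.vec‖) (h2 : ‖l.vec‖ ≤ N)
    (h3 : 0 < ‖m.vec‖) (h4 : ‖m.vec‖ ≤ N) (h5 : 0 < ‖(l + m).vec‖) (h6 : ‖(l + m).vec‖ ≤ N) :
    cutoff N l m = 1 := by
  unfold cutoff
  rw [if_pos ⟨⟨h1, h2⟩, ⟨h3, h4⟩, h5, h6⟩]

theorem anisoForm_pos {w : EuclideanSpace ℝ (Fin 2)} {a B : ℝ} (ha : 0 < a) (hB : 0 ≤ B)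
    {u : EuclideanSpace ℝ (Fin 2)} (hu : 0 < ‖u‖) : 0 < anisoForm w a B u := by
  unfold anisoForm
  positivity

theorem exists_split_sums {n : ℕ} (w : EuclideanSpace ℝ (Fin 2)) (q : Fin n → Mode) (b : Fin n) :
    ∃ rs rk : ℝ, 0 ≤ rs ∧ 0 ≤ rk ∧ rk ≤ ‖w‖ ^ 2 * rs ∧
      ∑ i, ‖(q i).vec‖ ^ 2 = ‖(q b).vec‖ ^ 2 + rs ∧
      ∀ (j : Fin (n + 1)) (l : Mode),
        ∑ i, ‖(split j b q l i).vec‖ ^ 2 = ‖l.vec‖ ^ 2 + ‖(q b).vec - l.vec‖ ^ 2 + rs ∧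
        ∑ i, (inner ℝ w (split j b q l i).vec) ^ 2 =
          (inner ℝ w l.vec) ^ 2 + (inner ℝ w ((q b).vec - l.vec)) ^ 2 + rk := by
  have h1 := Finset.add_sum_erase Finset.univ (fun i => ‖(q i).vec‖ ^ 2) (Finset.mem_univ b)
  have h2 := Finset.add_sum_erase Finset.univ (fun i => (inner ℝ w (q i).vec : ℝ) ^ 2)
    (Finset.mem_univ b)
  refine ⟨∑ i ∈ Finset.univ.erase b, ‖(q i).vec‖ ^ 2,
    ∑ i ∈ Finset.univ.erase b, (inner ℝ w (q i).vec : ℝ) ^ 2, Finset.sum_nonneg fun _ _ => sq_nonneg _,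
    Finset.sum_nonneg fun _ _ => sq_nonneg _, ?_, h1.symm, fun j l => ⟨?_, ?_⟩⟩
  · rw [Finset.mul_sum]
    exact Finset.sum_le_sum fun i _ => inner_sq_le _ _
  · have := sum_split j b q l (fun m => ‖m.vec‖ ^ 2)
    simp only [vec_sub] at this
    linarith
  · have := sum_split j b q l (fun m => (inner ℝ w m.vec : ℝ) ^ 2)
    simp only [vec_sub] at this
    linarith

theorem logL_ge {x : ℝ} (hx : 0 ≤ x) (z : ℝ) : z ≤ logL x z := by
  have : 0 ≤ Real.log (1 + x⁻¹) := by
    refine Real.log_nonneg ?_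
    have : 0 ≤ x⁻¹ := by positivity
    linarith
  unfold logL
  linarith

/-- (1 - 2t)(1 + t)² = 1 - 3t² - 2t³ ≤ 1. The bound is linear in t, so the error can be integrated
explicitly. -/
theorem one_sub_two_mul_div_le {G A t : ℝ} (hG : 0 < G) (hA : 0 < A) (ht : 0 ≤ t) :
    1 / G * (1 - 2 * t) / A ≤ (G * (A * (1 + t) ^ 2))⁻¹ := by
  have h1 : (1 - 2 * t) * (1 + t) ^ 2 ≤ 1 := by
    nlinarith [mul_nonneg ht ht, mul_nonneg (mul_nonneg ht ht) ht]
  rw [div_mul_eq_mul_div, one_mul, div_div, div_le_iff₀ (by positivity)]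
  have e : (G * (A * (1 + t) ^ 2))⁻¹ * (G * A) = 1 / (1 + t) ^ 2 := by
    field_simp
  rw [e, le_div_iff₀ (by positivity)]
  exact h1

/-! ### The lattice sum of the lower symbol. -/

section lower

variable {w : EuclideanSpace ℝ (Fin 2)} {N n : ℕ} {lam z θ G ρ : ℝ} {q : Fin n → Mode}

/-- The resolvent symbol that enters the lower bound. -/
def lowerSymbol (w : EuclideanSpace ℝ (Fin 2)) (N : ℕ) (lam z θ G : ℝ) {n : ℕ}
    (k : Fin n → Mode) : ℝ :=
  (lam + 1 / 2 * ∑ i, ‖(k i).vec‖ ^ 2 + G / 2 *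
    ((∑ i, (inner ℝ w (k i).vec) ^ 2) *
      logL ((lam + 1 / 2 * ∑ i, ‖(k i).vec‖ ^ 2) / (N : ℝ) ^ 2) z ^ θ +
      ∑ i, ‖(k i).vec‖ ^ 2))⁻¹

/-- The annulus 4ρ ≤ |y| ≤ N/4 is chosen so that l, q b - l and q b are all nonzero and of length at
most N: the cutoff equals 1. There the energy after splitting is at least |y|²/8, so its logarithm
is at most `radialLog`. -/
theorem le_lowerSymbol (hlam : 0 < lam) (hz : 0 < z) (hθ : 0 ≤ θ) (hG : 0 < G)
    (hq : ∀ i, q i ≠ 0) (hρ : 1 ≤ ρ)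
    (hρ2 : ρ ^ 2 = 2 * lam + ∑ i, ‖(q i).vec‖ ^ 2) (j : Fin (n + 1)) (b : Fin n) {l : Mode}
    {y : ℝ × ℝ} (hy : y ∈ cell l) (h1 : 4 * ρ ≤ ‖planePoint y‖) (h2 : ‖planePoint y‖ ≤ N / 4) :
    1 / G * (1 - 2 * (2 * ρ * √((1 + 1 / G + radialLog N z ‖planePoint y‖ ^ θ * ‖w‖ ^ 2) /
      (1 + 1 / G)) / ‖planePoint y‖)) /
      anisoForm w (1 + 1 / G) (radialLog N z ‖planePoint y‖ ^ θ) (planePoint y) ≤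
    cutoff N (q b - l) l * lowerSymbol w N lam z θ G (split j b q l) := by
  set u := planePoint y with hu
  set r := ‖u‖ with hr
  have hr0 : 0 < r := by linarith
  have hNr : r ≤ N := by linarith
  set B := radialLog N z r ^ θ with hB
  have hzr : z ≤ radialLog N z r := le_radialLog hr0 hNr
  have hB0 : 0 ≤ B := Real.rpow_nonneg (hz.le.trans hzr) θ
  set a := 1 + 1 / G with ha
  have ha0 : 0 < a := by positivity
  have hul := norm_planePoint_sub_le hy
  have hul' : ‖u - l.vec‖ ≤ 3 / 2 :=
    (sq_le_sq₀ (norm_nonneg _) (by norm_num)).mp (hul.trans (by norm_num))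
  have hl1 : ‖l.vec‖ ≤ r + 3 / 2 := by
    have := norm_sub_norm_le l.vec u
    rw [norm_sub_rev] at this
    linarith
  have hl2 : r - 3 / 2 ≤ ‖l.vec‖ := by
    have := norm_sub_norm_le u l.vec
    linarith
  obtain ⟨rs, rk, hrs0, hrk0, hrkle, hrs, hsplit⟩ := exists_split_sums w q b
  obtain ⟨esq', esk'⟩ := hsplit j l
  set p := q b with hp
  have hρ2' : ρ ^ 2 = 2 * lam + ‖p.vec‖ ^ 2 + rs := by rw [hρ2, hrs, add_assoc]
  have hpρ : ‖p.vec‖ ≤ ρ := by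
    refine (sq_le_sq₀ (norm_nonneg _) (by linarith)).mp ?_
    rw [hρ2']; linarith
  have hp0 : 1 ≤ ‖p.vec‖ := one_le_norm_vec (hq b)
  have hplow : ‖l.vec‖ - ρ ≤ ‖p.vec - l.vec‖ := by
    have := norm_sub_norm_le l.vec p.vec
    rw [norm_sub_rev] at this
    linarith
  have hpup : ‖p.vec - l.vec‖ ≤ ρ + ‖l.vec‖ := (norm_sub_le _ _).trans (by linarith)
  have hcut : cutoff N (p - l) l = 1 := by
    refine cutoff_eq_one ?_ ?_ ?_ ?_ ?_ ?_
    · rw [vec_sub]; linarith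
    · rw [vec_sub]; linarith
    · linarith
    · linarith
    · rw [sub_add_cancel]; linarith
    · rw [sub_add_cancel]; linarith
  rw [hcut, one_mul]
  unfold lowerSymbol
  rw [esq', esk']
  set sq := ‖l.vec‖ ^ 2 + ‖p.vec - l.vec‖ ^ 2 + rs with hsq
  set sk := (inner ℝ w l.vec) ^ 2 + (inner ℝ w (p.vec - l.vec)) ^ 2 + rk with hsk
  have hsk0 : 0 ≤ sk := by rw [hsk]; positivity
  have hsq0 : 0 ≤ sq := by rw [hsq]; positivity
  have hx : r ^ 2 / 8 ≤ lam + 1 / 2 * sq := by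
    have h3 : r / 2 ≤ ‖l.vec‖ := by linarith
    have h4 : (r / 2) ^ 2 ≤ ‖l.vec‖ ^ 2 := pow_le_pow_left₀ (by linarith) h3 2
    have h5 : 0 ≤ ‖p.vec - l.vec‖ ^ 2 := sq_nonneg _
    rw [hsq]
    linarith
  have hlogz : z ≤ logL ((lam + 1 / 2 * sq) / (N : ℝ) ^ 2) z := logL_ge (by positivity) z
  have hLB : logL ((lam + 1 / 2 * sq) / (N : ℝ) ^ 2) z ^ θ ≤ B :=
    Real.rpow_le_rpow (hz.le.trans hlogz) (logL_le_radialLog hr0 hNr hx) hθ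
  have hlog0 : 0 ≤ logL ((lam + 1 / 2 * sq) / (N : ℝ) ^ 2) z ^ θ :=
    Real.rpow_nonneg (hz.le.trans hlogz) _
  have hQ := anisoForm_split_le (w := w) (B := B) ha0 hB0 hr0 hul hlam.le hrs0 hrk0 hrkle hρ hρ2'
  set t := 2 * ρ * √((a + B * ‖w‖ ^ 2) / a) / r with ht
  have ht0 : 0 ≤ t := by positivity
  have hA : 0 < anisoForm w a B u := anisoForm_pos ha0 hB0 hr0
  have hden : lam + 1 / 2 * sq + G / 2 * (sk * logL ((lam + 1 / 2 * sq) / (N : ℝ) ^ 2) z ^ θ + sq) ≤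
      G * (anisoForm w a B u * (1 + t) ^ 2) := by
    have h6 : sk * logL ((lam + 1 / 2 * sq) / (N : ℝ) ^ 2) z ^ θ ≤ B * sk := by
      rw [mul_comm]
      exact mul_le_mul_of_nonneg_right hLB hsk0
    have h7 : G * (a * (2 * lam + sq)) = (G + 1) * (2 * lam + sq) := by
      rw [ha]; field_simp
    have h8 : G * (sk * logL ((lam + 1 / 2 * sq) / (N : ℝ) ^ 2) z ^ θ) ≤ G * (B * sk) :=
      mul_le_mul_of_nonneg_left h6 hG.le
    have h9 := mul_le_mul_of_nonneg_left hQ hG.le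
    have h10 : 0 ≤ G * lam := by positivity
    linarith
  have hdpos : 0 < lam + 1 / 2 * sq +
      G / 2 * (sk * logL ((lam + 1 / 2 * sq) / (N : ℝ) ^ 2) z ^ θ + sq) := by positivity
  exact (one_sub_two_mul_div_le hG hA ht0).trans (inv_anti₀ hdpos hden)

theorem lowerSymbol_nonneg (hlam : 0 < lam) (hz : 0 < z) (hG : 0 < G) (k : Fin n → Mode) :
    0 ≤ lowerSymbol w N lam z θ G k := by
  unfold lowerSymbol
  have h : 0 ≤ logL ((lam + 1 / 2 * ∑ i, ‖(k i).vec‖ ^ 2) / (N : ℝ) ^ 2) z ^ θ :=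
    Real.rpow_nonneg (hz.le.trans (logL_ge (by positivity) z)) _
  positivity

/-- Polar coordinates turn the cell bound into a radial integral over the annulus. The hypothesis on
η replaces the angular factor √(a(a + B|w|²)) by |w|√B, after which the integrand has an elementary
primitive. The term linear in ρ/r integrates to at most 2π. -/
theorem le_tsum_lowerSymbol (hw : 0 < ‖w‖) (hlam : 0 < lam) (hz : 0 < z) (hθ : 0 ≤ θ) (hθ1 : θ ≤ 1)
    (hG : 0 < G) (hq : ∀ i, q i ≠ 0) (hρ : 1 ≤ ρ)
    (hρ2 : ρ ^ 2 = 2 * lam + ∑ i, ‖(q i).vec‖ ^ 2) (hρN : 16 * ρ ≤ N) {η : ℝ}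
    (hη : ∀ B, z ^ θ ≤ B →
      (1 - η) * √((1 + 1 / G) * (1 + 1 / G + B * ‖w‖ ^ 2)) ≤ ‖w‖ * √B)
    (j : Fin (n + 1)) (b : Fin n) :
    1 / G * (Real.pi * (1 - η) / (‖w‖ * (1 - θ / 2)) *
      (radialLog N z (4 * ρ) ^ (1 - θ / 2) - radialLog N z (N / 4) ^ (1 - θ / 2)) - 2 * Real.pi) ≤
    ∑' l, cutoff N (q b - l) l * lowerSymbol w N lam z θ G (split j b q l) := by
  have hpi := Real.pi_pos
  set a := 1 + 1 / G with ha
  have ha1 : 1 ≤ a := by rw [ha]; have : 0 < 1 / G := by positivity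
                         linarith
  have ha0 : 0 < a := by linarith
  have hN : (0 : ℝ) < N := by linarith
  set B : ℝ → ℝ := fun r => |radialLog N z r| ^ θ with hB
  set γ : ℝ → ℝ := Set.indicator (Set.Ioc (4 * ρ) (N / 4)) (fun r =>
    1 / G * (1 - 2 * (2 * ρ * √((a + B r * ‖w‖ ^ 2) / a) / r))) with hγ
  have hterm : ∀ l, 0 ≤ cutoff N (q b - l) l * lowerSymbol w N lam z θ G (split j b q l) := fun l =>
    mul_nonneg (cutoff_nonneg _ _ _) (lowerSymbol_nonneg hlam hz hG _)
  have hrl : ∀ r : ℝ, 0 < r → r ≤ N → |radialLog N z r| = radialLog N z r := fun r h1 h2 =>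
    abs_of_pos (hz.trans_le (le_radialLog h1 h2))
  have hcell : ∀ l, ∀ y ∈ cell l, ENNReal.ofReal (γ ‖planePoint y‖ /
      (a * ‖planePoint y‖ ^ 2 + B ‖planePoint y‖ * (inner ℝ w (planePoint y)) ^ 2)) ≤
      ENNReal.ofReal (cutoff N (q b - l) l * lowerSymbol w N lam z θ G (split j b q l)) := by
    intro l y hy
    refine ENNReal.ofReal_le_ofReal ?_
    by_cases hr : ‖planePoint y‖ ∈ Set.Ioc (4 * ρ) ((N : ℝ) / 4)
    · have hr0 : 0 < ‖planePoint y‖ := by linarith [hr.1]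
      have hrN : ‖planePoint y‖ ≤ N := by linarith [hr.2]
      have := le_lowerSymbol (w := w) (N := N) (z := z) hlam hz hθ hG hq hρ hρ2 j b hy hr.1.le hr.2
      rw [hγ, Set.indicator_of_mem hr]
      simp only [hB, hrl _ hr0 hrN]
      exact this
    · rw [hγ, Set.indicator_of_notMem hr, zero_div]
      exact hterm l
  have hInt := lintegral_le_tsum_of_le_on_cell hcell
  have hmlog : Measurable (radialLog N z) := by
    unfold radialLog
    fun_prop
  have hmB : Measurable B := (hmlog.norm).pow_const θ
  rw [lintegral_polar w (α := fun r => a * r ^ 2) (β := B) (γ := γ) (by fun_prop) hmB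
    (Measurable.indicator (by fun_prop) measurableSet_Ioc)
    (fun r hr => by positivity) (fun r _ => Real.rpow_nonneg (abs_nonneg _) _),
    ← ENNReal.ofReal_tsum_of_nonneg hterm (summable_cutoff_mul N (q b) _)] at hInt
  -- The derivative of `radialLog` is -2/r, so its power 1 - θ/2 is a primitive of L^(-θ/2)/r up to
  -- a constant.
  set F : ℝ → ℝ := fun r => 1 / G * (-(Real.pi * (1 - η) / (‖w‖ * (1 - θ / 2)) *
    radialLog N z r ^ (1 - θ / 2)) + 8 * Real.pi * ρ / r) with hF
  set F' : ℝ → ℝ := fun r => 1 / G * (2 * Real.pi * (1 - η) / (‖w‖ * r) *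
    radialLog N z r ^ (-(θ / 2)) - 8 * Real.pi * ρ / r ^ 2) with hF'
  have hab : 4 * ρ ≤ (N : ℝ) / 4 := by linarith
  have hθ2 : 0 < 1 - θ / 2 := by linarith
  have hpos : ∀ r ∈ Set.Icc (4 * ρ) ((N : ℝ) / 4), 0 < r ∧ r ≤ N ∧ 0 < radialLog N z r := by
    intro r hr
    have h1 : 0 < r := by linarith [hr.1]
    have h2 : r ≤ N := by linarith [hr.2]
    exact ⟨h1, h2, hz.trans_le (le_radialLog h1 h2)⟩
  have hFd : ∀ r ∈ Set.Icc (4 * ρ) ((N : ℝ) / 4), HasDerivAt F (F' r) r := by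
    intro r hr
    obtain ⟨h1, h2, h3⟩ := hpos r hr
    have d1 := (hasDerivAt_radialLog N z h1.ne').rpow_const (p := 1 - θ / 2) (Or.inl h3.ne')
    have d2 : HasDerivAt (fun r => 8 * Real.pi * ρ / r) (-(8 * Real.pi * ρ) / r ^ 2) r := by
      have := (hasDerivAt_inv h1.ne').const_mul (8 * Real.pi * ρ)
      refine (this.congr_deriv ?_)
      ring
    refine (((d1.const_mul (Real.pi * (1 - η) / (‖w‖ * (1 - θ / 2)))).neg.add d2).const_mul
      (1 / G)).congr_deriv ?_
    simp only [hF']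
    rw [show 1 - θ / 2 - 1 = -(θ / 2) by ring]
    have hne := hθ2.ne'
    generalize 1 - θ / 2 = T at hne ⊢
    field_simp
    ring
  have hFc : ContinuousOn F' (Set.Icc (4 * ρ) ((N : ℝ) / 4)) := by
    have hlogc : ContinuousOn (radialLog N z) (Set.Icc (4 * ρ) ((N : ℝ) / 4)) := fun r hr =>
      (hasDerivAt_radialLog N z (hpos r hr).1.ne').continuousAt.continuousWithinAt
    refine continuousOn_const.mul (ContinuousOn.sub (ContinuousOn.mul ?_ ?_) ?_)
    · exact continuousOn_const.div (by fun_prop) fun r hr => (mul_pos hw (hpos r hr).1).ne'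
    · exact hlogc.rpow_const fun r hr => Or.inl (hpos r hr).2.2.ne'
    · exact continuousOn_const.div (by fun_prop) fun r hr => (pow_pos (hpos r hr).1 2).ne'
  have hle : ∀ r ∈ Set.Icc (4 * ρ) ((N : ℝ) / 4), F' r ≤ 2 * Real.pi * (r * (1 / G * (1 - 2 *
      (2 * ρ * √((a + B r * ‖w‖ ^ 2) / a) / r)))) /
      √(a * r ^ 2 * (a * r ^ 2 + B r * r ^ 2 * ‖w‖ ^ 2)) := by
    intro r hr
    obtain ⟨h1, h2, h3⟩ := hpos r hr
    have hzr := le_radialLog (z := z) h1 h2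
    have eB : B r = radialLog N z r ^ θ := by simp only [hB, hrl r h1 h2]
    have hB0 : 0 < B r := by rw [eB]; positivity
    set M := a + B r * ‖w‖ ^ 2 with hM
    have hM0 : 0 < M := by positivity
    have es : √(a * r ^ 2 * (a * r ^ 2 + B r * r ^ 2 * ‖w‖ ^ 2)) = r ^ 2 * √(a * M) := by
      rw [show a * r ^ 2 * (a * r ^ 2 + B r * r ^ 2 * ‖w‖ ^ 2) = (r ^ 2) ^ 2 * (a * M) by
        rw [hM]; ring, Real.sqrt_mul (by positivity), Real.sqrt_sq (by positivity)]
    have hs0 : 0 < √(a * M) := Real.sqrt_pos.mpr (by positivity)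
    have em : √(M / a) * a = √(a * M) := by
      rw [Real.sqrt_div hM0.le, Real.sqrt_mul ha0.le, div_mul_eq_mul_div, div_eq_iff
        (Real.sqrt_pos.mpr ha0).ne']
      have := Real.mul_self_sqrt ha0.le
      linear_combination -√M * this
    have hsB : √(B r) = radialLog N z r ^ (θ / 2) := by
      rw [eB, Real.sqrt_eq_rpow, ← Real.rpow_mul h3.le]
      congr 1
      ring
    have hηr := hη (B r) (by rw [eB]; exact Real.rpow_le_rpow hz.le hzr hθ)
    have hsB0 : 0 < √(B r) := Real.sqrt_pos.mpr hB0
    have e1 : radialLog N z r ^ (-(θ / 2)) = (√(B r))⁻¹ := by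
      rw [hsB, Real.rpow_neg h3.le]
    have h4 : (1 - η) / (‖w‖ * √(B r)) ≤ 1 / √(a * M) := by
      rw [div_le_div_iff₀ (by positivity) hs0, one_mul]
      exact hηr
    have h5 : 1 / a ≤ 1 := by rw [div_le_one ha0]; exact ha1
    rw [es]
    have e2 : 2 * Real.pi * (r * (1 / G * (1 - 2 * (2 * ρ * √(M / a) / r)))) /
        (r ^ 2 * √(a * M)) =
        1 / G * (2 * Real.pi / r * (1 / √(a * M)) - 8 * Real.pi * ρ / r ^ 2 * (1 / a)) := by
      rw [← em]
      have hsM : 0 < √(M / a) := Real.sqrt_pos.mpr (by positivity)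
      field_simp
      ring
    have e3 : F' r = 1 / G * (2 * Real.pi / r * ((1 - η) / (‖w‖ * √(B r))) -
        8 * Real.pi * ρ / r ^ 2) := by
      simp only [hF']
      rw [e1]
      field_simp
    rw [e2, e3]
    have h6 : 2 * Real.pi / r * ((1 - η) / (‖w‖ * √(B r))) ≤ 2 * Real.pi / r * (1 / √(a * M)) :=
      mul_le_mul_of_nonneg_left h4 (by positivity)
    have h7 : 8 * Real.pi * ρ / r ^ 2 * (1 / a) ≤ 8 * Real.pi * ρ / r ^ 2 :=
      mul_le_of_le_one_right (by positivity) h5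
    refine mul_le_mul_of_nonneg_left ?_ (by positivity)
    linarith
  have hlow := ofReal_sub_le_lintegral hab hFd hFc hle
  have hchain : ENNReal.ofReal (F (N / 4) - F (4 * ρ)) ≤ ENNReal.ofReal
      (∑' l, cutoff N (q b - l) l * lowerSymbol w N lam z θ G (split j b q l)) := by
    refine hlow.trans (le_trans ?_ hInt)
    refine le_trans (le_of_eq ?_) (lintegral_mono_set (s := Set.Ioc (4 * ρ) ((N : ℝ) / 4))
      fun r hr => ?_)
    · refine setLIntegral_congr_fun measurableSet_Ioc fun r hr => ?_
      simp only [hγ, Set.indicator_of_mem hr]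
    · have : 4 * ρ < r := hr.1
      exact Set.mem_Ioi.mpr (by linarith)
  have hreal := (ENNReal.ofReal_le_ofReal_iff (tsum_nonneg hterm)).mp hchain
  refine le_trans ?_ hreal
  simp only [hF]
  rw [← mul_sub]
  refine mul_le_mul_of_nonneg_left ?_ (by positivity)
  have e4 : 8 * Real.pi * ρ / (4 * ρ) = 2 * Real.pi := by field_simp; ring
  rw [e4]
  have : 0 ≤ 8 * Real.pi * ρ / ((N : ℝ) / 4) := by positivity
  linarith

end lower

/-! ### Upper bound of the diagonal terms -/

theorem logL_anti {x x' : ℝ} (hx : 0 < x) (h : x ≤ x') (z : ℝ) : logL x' z ≤ logL x z := by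
  unfold logL
  have h1 : x'⁻¹ ≤ x⁻¹ := inv_anti₀ hx h
  have h2 : 0 < x'⁻¹ := inv_pos.mpr (hx.trans_le h)
  have := Real.log_le_log (by linarith : 0 < 1 + x'⁻¹) (by linarith : 1 + x'⁻¹ ≤ 1 + x⁻¹)
  linarith

/-- The factor 18 lowers the logarithm by at most log 18 ≤ 3, which is at most half of z and hence
of `logL x z`. -/
theorem half_logL_le {x z : ℝ} (hx : 0 < x) (hz : 6 ≤ z) : logL x z / 2 ≤ logL (18 * x) z := by
  have h1 : 1 + x⁻¹ ≤ 18 * (1 + (18 * x)⁻¹) := by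
    have : 18 * (18 * x)⁻¹ = x⁻¹ := by field_simp
    linarith
  have hx' : 0 < x⁻¹ := inv_pos.mpr hx
  have h2 := Real.log_le_log (by positivity) h1
  rw [Real.log_mul (by norm_num) (by positivity)] at h2
  have h3 : Real.log 18 ≤ 3 := by
    rw [Real.log_le_iff_le_exp (by norm_num)]
    have h5 : (2.7 : ℝ) ≤ Real.exp 1 := by linarith [Real.exp_one_gt_d9]
    have h6 : Real.exp 3 = Real.exp 1 ^ 3 := by rw [← Real.exp_nat_mul]; norm_num
    rw [h6]
    calc (18 : ℝ) ≤ 2.7 ^ 3 := by norm_num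
      _ ≤ Real.exp 1 ^ 3 := by gcongr
  have h4 : 0 ≤ Real.log (1 + (18 * x)⁻¹) := by
    refine Real.log_nonneg ?_
    have : 0 < (18 * x)⁻¹ := by positivity
    linarith
  unfold logL
  linarith

theorem summable_inv_norm_cube : Summable fun l : Mode => 1 / ‖l.vec‖ ^ 3 := by
  have h := EisensteinSeries.summable_one_div_norm_rpow (k := 3) (by norm_num)
  refine Summable.of_nonneg_of_le (fun l => by positivity) (fun l : Mode => ?_) h
  by_cases hl : l = 0
  · rw [hl, vec_zero, norm_zero]
    simp
  have h1 : ‖l‖ ≤ ‖l.vec‖ := by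
    refine (pi_norm_le_iff_of_nonneg (norm_nonneg _)).mpr fun i => ?_
    refine le_trans (le_of_eq ?_) (PiLp.norm_apply_le l.vec i)
    rfl
  have h2 : 0 < ‖l‖ := norm_pos_iff.mpr hl
  rw [Real.rpow_neg (norm_nonneg _), one_div]
  refine inv_anti₀ (by positivity) ?_
  rw [show (3 : ℝ) = ((3 : ℕ) : ℝ) by norm_num, Real.rpow_natCast]
  gcongr

/-- A multiple of the summable |l|⁻³ is split off; only the remaining positive part is compared with
an integral. -/
theorem tsum_le_add_inv_cube {f : Mode → ℝ} (hf0 : ∀ l, 0 ≤ f l) (hfs : Summable f) {c C : ℝ}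
    (hc : 0 ≤ c) (hC : 0 ≤ C)
    (h : ∑' l : Mode, ENNReal.ofReal (max 0 (f l - c * (1 / ‖l.vec‖ ^ 3))) ≤ ENNReal.ofReal C) :
    ∑' l, f l ≤ C + c * ∑' l : Mode, 1 / ‖l.vec‖ ^ 3 := by
  have hs : Summable fun l : Mode => max 0 (f l - c * (1 / ‖l.vec‖ ^ 3)) := by
    refine Summable.of_nonneg_of_le (fun l => le_max_left _ _) (fun l => ?_) hfs
    refine max_le (hf0 l) ?_
    have : 0 ≤ c * (1 / ‖l.vec‖ ^ 3) := by positivity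
    linarith
  have h1 := tsum_le_of_tsum_ofReal_le hs (fun l => le_max_left _ _) hC h
  have h2 : ∑' l, f l ≤ ∑' l : Mode, max 0 (f l - c * (1 / ‖l.vec‖ ^ 3)) +
      c * ∑' l : Mode, 1 / ‖l.vec‖ ^ 3 := by
    rw [← tsum_mul_left, ← hs.tsum_add (summable_inv_norm_cube.mul_left c)]
    refine hfs.tsum_le_tsum (fun l => ?_) (hs.add (summable_inv_norm_cube.mul_left c))
    have := le_max_right 0 (f l - c * (1 / ‖l.vec‖ ^ 3))
    linarith
  linarith

/-- The constant in the upper bound of the diagonal terms. -/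
def upperConst (ω : ℝ) : ℝ := 60 * ω * ∑' l : Mode, 1 / ‖l.vec‖ ^ 3 + 800 / ω

/-! ### The lattice sum of the upper symbol. -/

section upper

variable {w : EuclideanSpace ℝ (Fin 2)} {N n : ℕ} {lam z θ g : ℝ} {q : Fin n → Mode}

/-- The resolvent symbol that enters the upper bound. -/
def upperSymbol (w : EuclideanSpace ℝ (Fin 2)) (N : ℕ) (lam z θ g : ℝ) {n : ℕ}
    (k : Fin n → Mode) : ℝ :=
  (1 / 3 * (lam + 1 / 2 * ∑ i, ‖(k i).vec‖ ^ 2) + 1 / (2 * g) *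
    ((∑ i, (inner ℝ w (k i).vec) ^ 2) *
      logL ((lam + 1 / 2 * ∑ i, ‖(k i).vec‖ ^ 2) / (N : ℝ) ^ 2) z ^ θ))⁻¹

theorem upperSymbol_nonneg (hlam : 0 < lam) (hz : 0 < z) (hg : 0 < g) (k : Fin n → Mode) :
    0 ≤ upperSymbol w N lam z θ g k := by
  unfold upperSymbol
  have h : 0 ≤ logL ((lam + 1 / 2 * ∑ i, ‖(k i).vec‖ ^ 2) / (N : ℝ) ^ 2) z ^ θ :=
    Real.rpow_nonneg (hz.le.trans (logL_ge (by positivity) z)) _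
  positivity

/-- First simplification of the symbol after a mode has been split. -/
theorem upperSymbol_split_le (hlam : 0 < lam) (hz : 0 < z) (hθ : 0 ≤ θ) (hg : 0 < g) (hN : 0 < N)
    (j : Fin (n + 1)) (b : Fin n) (l : Mode) {x₀ : ℝ}
    (hx₀ : x₀ = lam + 1 / 2 * ∑ i, ‖(q i).vec‖ ^ 2) :
    upperSymbol w N lam z θ g (split j b q l) ≤
      ((x₀ + ‖l.vec‖ ^ 2) / 12 + 1 / (2 * g) *
        logL (2 * (x₀ + ‖l.vec‖ ^ 2) / (N : ℝ) ^ 2) z ^ θ * (inner ℝ w l.vec) ^ 2)⁻¹ := by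
  obtain ⟨rs, rk, hrs0, hrk0, -, hrs, hsplit⟩ := exists_split_sums w q b
  obtain ⟨esq, esk⟩ := hsplit j l
  unfold upperSymbol
  rw [esq, esk]
  rw [hrs] at hx₀
  set p := (q b).vec
  have hN' : (0 : ℝ) < N := by exact_mod_cast hN
  have h1 : ‖p‖ ^ 2 ≤ 2 * ‖p - l.vec‖ ^ 2 + 2 * ‖l.vec‖ ^ 2 := by
    have := norm_add_sq_le one_pos (p - l.vec) l.vec
    rw [sub_add_cancel] at this
    linarith
  have h2 : ‖p - l.vec‖ ^ 2 ≤ 2 * ‖p‖ ^ 2 + 2 * ‖l.vec‖ ^ 2 := by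
    have := norm_add_sq_le one_pos p (-l.vec)
    rw [norm_neg, ← sub_eq_add_neg] at this
    linarith
  have h3 : 0 ≤ ‖p - l.vec‖ ^ 2 := sq_nonneg _
  have h4 : 0 ≤ ‖l.vec‖ ^ 2 := sq_nonneg _
  have h5 : 0 ≤ ‖p‖ ^ 2 := sq_nonneg _
  set x := lam + 1 / 2 * (‖l.vec‖ ^ 2 + ‖p - l.vec‖ ^ 2 + rs) with hx
  have hx1 : (x₀ + ‖l.vec‖ ^ 2) / 4 ≤ x := by linarith
  have hx2 : x ≤ 2 * (x₀ + ‖l.vec‖ ^ 2) := by linarith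
  have hx₀0 : 0 < x₀ := by linarith
  have hx0 : 0 < x := by linarith
  have hL : logL (2 * (x₀ + ‖l.vec‖ ^ 2) / (N : ℝ) ^ 2) z ^ θ ≤ logL (x / (N : ℝ) ^ 2) z ^ θ := by
    refine Real.rpow_le_rpow (hz.le.trans (logL_ge (by positivity) z)) ?_ hθ
    refine logL_anti (by positivity) ?_ z
    gcongr
  have hL0 : 0 ≤ logL (2 * (x₀ + ‖l.vec‖ ^ 2) / (N : ℝ) ^ 2) z ^ θ :=
    Real.rpow_nonneg (hz.le.trans (logL_ge (by positivity) z)) _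
  refine inv_anti₀ (by positivity) ?_
  have h6 : logL (2 * (x₀ + ‖l.vec‖ ^ 2) / (N : ℝ) ^ 2) z ^ θ * (inner ℝ w l.vec) ^ 2 ≤
      ((inner ℝ w l.vec) ^ 2 + (inner ℝ w (p - l.vec)) ^ 2 + rk) *
        logL (x / (N : ℝ) ^ 2) z ^ θ := by
    rw [mul_comm]
    have h7 : 0 ≤ (inner ℝ w (p - l.vec)) ^ 2 := sq_nonneg _
    have h8 : 0 ≤ (inner ℝ w l.vec) ^ 2 := sq_nonneg _
    exact mul_le_mul (by linarith) hL hL0 (by linarith)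
  have h9 := mul_le_mul_of_nonneg_left h6 (by positivity : 0 ≤ 1 / (2 * g))
  linarith

/-- Comparison of the symbol at a lattice point with its values on the unit cell. -/
theorem upperSymbol_le_on_cell (hz : 6 ≤ z) (hθ : 0 ≤ θ) (hθ1 : θ ≤ 1) (hg : 1 ≤ g) (hN : 0 < N)
    {l : Mode} (hl : l ≠ 0) {x₀ : ℝ} (hx₀ : 1 / 2 ≤ x₀) {y : ℝ × ℝ} (hy : y ∈ cell l) :
    ((x₀ + ‖l.vec‖ ^ 2) / 12 + 1 / (2 * g) *
      logL (2 * (x₀ + ‖l.vec‖ ^ 2) / (N : ℝ) ^ 2) z ^ θ * (inner ℝ w l.vec) ^ 2)⁻¹ ≤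
    60 * ‖w‖ * logL (x₀ / (N : ℝ) ^ 2) z ^ (1 - θ / 2) * (1 / ‖l.vec‖ ^ 3) +
    1 / ((x₀ + ‖planePoint y‖ ^ 2) / 144 + 1 / (8 * g) *
      logL ((x₀ + ‖planePoint y‖ ^ 2) / (N : ℝ) ^ 2) z ^ θ * (inner ℝ w (planePoint y)) ^ 2) := by
  have hN' : (0 : ℝ) < N := by exact_mod_cast hN
  have hl1 := one_le_norm_vec hl
  have hul := norm_planePoint_sub_le hy
  set u := planePoint y
  set v := l.vec
  have hx0 : 0 < x₀ := by linarith
  set yl := x₀ + ‖v‖ ^ 2 with hyl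
  set yu := x₀ + ‖u‖ ^ 2 with hyu
  have hyl0 : 0 < yl := by positivity
  have hyu0 : 0 < yu := by positivity
  set L0 := logL (x₀ / (N : ℝ) ^ 2) z with hL0
  set Ll := logL (2 * yl / (N : ℝ) ^ 2) z with hLl
  set Lu := logL (yu / (N : ℝ) ^ 2) z with hLu
  have hL01 : z ≤ L0 := logL_ge (by positivity) z
  have hLl1 : z ≤ Ll := logL_ge (by positivity) z
  have hLu1 : z ≤ Lu := logL_ge (by positivity) z
  have hLl0 : Ll ≤ L0 := by
    refine logL_anti (by positivity) ?_ z
    gcongr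
    nlinarith [sq_nonneg ‖v‖]
  have h1 : ‖u‖ ^ 2 ≤ 2 * ‖v‖ ^ 2 + 4 := by
    have := norm_add_sq_le one_pos v (u - v)
    rw [add_sub_cancel] at this
    linarith
  have h2 : ‖v‖ ^ 2 ≤ 2 * ‖u‖ ^ 2 + 4 := by
    have := norm_add_sq_le one_pos u (v - u)
    rw [add_sub_cancel, norm_sub_rev v u] at this
    linarith
  have h3 : (inner ℝ w u) ^ 2 ≤ 2 * (inner ℝ w v) ^ 2 + 4 * ‖w‖ ^ 2 := by
    have := norm_add_sq_le one_pos (inner ℝ w v : ℝ) (inner ℝ w (u - v))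
    rw [← inner_add_right, add_sub_cancel] at this
    simp only [Real.norm_eq_abs, sq_abs] at this
    have h4 := inner_sq_le w (u - v)
    have h5 := mul_le_mul_of_nonneg_left hul (sq_nonneg ‖w‖)
    linarith
  have hv1 : 1 ≤ ‖v‖ ^ 2 := one_le_pow₀ hl1
  have hyul : yu ≤ 6 * yl := by rw [hyu, hyl]; linarith
  have hylu : 2 * yl ≤ 18 * yu := by rw [hyu, hyl]; linarith [sq_nonneg ‖u‖]
  have hLlu : Lu / 2 ≤ Ll := by
    refine (half_logL_le (by positivity) hz).trans (logL_anti (by positivity) ?_ z)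
    rw [← mul_div_assoc]
    gcongr
  have hLlu' : Lu ^ θ / 2 ≤ Ll ^ θ := by
    have h6 : (Lu / 2) ^ θ ≤ Ll ^ θ := Real.rpow_le_rpow (by linarith) hLlu hθ
    rw [Real.div_rpow (by linarith) (by norm_num)] at h6
    refine le_trans ?_ h6
    have h7 : (2 : ℝ) ^ θ ≤ 2 := by
      calc (2 : ℝ) ^ θ ≤ 2 ^ (1 : ℝ) := Real.rpow_le_rpow_of_exponent_le (by norm_num) hθ1
        _ = 2 := Real.rpow_one 2
    have h8 : 0 ≤ Lu ^ θ := Real.rpow_nonneg (by linarith) _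
    gcongr
  have hLuθ : 0 ≤ Lu ^ θ := Real.rpow_nonneg (by linarith) _
  have hLlθ : 0 < Ll ^ θ := Real.rpow_pos_of_pos (by linarith) _
  have hL0θ' : 0 < L0 ^ (1 - θ / 2) := Real.rpow_pos_of_pos (by linarith) _
  have hg0 : 0 < g := by linarith
  set A := 1 / (2 * g) * Ll ^ θ with hA
  have hA0 : 0 < A := by positivity
  have hsq : 0 ≤ (inner ℝ w v) ^ 2 := sq_nonneg _
  have hsqu : 0 ≤ (inner ℝ w u) ^ 2 := sq_nonneg _
  have hlast : 0 ≤ 1 / (yu / 144 + 1 / (8 * g) * Lu ^ θ * (inner ℝ w u) ^ 2) := by positivity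
  have hfirst : 0 ≤ 60 * ‖w‖ * L0 ^ (1 - θ / 2) * (1 / ‖v‖ ^ 3) := by positivity
  -- Within a cell (w·y)² can exceed its value at l by a term of order |w|². If the isotropic part
  -- is large it absorbs this. Otherwise |l| is at most 5|w|Q, and 12/|l|² is bounded by
  -- 60|w|Q/|l|³, the part that is summed separately.
  rcases le_or_gt (48 * A * ‖w‖ ^ 2) yl with hc | hc
  · refine le_trans ?_ (le_add_of_nonneg_left hfirst)
    rw [one_div]
    refine inv_anti₀ (by positivity) ?_
    have h9 : 1 / (8 * g) * Lu ^ θ * (inner ℝ w u) ^ 2 ≤ A / 2 * (inner ℝ w u) ^ 2 := by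
      refine mul_le_mul_of_nonneg_right ?_ hsqu
      have e : 1 / (8 * g) * Lu ^ θ = 1 / (4 * g) * (Lu ^ θ / 2) := by field_simp; ring
      have e2 : A / 2 = 1 / (4 * g) * Ll ^ θ := by rw [hA]; field_simp; ring
      rw [e, e2]
      exact mul_le_mul_of_nonneg_left hLlu' (by positivity)
    have h10 := mul_le_mul_of_nonneg_left h3 hA0.le
    linarith
  · refine le_trans ?_ (le_add_of_nonneg_right hlast)
    have h11 : (yl / 12 + A * (inner ℝ w v) ^ 2)⁻¹ ≤ 12 / yl := by
      rw [show 12 / yl = (yl / 12)⁻¹ by rw [inv_div]]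
      refine inv_anti₀ (by positivity) ?_
      have := mul_nonneg hA0.le hsq
      linarith
    refine h11.trans ?_
    have hAL : A ≤ L0 ^ θ / 2 := by
      have h12 : Ll ^ θ ≤ L0 ^ θ := Real.rpow_le_rpow (by linarith) hLl0 hθ
      have h13 : 1 / (2 * g) ≤ 1 / 2 := by
        apply one_div_le_one_div_of_le <;> linarith
      calc A ≤ 1 / 2 * L0 ^ θ := mul_le_mul h13 h12 hLlθ.le (by norm_num)
        _ = _ := by ring
    have h14 : L0 ^ θ ≤ (L0 ^ (1 - θ / 2)) ^ 2 := by
      rw [← Real.rpow_natCast, ← Real.rpow_mul (by linarith)]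
      refine Real.rpow_le_rpow_of_exponent_le (by linarith) ?_
      push_cast
      linarith
    set Q := L0 ^ (1 - θ / 2)
    have h15 : yl ≤ (5 * ‖w‖ * Q) ^ 2 := by
      have h16 : A * ‖w‖ ^ 2 ≤ Q ^ 2 / 2 * ‖w‖ ^ 2 :=
        mul_le_mul_of_nonneg_right (by linarith) (sq_nonneg _)
      have h17 : 0 ≤ Q ^ 2 * ‖w‖ ^ 2 := by positivity
      nlinarith
    have h18 : ‖v‖ ≤ 5 * ‖w‖ * Q := by
      refine (sq_le_sq₀ (norm_nonneg _) (by positivity)).mp (le_trans ?_ h15)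
      rw [hyl]; linarith
    have hv0 : 0 < ‖v‖ := by linarith
    calc 12 / yl ≤ 12 / ‖v‖ ^ 2 := by
          gcongr
          rw [hyl]; linarith
      _ = 12 * ‖v‖ / ‖v‖ ^ 3 := by field_simp
      _ ≤ 12 * (5 * ‖w‖ * Q) / ‖v‖ ^ 3 := by gcongr
      _ = _ := by ring

theorem hasDerivAt_logL_sq {N : ℕ} (hN : 0 < N) (z : ℝ) {a r : ℝ} (hs : 0 < a + r) :
    HasDerivAt (fun r => logL ((a + r) ^ 2 / (N : ℝ) ^ 2) z)
      (-(2 * (N : ℝ) ^ 2 / ((a + r) * ((a + r) ^ 2 + (N : ℝ) ^ 2)))) r := by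
  have hN' : (0 : ℝ) < N := by exact_mod_cast hN
  unfold logL
  have d1 : HasDerivAt (fun r => (a + r) ^ 2 / (N : ℝ) ^ 2) (2 * (a + r) / (N : ℝ) ^ 2) r := by
    have := (((hasDerivAt_id r).const_add a).pow 2).div_const ((N : ℝ) ^ 2)
    refine this.congr_deriv ?_
    simp
  have hpos : 0 < (a + r) ^ 2 / (N : ℝ) ^ 2 := by positivity
  have hpos' : 0 < 1 + ((a + r) ^ 2 / (N : ℝ) ^ 2)⁻¹ := by positivity
  have d2 : HasDerivAt (fun r => Real.log (1 + ((a + r) ^ 2 / (N : ℝ) ^ 2)⁻¹))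
      (-(2 * (a + r) / (N : ℝ) ^ 2) / ((a + r) ^ 2 / (N : ℝ) ^ 2) ^ 2 /
        (1 + ((a + r) ^ 2 / (N : ℝ) ^ 2)⁻¹)) r :=
    ((d1.inv hpos.ne').const_add 1).log hpos'.ne'
  refine (d2.add_const z).congr_deriv ?_
  field_simp

/-- The variable s = √x₀ + r replaces √(x₀ + r²), with s² between x₀ + r² and twice that. Keeping
one isotropic and one anisotropic factor under the root leaves √g/|w| times ℓ^(-θ/2)/s. -/
theorem lintegral_radial_le (hw : 0 < ‖w‖) (hz : 6 ≤ z) (hθ : 0 ≤ θ) (hθ1 : θ ≤ 1) (hg : 1 ≤ g)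
    (hN : 0 < N) {x₀ : ℝ} (hx₀ : 0 < x₀) :
    ∫⁻ r in Set.Ioc (0 : ℝ) (3 * N), ENNReal.ofReal (2 * Real.pi * r /
      √((x₀ + r ^ 2) / 144 * ((x₀ + r ^ 2) / 144 + 1 / (8 * g) *
        logL ((x₀ + r ^ 2) / (N : ℝ) ^ 2) z ^ θ * r ^ 2 * ‖w‖ ^ 2))) ≤
    ENNReal.ofReal (800 / ‖w‖ * √g * logL (x₀ / (N : ℝ) ^ 2) z ^ (1 - θ / 2)) := by
  have hN' : (0 : ℝ) < N := by exact_mod_cast hN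
  have hg0 : 0 < g := by linarith
  set a := √x₀ with ha
  have ha0 : 0 < a := Real.sqrt_pos.mpr hx₀
  have ha2 : a ^ 2 = x₀ := Real.sq_sqrt hx₀.le
  set ℓ : ℝ → ℝ := fun r => logL ((a + r) ^ 2 / (N : ℝ) ^ 2) z with hℓ
  have hℓz : ∀ r, z ≤ ℓ r := fun r => logL_ge (by positivity) z
  set C := 320 * √g / ‖w‖ with hC
  have hC0 : 0 < C := by
    have : 0 < √g := Real.sqrt_pos.mpr hg0
    positivity
  set T := 1 - θ / 2 with hT
  have hT0 : 1 / 2 ≤ T := by rw [hT]; linarith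
  set F : ℝ → ℝ := fun r => C * (-(1 / (2 * T) * ℓ r ^ T) + r / (2 * N)) with hF
  set F' : ℝ → ℝ := fun r => C * ((N : ℝ) ^ 2 / ((a + r) * ((a + r) ^ 2 + (N : ℝ) ^ 2)) *
    ℓ r ^ (-(θ / 2)) + 1 / (2 * N)) with hF'
  have hd : ∀ r ∈ Set.Icc (0 : ℝ) (3 * N), HasDerivAt F (F' r) r := by
    intro r hr
    have hs : 0 < a + r := by linarith [hr.1]
    have h1 := (hasDerivAt_logL_sq hN z hs).rpow_const (p := T)
      (Or.inl (by have := hℓz r; simp only [hℓ] at this; linarith))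
    refine (((h1.const_mul (1 / (2 * T))).neg.add ((hasDerivAt_id r).div_const (2 * N))).const_mul
      C).congr_deriv ?_
    simp only [hF', hℓ]
    rw [show T - 1 = -(θ / 2) by rw [hT]; ring]
    have : T ≠ 0 := by linarith
    field_simp
  have hc : ContinuousOn F' (Set.Icc (0 : ℝ) (3 * N)) := by
    have hℓc : ContinuousOn ℓ (Set.Icc (0 : ℝ) (3 * N)) := fun r hr =>
      (hasDerivAt_logL_sq hN z (by linarith [hr.1] : 0 < a + r)).continuousAt.continuousWithinAt
    refine continuousOn_const.mul (ContinuousOn.add (ContinuousOn.mul ?_ ?_) continuousOn_const)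
    · refine continuousOn_const.div (by fun_prop) fun r hr => ?_
      have : 0 < a + r := by linarith [hr.1]
      positivity
    · exact hℓc.rpow_const fun r _ => Or.inl (by linarith [hℓz r])
  have hmain := lintegral_le_ofReal_sub (a := 0) (b := 3 * N) (by positivity) hd hc
    (h := fun r => 2 * Real.pi * r /
      √((x₀ + r ^ 2) / 144 * ((x₀ + r ^ 2) / 144 + 1 / (8 * g) *
        logL ((x₀ + r ^ 2) / (N : ℝ) ^ 2) z ^ θ * r ^ 2 * ‖w‖ ^ 2))) ?_ ?_
  · refine hmain.trans (ENNReal.ofReal_le_ofReal ?_)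
    have e0 : ℓ 0 = logL (x₀ / (N : ℝ) ^ 2) z := by simp only [hℓ, add_zero, ha2]
    rw [← e0]
    simp only [hF]
    have h1 : 0 ≤ 1 / (2 * T) * ℓ (3 * N) ^ T := by
      have : 0 ≤ ℓ (3 * N) ^ T := Real.rpow_nonneg (by linarith [hℓz (3 * N)]) _
      positivity
    have h2 : 1 ≤ ℓ 0 ^ T := Real.one_le_rpow (by linarith [hℓz 0]) (by linarith)
    have h3 : 1 / (2 * T) ≤ 1 := by rw [div_le_one (by linarith)]; linarith
    have h4 : 1 / (2 * T) * ℓ 0 ^ T ≤ 1 * ℓ 0 ^ T := mul_le_mul_of_nonneg_right h3 (by linarith)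
    have h5 : 3 * (N : ℝ) / (2 * N) = 3 / 2 := by field_simp
    have e : 800 / ‖w‖ * √g * ℓ 0 ^ T = C * (5 / 2 * ℓ 0 ^ T) := by rw [hC]; ring
    rw [e, ← mul_sub]
    refine mul_le_mul_of_nonneg_left ?_ hC0.le
    rw [h5, zero_div]
    linarith
  · intro r hr
    have hr0 : 0 < r := hr.1
    set yr := x₀ + r ^ 2 with hyr
    have hyr0 : 0 < yr := by positivity
    set s := a + r with hs
    have hs0 : 0 < s := by linarith
    have hys : yr ≤ s ^ 2 := by rw [hyr, hs, ← ha2]; nlinarith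
    have hsy : s ^ 2 ≤ 2 * yr := by rw [hyr, hs, ← ha2]; nlinarith [sq_nonneg (a - r)]
    have hLs : ℓ r ≤ logL (yr / (N : ℝ) ^ 2) z := by
      simp only [hℓ]
      refine logL_anti (by positivity) ?_ z
      gcongr
    have hℓ0 : 0 < ℓ r := by linarith [hℓz r]
    set Lr := logL (yr / (N : ℝ) ^ 2) z
    have hLr0 : 0 < Lr := hℓ0.trans_le hLs
    -- lower bound of the root
    have hroot : r * s * ‖w‖ * ℓ r ^ (θ / 2) / (48 * √g) ≤
        √(yr / 144 * (yr / 144 + 1 / (8 * g) * Lr ^ θ * r ^ 2 * ‖w‖ ^ 2)) := by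
      refine Real.le_sqrt_of_sq_le ?_
      have e1 : (ℓ r ^ (θ / 2)) ^ 2 = ℓ r ^ θ := by
        rw [← Real.rpow_natCast, ← Real.rpow_mul hℓ0.le]
        congr 1
        push_cast
        ring
      have e2 : (r * s * ‖w‖ * ℓ r ^ (θ / 2) / (48 * √g)) ^ 2 =
          s ^ 2 / 2 / 144 * (1 / (8 * g) * ℓ r ^ θ * r ^ 2 * ‖w‖ ^ 2) := by
        rw [div_pow, mul_pow, mul_pow, mul_pow, e1, mul_pow, Real.sq_sqrt hg0.le]
        field_simp
        ring
      rw [e2]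
      have h6 : ℓ r ^ θ ≤ Lr ^ θ := Real.rpow_le_rpow hℓ0.le hLs hθ
      have h7 : 0 ≤ ℓ r ^ θ := Real.rpow_nonneg hℓ0.le _
      have h8 : 1 / (8 * g) * ℓ r ^ θ * r ^ 2 * ‖w‖ ^ 2 ≤
          yr / 144 + 1 / (8 * g) * Lr ^ θ * r ^ 2 * ‖w‖ ^ 2 := by
        have h9 : 1 / (8 * g) * ℓ r ^ θ * r ^ 2 * ‖w‖ ^ 2 ≤
            1 / (8 * g) * Lr ^ θ * r ^ 2 * ‖w‖ ^ 2 := by gcongr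
        have : 0 ≤ yr / 144 := by positivity
        linarith
      refine mul_le_mul ?_ h8 (by positivity) (by positivity)
      linarith
    have hlow0 : 0 < r * s * ‖w‖ * ℓ r ^ (θ / 2) / (48 * √g) := by
      have h10 : 0 < √g := Real.sqrt_pos.mpr hg0
      have h11 : 0 < ℓ r ^ (θ / 2) := Real.rpow_pos_of_pos hℓ0 _
      positivity
    have hstep : 2 * Real.pi * r / √(yr / 144 * (yr / 144 + 1 / (8 * g) * Lr ^ θ * r ^ 2 * ‖w‖ ^ 2)) ≤
        C * (1 / s * ℓ r ^ (-(θ / 2))) := by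
      calc 2 * Real.pi * r / √(yr / 144 * (yr / 144 + 1 / (8 * g) * Lr ^ θ * r ^ 2 * ‖w‖ ^ 2))
          ≤ 2 * Real.pi * r / (r * s * ‖w‖ * ℓ r ^ (θ / 2) / (48 * √g)) := by
            have := Real.pi_pos
            gcongr
        _ = (96 * Real.pi) * (√g / ‖w‖) * (1 / s * ℓ r ^ (-(θ / 2))) := by
            rw [Real.rpow_neg hℓ0.le]
            have h11 : 0 < ℓ r ^ (θ / 2) := Real.rpow_pos_of_pos hℓ0 _
            field_simp
            ring
        _ ≤ 320 * (√g / ‖w‖) * (1 / s * ℓ r ^ (-(θ / 2))) := by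
            have h12 : 96 * Real.pi ≤ 320 := by linarith [Real.pi_lt_d2]
            have h13 : 0 ≤ ℓ r ^ (-(θ / 2)) := Real.rpow_nonneg hℓ0.le _
            gcongr
        _ = _ := by rw [hC]; ring
    refine hstep.trans (mul_le_mul_of_nonneg_left ?_ hC0.le)
    -- The first summand is minus half the derivative of ℓ; the second is at most 1/(2N), hence
    -- integrates to at most 3/2 over the range of length 3N.
    have e3 : 1 / s = (N : ℝ) ^ 2 / (s * (s ^ 2 + (N : ℝ) ^ 2)) + s / (s ^ 2 + (N : ℝ) ^ 2) := by
      field_simp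
      ring
    have h14 : ℓ r ^ (-(θ / 2)) ≤ 1 :=
      Real.rpow_le_one_of_one_le_of_nonpos (by linarith [hℓz r]) (by linarith)
    have h15 : 0 ≤ ℓ r ^ (-(θ / 2)) := Real.rpow_nonneg hℓ0.le _
    have h16 : s / (s ^ 2 + (N : ℝ) ^ 2) ≤ 1 / (2 * N) := by
      rw [div_le_div_iff₀ (by positivity) (by positivity)]
      nlinarith [sq_nonneg (s - N)]
    have h17 : s / (s ^ 2 + (N : ℝ) ^ 2) * ℓ r ^ (-(θ / 2)) ≤ 1 / (2 * N) * 1 :=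
      mul_le_mul h16 h14 h15 (by positivity)
    rw [e3]
    linarith
  · intro r hr
    have hr0 : 0 < r := hr.1
    have h15 : 0 ≤ ℓ r ^ (-(θ / 2)) := Real.rpow_nonneg (by linarith [hℓz r]) _
    have : 0 < a + r := by linarith
    positivity

/-- What remains of a term of the lattice sum after the summable part is controlled by the
integral over the cell. -/
theorem cutoff_mul_upperSymbol_le (hlam : 0 < lam) (hz : 6 ≤ z) (hθ : 0 ≤ θ)
    (hθ1 : θ ≤ 1) (hg : 1 ≤ g) (hN : 0 < N) (j : Fin (n + 1)) (b : Fin n) {x₀ : ℝ}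
    (hx₀ : x₀ = lam + 1 / 2 * ∑ i, ‖(q i).vec‖ ^ 2) (hx₀h : 1 / 2 ≤ x₀) {l : Mode} {y : ℝ × ℝ}
    (hy : y ∈ cell l) :
    max 0 (cutoff N (q b - l) l * upperSymbol w N lam z θ g (split j b q l) -
      60 * ‖w‖ * logL (x₀ / (N : ℝ) ^ 2) z ^ (1 - θ / 2) * (1 / ‖l.vec‖ ^ 3)) ≤
    Set.indicator (Set.Iic (3 * (N : ℝ))) (fun _ => 1) ‖planePoint y‖ /
      ((x₀ + ‖planePoint y‖ ^ 2) / 144 + 1 / (8 * g) *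
      logL ((x₀ + ‖planePoint y‖ ^ 2) / (N : ℝ) ^ 2) z ^ θ * (inner ℝ w (planePoint y)) ^ 2) := by
  have hg0 : 0 < g := by linarith
  have hz0 : 0 < z := by linarith
  have hN1 : (1 : ℝ) ≤ N := by exact_mod_cast hN
  have hx₀0 : 0 < x₀ := by linarith
  have hLu : 0 ≤ logL ((x₀ + ‖planePoint y‖ ^ 2) / (N : ℝ) ^ 2) z ^ θ :=
    Real.rpow_nonneg (hz0.le.trans (logL_ge (by positivity) z)) _
  have hL0 : 0 ≤ logL (x₀ / (N : ℝ) ^ 2) z ^ (1 - θ / 2) :=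
    Real.rpow_nonneg (hz0.le.trans (logL_ge (by positivity) z)) _
  have hγ0 : 0 ≤ Set.indicator (Set.Iic (3 * (N : ℝ))) (fun _ => (1 : ℝ)) ‖planePoint y‖ :=
    Set.indicator_nonneg (fun _ _ => zero_le_one) _
  have hrhs : 0 ≤ Set.indicator (Set.Iic (3 * (N : ℝ))) (fun _ => 1) ‖planePoint y‖ /
      ((x₀ + ‖planePoint y‖ ^ 2) / 144 + 1 / (8 * g) *
      logL ((x₀ + ‖planePoint y‖ ^ 2) / (N : ℝ) ^ 2) z ^ θ * (inner ℝ w (planePoint y)) ^ 2) :=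
    div_nonneg hγ0 (by positivity)
  refine max_le hrhs ?_
  by_cases hcut : cutoff N (q b - l) l = 0
  · rw [hcut, zero_mul, zero_sub]
    exact (neg_nonpos.mpr (by positivity)).trans hrhs
  · obtain ⟨-, ⟨hl0, hlN⟩, -⟩ := of_cutoff_ne_zero hcut
    have hl : l ≠ 0 := by
      rintro rfl
      rw [vec_zero, norm_zero] at hl0
      exact lt_irrefl _ hl0
    have hul' : ‖planePoint y - l.vec‖ ≤ 3 / 2 :=
      (sq_le_sq₀ (norm_nonneg _) (by norm_num)).mp
        ((norm_planePoint_sub_le hy).trans (by norm_num))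
    have hr : ‖planePoint y‖ ≤ 3 * (N : ℝ) := by
      have := norm_sub_norm_le (planePoint y) l.vec
      linarith
    rw [Set.indicator_of_mem (Set.mem_Iic.mpr hr)]
    have h1 : cutoff N (q b - l) l * upperSymbol w N lam z θ g (split j b q l) ≤
        upperSymbol w N lam z θ g (split j b q l) :=
      mul_le_of_le_one_left (upperSymbol_nonneg hlam hz0 hg0 _) (cutoff_le_one _ _ _)
    have h2 := upperSymbol_split_le (w := w) (θ := θ) hlam hz0 hθ hg0 hN j b l hx₀
    have h3 := upperSymbol_le_on_cell (w := w) hz hθ hθ1 hg hN hl hx₀h hy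
    linarith

theorem lintegral_upper_le (hw : 0 < ‖w‖) (hz : 6 ≤ z) (hθ : 0 ≤ θ) (hθ1 : θ ≤ 1) (hg : 1 ≤ g)
    (hN : 0 < N) {x₀ : ℝ} (hx₀ : 0 < x₀) :
    ∫⁻ y, ENNReal.ofReal (Set.indicator (Set.Iic (3 * (N : ℝ))) (fun _ => 1) ‖planePoint y‖ /
      ((x₀ + ‖planePoint y‖ ^ 2) / 144 + 1 / (8 * g) *
      logL ((x₀ + ‖planePoint y‖ ^ 2) / (N : ℝ) ^ 2) z ^ θ * (inner ℝ w (planePoint y)) ^ 2)) ≤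
    ENNReal.ofReal (800 / ‖w‖ * √g * logL (x₀ / (N : ℝ) ^ 2) z ^ (1 - θ / 2)) := by
  have hβ : Measurable fun r : ℝ => 1 / (8 * g) * logL ((x₀ + r ^ 2) / (N : ℝ) ^ 2) z ^ θ := by
    unfold logL
    fun_prop
  rw [lintegral_polar w (α := fun r => (x₀ + r ^ 2) / 144) (by fun_prop) hβ
    (Measurable.indicator measurable_const measurableSet_Iic)
    (fun r hr => by positivity)
    (fun r hr => mul_nonneg (by positivity)
      (Real.rpow_nonneg ((by linarith : 0 ≤ z).trans (logL_ge (by positivity) z)) _))]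
  refine le_trans ?_ (lintegral_radial_le hw hz hθ hθ1 hg hN hx₀)
  rw [← Set.Ioi_inter_Iic, Set.inter_comm, ← setLIntegral_indicator measurableSet_Iic]
  refine lintegral_mono fun r => ?_
  by_cases hr : r ∈ Set.Iic (3 * (N : ℝ))
  · rw [Set.indicator_of_mem hr, Set.indicator_of_mem hr, mul_one]
  · rw [Set.indicator_of_notMem hr, Set.indicator_of_notMem hr, mul_zero, mul_zero, zero_div,
      ENNReal.ofReal_zero]

theorem tsum_upperSymbol_le (hw : 0 < ‖w‖) (hlam : 0 < lam) (hz : 6 ≤ z) (hθ : 0 ≤ θ) (hθ1 : θ ≤ 1)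
    (hg : 1 ≤ g) (hN : 0 < N) (hq : ∀ i, q i ≠ 0) (j : Fin (n + 1)) (b : Fin n) :
    ∑' l, cutoff N (q b - l) l * upperSymbol w N lam z θ g (split j b q l) ≤
      upperConst ‖w‖ * √g *
        logL ((lam + 1 / 2 * ∑ i, ‖(q i).vec‖ ^ 2) / (N : ℝ) ^ 2) z ^ (1 - θ / 2) := by
  obtain ⟨x₀, hx₀⟩ : ∃ x₀, x₀ = lam + 1 / 2 * ∑ i, ‖(q i).vec‖ ^ 2 := ⟨_, rfl⟩
  rw [← hx₀]
  have hg0 : 0 < g := by linarith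
  have hz0 : 0 < z := by linarith
  have hx₀h : 1 / 2 ≤ x₀ := by
    have h1 : ‖(q b).vec‖ ^ 2 ≤ ∑ i, ‖(q i).vec‖ ^ 2 :=
      Finset.single_le_sum (f := fun i => ‖(q i).vec‖ ^ 2) (fun i _ => sq_nonneg _)
        (Finset.mem_univ b)
    have h2 : 1 ≤ ‖(q b).vec‖ ^ 2 := one_le_pow₀ (one_le_norm_vec (hq b))
    rw [hx₀]
    linarith
  have hx₀0 : 0 < x₀ := by linarith
  have hcell := fun l y (hy : y ∈ cell l) => ENNReal.ofReal_le_ofReal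
    (cutoff_mul_upperSymbol_le (w := w) (N := N) (q := q) hlam hz hθ hθ1 hg hN j b hx₀ hx₀h hy)
  have hInt := (tsum_le_lintegral_of_le_on_cell hcell).trans
    (lintegral_upper_le hw hz hθ hθ1 hg hN hx₀0)
  have hQ0 : 0 ≤ logL (x₀ / (N : ℝ) ^ 2) z ^ (1 - θ / 2) :=
    Real.rpow_nonneg (hz0.le.trans (logL_ge (by positivity) z)) _
  have hmain := tsum_le_add_inv_cube
    (fun l => mul_nonneg (cutoff_nonneg _ _ _) (upperSymbol_nonneg hlam hz0 hg0 _))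
    (summable_cutoff_mul N (q b) _) (by positivity) (by positivity) hInt
  refine hmain.trans ?_
  generalize logL (x₀ / (N : ℝ) ^ 2) z ^ (1 - θ / 2) = Q at hQ0 ⊢
  have hsg : 1 ≤ √g := Real.one_le_sqrt.mpr hg
  have hS : 0 ≤ ∑' l : Mode, 1 / ‖l.vec‖ ^ 3 := tsum_nonneg fun l => by positivity
  unfold upperConst
  have h4 : 60 * ‖w‖ * Q * ∑' l : Mode, 1 / ‖l.vec‖ ^ 3 ≤
      (60 * ‖w‖ * Q * ∑' l : Mode, 1 / ‖l.vec‖ ^ 3) * √g :=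
    le_mul_of_one_le_right (by positivity) hsg
  linarith

end upper

/-! ### The exponents and the constants -/

theorem theta_add_three (k : ℕ) : theta (k + 3) = 1 - theta (k + 2) / 2 := rfl

theorem theta_eq (k : ℕ) : theta (k + 2) = 2 / 3 - 2 / 3 * (-1 / 2) ^ k := by
  induction k with
  | zero => norm_num [theta]
  | succ k ih => rw [theta_add_three, ih, pow_succ]; ring

theorem tendsto_theta : Filter.Tendsto theta Filter.atTop (nhds (2 / 3)) := by
  rw [← Filter.tendsto_add_atTop_iff_nat 2]
  simp only [theta_eq]
  have h : Filter.Tendsto (fun k : ℕ => (-1 / 2 : ℝ) ^ k) Filter.atTop (nhds 0) :=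
    tendsto_pow_atTop_nhds_zero_of_abs_lt_one (by norm_num [abs_lt])
  simpa using (h.const_mul (2 / 3 : ℝ)).const_sub (2 / 3 : ℝ)

/-- The exponents approach 2/3 from alternating sides. The lower bound needs θ ≥ 2/3 at odd levels,
both for 1/(1 - θ/2) ≥ 3/2 and for z^θ ≥ z^(2/3). -/
theorem theta_even (k : ℕ) : 0 ≤ theta (2 * k + 2) ∧ theta (2 * k + 2) ≤ 2 / 3 := by
  rw [theta_eq, pow_mul]
  have h1 : (0 : ℝ) ≤ ((-1 / 2) ^ 2) ^ k := by positivity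
  have h2 : ((-1 / 2 : ℝ) ^ 2) ^ k ≤ 1 := pow_le_one₀ (by positivity) (by norm_num)
  constructor <;> linarith

theorem theta_odd (k : ℕ) : 2 / 3 ≤ theta (2 * k + 3) ∧ theta (2 * k + 3) ≤ 1 := by
  rw [theta_add_three]
  have := theta_even k
  constructor <;> linarith

/-- The relative error `1 / (2 (k+1)^(1+δ))` in the recursion of the constants. -/
def epsCoeff (δ : ℝ) (k : ℕ) : ℝ := 1 / (2 * ((k : ℝ) + 1) ^ (1 + δ))

section constants

variable {w : EuclideanSpace ℝ (Fin 2)} {δ : ℝ}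

theorem epsCoeff_pos (k : ℕ) : 0 < epsCoeff δ k := by
  unfold epsCoeff
  positivity

theorem epsCoeff_le (hδ : 0 < δ) (k : ℕ) : epsCoeff δ k ≤ 1 / 2 := by
  unfold epsCoeff
  have : 1 ≤ ((k : ℝ) + 1) ^ (1 + δ) :=
    Real.one_le_rpow (by linarith [(Nat.cast_nonneg k : (0 : ℝ) ≤ k)]) (by linarith)
  exact one_div_le_one_div_of_le (by norm_num) (by linarith)

theorem cCoeff_two : cCoeff w δ 2 = 1 / (Real.pi * max (‖w‖ ^ 2) 1) := by simp [cCoeff]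

theorem cCoeff_odd (k : ℕ) : cCoeff w δ (2 * k + 3) =
    3 / (2 * Real.pi * ‖w‖) * ((1 + epsCoeff δ k) / cCoeff w δ (2 * k + 2)) := by
  have h1 : Odd (2 * k + 3) := ⟨k + 1, by ring⟩
  have h2 : (2 * k + 2) / 2 = k + 1 := by omega
  rw [cCoeff]
  simp only [h1, if_true, h2, epsCoeff]
  push_cast
  rfl

theorem cCoeff_even (k : ℕ) : cCoeff w δ (2 * k + 4) =
    3 / (2 * Real.pi * ‖w‖) *
      ((1 - epsCoeff δ k) / ((1 + epsCoeff δ k) * cCoeff w δ (2 * k + 3))) := by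
  have h1 : ¬ Odd (2 * k + 1 + 3) := by
    rw [Nat.not_odd_iff_even]
    exact ⟨k + 2, by ring⟩
  have h2 : (2 * k + 1 + 2) / 2 = k + 1 := by omega
  rw [show 2 * k + 4 = (2 * k + 1) + 3 by ring, cCoeff]
  simp only [h1, if_false, h2, epsCoeff]
  push_cast
  rfl

/-- Two steps of the recursion multiply the constant by (1 - ε)/(1 + ε)² ≤ 1, so the bound at c₂
persists. It is what keeps λ - ℒ₀ plus the lower symbol positive. -/
theorem cCoeff_even_bounds (hw : 0 < ‖w‖) (hδ : 0 < δ) (k : ℕ) :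
    0 < cCoeff w δ (2 * k + 2) ∧ cCoeff w δ (2 * k + 2) * (Real.pi * max (‖w‖ ^ 2) 1) ≤ 1 := by
  have hm : 1 ≤ max (‖w‖ ^ 2) 1 := le_max_right _ _
  have hpi := Real.pi_pos
  induction k with
  | zero =>
    rw [show 2 * 0 + 2 = 2 by norm_num, cCoeff_two]
    constructor
    · positivity
    · rw [one_div_mul_cancel (by positivity)]
  | succ k ih =>
    obtain ⟨h0, h1⟩ := ih
    have he := epsCoeff_pos (δ := δ) k
    have he1 := epsCoeff_le hδ k
    rw [show 2 * (k + 1) + 2 = 2 * k + 4 by ring, cCoeff_even, cCoeff_odd]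
    set c := cCoeff w δ (2 * k + 2)
    set ε := epsCoeff δ k
    have e : 3 / (2 * Real.pi * ‖w‖) *
        ((1 - ε) / ((1 + ε) * (3 / (2 * Real.pi * ‖w‖) * ((1 + ε) / c)))) =
        c * ((1 - ε) / (1 + ε) ^ 2) := by
      field_simp
    have h2 : 0 < (1 - ε) / (1 + ε) ^ 2 := div_pos (by linarith) (by positivity)
    have h3 : (1 - ε) / (1 + ε) ^ 2 ≤ 1 := by
      rw [div_le_one (by positivity)]
      nlinarith
    rw [e]
    refine ⟨mul_pos h0 h2, le_trans ?_ h1⟩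
    refine mul_le_mul_of_nonneg_right (mul_le_of_le_one_right h0.le h3) (by positivity)

theorem cCoeff_even_lt_one (hw : 0 < ‖w‖) (hδ : 0 < δ) (k : ℕ) : cCoeff w δ (2 * k + 2) < 1 := by
  obtain ⟨h0, h1⟩ := cCoeff_even_bounds (w := w) hw hδ k
  have hm : 1 ≤ max (‖w‖ ^ 2) 1 := le_max_right _ _
  have hpi := Real.pi_gt_three
  have h2 : 3 ≤ Real.pi * max (‖w‖ ^ 2) 1 := by nlinarith
  nlinarith

theorem le_cCoeff_odd (hw : 0 < ‖w‖) (hδ : 0 < δ) (k : ℕ) :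
    3 / (2 * Real.pi * ‖w‖) / cCoeff w δ (2 * k + 2) ≤ cCoeff w δ (2 * k + 3) := by
  obtain ⟨h0, -⟩ := cCoeff_even_bounds (w := w) hw hδ k
  have he := epsCoeff_pos (δ := δ) k
  have hpi := Real.pi_pos
  rw [cCoeff_odd, div_eq_mul_one_div]
  gcongr
  linarith

/-- The even constant is at most 1/(π|w|) because |w| ≤ max(|w|², 1), which gives at least 3/2. -/
theorem one_lt_cCoeff_odd (hw : 0 < ‖w‖) (hδ : 0 < δ) (k : ℕ) : 1 < cCoeff w δ (2 * k + 3) := by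
  obtain ⟨h0, h1⟩ := cCoeff_even_bounds (w := w) hw hδ k
  refine lt_of_lt_of_le ?_ (le_cCoeff_odd hw hδ k)
  have hpi := Real.pi_pos
  have hm : ‖w‖ ≤ max (‖w‖ ^ 2) 1 := by
    rcases le_total ‖w‖ 1 with h | h
    · exact h.trans (le_max_right _ _)
    · exact le_trans (by nlinarith) (le_max_left _ _)
  rw [div_div, lt_div_iff₀ (by positivity), one_mul]
  have h2 : cCoeff w δ (2 * k + 2) * (Real.pi * ‖w‖) ≤ 1 := by
    refine le_trans ?_ h1
    gcongr
  linarith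

theorem cCoeff_odd_mul_even (hw : 0 < ‖w‖) (hδ : 0 < δ) (k : ℕ) :
    cCoeff w δ (2 * k + 3) * cCoeff w δ (2 * k + 4) =
      3 / (2 * Real.pi * ‖w‖) * ((1 - epsCoeff δ k) / (1 + epsCoeff δ k)) := by
  have h1 := one_lt_cCoeff_odd (w := w) hw hδ k
  have he := epsCoeff_pos (δ := δ) k
  rw [cCoeff_even]
  have : cCoeff w δ (2 * k + 3) ≠ 0 := by linarith
  field_simp

end constants

/-! ### The size of `z` and `f` -/

/-- z and f depend on n + k only: going down one chaos and up one level leaves them unchanged, so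
the induction step works with a single z and a single f. -/
theorem zCoeff_succ (K δ : ℝ) (k n : ℕ) : zCoeff K δ k (n + 1) = zCoeff K δ (k + 1) n := by
  unfold zCoeff
  push_cast
  rw [show (n : ℝ) + 1 + k = n + (k + 1) by ring]

theorem fCoeff_succ (K δ : ℝ) (k n : ℕ) : fCoeff K δ k (n + 1) = fCoeff K δ (k + 1) n := by
  rw [fCoeff, zCoeff_succ, fCoeff]

/-- The exponent 9/2 + 3δ/2 is made for this: f grows like (n+k)^(3+δ), enough for the off-diagonal
n² times the inverse (n+k)^(1+δ) of the allowed error. -/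
theorem zCoeff_rpow {K δ : ℝ} (hK : 0 ≤ K) (k n : ℕ) :
    zCoeff K δ k n ^ (2 / 3 : ℝ) = K ^ (2 / 3 : ℝ) * ((n : ℝ) + k) ^ (3 + δ) := by
  unfold zCoeff
  rw [Real.mul_rpow hK (by positivity), ← Real.rpow_mul (by positivity)]
  congr 2
  ring

/-- The lower bound that is imposed on `K ^ (2/3)`. -/
def baseConst (ω : ℝ) : ℝ :=
  100 + 3 * ω + 80 * ω ^ 3 + (ω * upperConst ω) ^ 2 + (1 + 6 / ω ^ 2)

section size

variable {ω K δ : ℝ}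

/-- The uses: 100 for the size of z and for the off-diagonal error in the upper bound; 3ω for the
loss 2π in the radial integral; 80ω³ for the off-diagonal error in the lower bound; the square for
the constant of the upper lattice sum; 1 + 6/ω² for the anisotropy error η ≤ ε. -/
theorem baseConst_ge (hω : 0 < ω) : 100 ≤ baseConst ω ∧ 100 + 3 * ω ≤ baseConst ω ∧
    80 * ω ^ 3 ≤ baseConst ω ∧ (ω * upperConst ω) ^ 2 ≤ baseConst ω ∧
    1 + 6 / ω ^ 2 ≤ baseConst ω := by
  unfold baseConst
  have h1 : 0 ≤ 80 * ω ^ 3 := by positivity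
  have h2 : 0 ≤ (ω * upperConst ω) ^ 2 := sq_nonneg _
  have h3 : 0 ≤ 6 / ω ^ 2 := by positivity
  refine ⟨?_, ?_, ?_, ?_, ?_⟩ <;> linarith

theorem baseConst_le_rpow (hω : 0 < ω) (hK : baseConst ω ^ (3 / 2 : ℝ) ≤ K) :
    0 < K ∧ baseConst ω ≤ K ^ (2 / 3 : ℝ) := by
  have h0 : 0 < baseConst ω := by linarith [(baseConst_ge hω).1]
  have hK0 : 0 < K := (Real.rpow_pos_of_pos h0 _).trans_le hK
  refine ⟨hK0, ?_⟩
  calc baseConst ω = (baseConst ω ^ (3 / 2 : ℝ)) ^ (2 / 3 : ℝ) := by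
        rw [← Real.rpow_mul h0.le]; norm_num
    _ ≤ K ^ (2 / 3 : ℝ) := Real.rpow_le_rpow (by positivity) hK (by norm_num)

theorem le_zCoeff_rpow (hω : 0 < ω) (hK : baseConst ω ^ (3 / 2 : ℝ) ≤ K) (k n : ℕ)
    {x : ℝ} (hx : x ≤ ((n : ℝ) + k) ^ (3 + δ)) (hx0 : 0 ≤ x) :
    baseConst ω * x ≤ zCoeff K δ k n ^ (2 / 3 : ℝ) := by
  obtain ⟨hK0, hb⟩ := baseConst_le_rpow hω hK
  rw [zCoeff_rpow hK0.le]
  exact mul_le_mul hb hx hx0 (by positivity)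

theorem le_zCoeff_rpow_self (hω : 0 < ω) (hK : baseConst ω ^ (3 / 2 : ℝ) ≤ K) (hδ : 0 < δ)
    {k : ℕ} (hk : 1 ≤ k) (n : ℕ) : baseConst ω ≤ zCoeff K δ k n ^ (2 / 3 : ℝ) := by
  have hk' : (1 : ℝ) ≤ k := by exact_mod_cast hk
  have := le_zCoeff_rpow hω hK k n (x := 1)
    (Real.one_le_rpow (by linarith [(Nat.cast_nonneg n : (0 : ℝ) ≤ n)]) (by linarith)) zero_le_one
  linarith

theorem zCoeff_nonneg (hK : 0 ≤ K) (k n : ℕ) : 0 ≤ zCoeff K δ k n := by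
  unfold zCoeff
  positivity

theorem one_le_zCoeff (hω : 0 < ω) (hK : baseConst ω ^ (3 / 2 : ℝ) ≤ K) (hδ : 0 < δ)
    {k : ℕ} (hk : 1 ≤ k) (n : ℕ) :
    zCoeff K δ k n ^ (2 / 3 : ℝ) ≤ zCoeff K δ k n ∧ 100 ≤ zCoeff K δ k n := by
  obtain ⟨hK0, -⟩ := baseConst_le_rpow hω hK
  have h0 := zCoeff_nonneg (δ := δ) hK0.le k n
  have h1 := le_zCoeff_rpow_self hω hK hδ hk n
  have h2 := (baseConst_ge hω).1
  have h3 : 1 ≤ zCoeff K δ k n := by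
    by_contra h
    push Not at h
    have := Real.rpow_le_one h0 h.le (by norm_num : (0 : ℝ) ≤ 2 / 3)
    linarith
  have h4 : zCoeff K δ k n ^ (2 / 3 : ℝ) ≤ zCoeff K δ k n := by
    calc zCoeff K δ k n ^ (2 / 3 : ℝ) ≤ zCoeff K δ k n ^ (1 : ℝ) :=
          Real.rpow_le_rpow_of_exponent_le h3 (by norm_num)
      _ = _ := Real.rpow_one _
  exact ⟨h4, by linarith⟩

end size

/-! ### The symbols of the two bounds -/

/-- The symbol of `c ((-ℒ₀ʷ) f L^θ + f (-ℒ₀))`. -/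
def oddSymbol (w : EuclideanSpace ℝ (Fin 2)) (N : ℕ) (lam z θ f c : ℝ) {n : ℕ}
    (q : Fin n → Mode) : ℝ :=
  c * ((1 / 2 * ∑ i, (inner ℝ w (q i).vec) ^ 2) *
      (f * logL ((lam + 1 / 2 * ∑ i, ‖(q i).vec‖ ^ 2) / (N : ℝ) ^ 2) z ^ θ) +
    f * (1 / 2 * ∑ i, ‖(q i).vec‖ ^ 2))

/-- The symbol of `c ((-ℒ₀ʷ) f⁻¹ (L^θ - f) - ν (-ℒ₀))`. -/
def evenSymbol (w : EuclideanSpace ℝ (Fin 2)) (N : ℕ) (lam z θ f c ν : ℝ) {n : ℕ}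
    (q : Fin n → Mode) : ℝ :=
  c * ((1 / 2 * ∑ i, (inner ℝ w (q i).vec) ^ 2) *
      (1 / f * (logL ((lam + 1 / 2 * ∑ i, ‖(q i).vec‖ ^ 2) / (N : ℝ) ^ 2) z ^ θ - f)) -
    ν * (1 / 2 * ∑ i, ‖(q i).vec‖ ^ 2))

theorem sum_inner_sq_le (w : EuclideanSpace ℝ (Fin 2)) {n : ℕ} (q : Fin n → Mode) :
    ∑ i, (inner ℝ w (q i).vec) ^ 2 ≤ ‖w‖ ^ 2 * ∑ i, ‖(q i).vec‖ ^ 2 := by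
  rw [Finset.mul_sum]
  exact Finset.sum_le_sum fun i _ => inner_sq_le w _

/-! ### From the lower bound at an even level to the upper bound at the next. -/

section upper

variable {w : EuclideanSpace ℝ (Fin 2)} {N n : ℕ} {lam z θ f c ν : ℝ}

theorem half_sum_norm_sq_nonneg (q : Fin n → Mode) : 0 ≤ 1 / 2 * ∑ i, ‖(q i).vec‖ ^ 2 := by
  positivity

theorem le_logL_symbol (hlam : 0 < lam) (z : ℝ) (q : Fin n → Mode) :
    z ≤ logL ((lam + 1 / 2 * ∑ i, ‖(q i).vec‖ ^ 2) / (N : ℝ) ^ 2) z :=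
  logL_ge (by positivity) z

theorem logL_rpow_le (hlam : 0 < lam) (hN : 0 < N) (hz : 0 ≤ z) (hθ : 0 ≤ θ) (q : Fin n → Mode) :
    logL ((lam + 1 / 2 * ∑ i, ‖(q i).vec‖ ^ 2) / (N : ℝ) ^ 2) z ^ θ ≤
      logL (lam / (N : ℝ) ^ 2) z ^ θ := by
  have hN' : (0 : ℝ) < N := by exact_mod_cast hN
  have hS : 0 ≤ ∑ i, ‖(q i).vec‖ ^ 2 := by positivity
  refine Real.rpow_le_rpow (hz.trans (logL_ge (by positivity) z)) (logL_anti (by positivity) ?_ z) hθ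
  gcongr
  linarith

theorem logL_rpow_nonneg (hlam : 0 < lam) (hz : 0 ≤ z) (q : Fin n → Mode) :
    0 ≤ logL ((lam + 1 / 2 * ∑ i, ‖(q i).vec‖ ^ 2) / (N : ℝ) ^ 2) z ^ θ :=
  Real.rpow_nonneg (hz.trans (logL_ge (by positivity) z)) _

theorem abs_evenSymbol_le (hlam : 0 < lam) (hN : 0 < N) (hz : 0 ≤ z) (hθ : 0 ≤ θ) (hf : 0 < f)
    (hc : 0 ≤ c) (hν : 0 ≤ ν) (q : Fin n → Mode) :
    |evenSymbol w N lam z θ f c ν q| ≤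
      c * (‖w‖ ^ 2 * (1 / f * (logL (lam / (N : ℝ) ^ 2) z ^ θ + f)) + ν) * (lam - laplacian n q) := by
  have h1 := sum_inner_sq_le w q
  have h2 := logL_rpow_le (θ := θ) hlam hN hz hθ q
  have h3 := logL_rpow_nonneg (N := N) (θ := θ) hlam hz q
  have hS : 0 ≤ ∑ i, ‖(q i).vec‖ ^ 2 := by positivity
  have hA : 0 ≤ ∑ i, (inner ℝ w (q i).vec) ^ 2 := by positivity
  unfold evenSymbol
  rw [sub_laplacian_eq]
  generalize ∑ i, (inner ℝ w (q i).vec) ^ 2 = A at *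
  generalize logL ((lam + 1 / 2 * ∑ i, ‖(q i).vec‖ ^ 2) / (N : ℝ) ^ 2) z ^ θ = Q at *
  generalize logL (lam / (N : ℝ) ^ 2) z ^ θ = M at *
  generalize ∑ i, ‖(q i).vec‖ ^ 2 = S at *
  rw [abs_mul, abs_of_nonneg hc, mul_assoc c]
  refine mul_le_mul_of_nonneg_left ?_ hc
  have h4 : |1 / f * (Q - f)| ≤ 1 / f * (M + f) := by
    rw [abs_mul, abs_of_pos (by positivity : 0 < 1 / f)]
    refine mul_le_mul_of_nonneg_left ?_ (by positivity)
    rw [abs_le]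
    constructor <;> linarith
  have h5 : 0 ≤ 1 / f * (M + f) := (abs_nonneg _).trans h4
  calc |1 / 2 * A * (1 / f * (Q - f)) - ν * (1 / 2 * S)|
      ≤ |1 / 2 * A * (1 / f * (Q - f))| + |ν * (1 / 2 * S)| := abs_sub _ _
    _ = 1 / 2 * A * |1 / f * (Q - f)| + ν * (1 / 2 * S) := by
        rw [abs_mul, abs_of_nonneg (by positivity : 0 ≤ 1 / 2 * A),
          abs_of_nonneg (by positivity : 0 ≤ ν * (1 / 2 * S))]
    _ ≤ 1 / 2 * (‖w‖ ^ 2 * S) * (1 / f * (M + f)) + ν * (1 / 2 * S) := by gcongr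
    _ = (‖w‖ ^ 2 * (1 / f * (M + f)) + ν) * (1 / 2 * S) := by ring
    _ ≤ _ := by gcongr; linarith

/-- Since c max(|w|², 1) ≤ 1/π ≤ 1/3, each of the two negative parts of the symbol costs at most a
third of -ℒ₀; a third of λ - ℒ₀ and the logarithmic part are left. -/
theorem le_add_evenSymbol (hlam : 0 < lam) (hf : 0 < f) (hc : 0 < c)
    (hcw : c * (Real.pi * max (‖w‖ ^ 2) 1) ≤ 1) (hν : ν ≤ 1) (q : Fin n → Mode) :
    1 / 3 * (lam + 1 / 2 * ∑ i, ‖(q i).vec‖ ^ 2) + 1 / (2 * (f / c)) *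
      ((∑ i, (inner ℝ w (q i).vec) ^ 2) *
      logL ((lam + 1 / 2 * ∑ i, ‖(q i).vec‖ ^ 2) / (N : ℝ) ^ 2) z ^ θ) ≤
      lam - laplacian n q + evenSymbol w N lam z θ f c ν q := by
  have h1 := sum_inner_sq_le w q
  have hS : 0 ≤ ∑ i, ‖(q i).vec‖ ^ 2 := by positivity
  unfold evenSymbol
  rw [sub_laplacian_eq]
  generalize ∑ i, (inner ℝ w (q i).vec) ^ 2 = A at *
  generalize logL ((lam + 1 / 2 * ∑ i, ‖(q i).vec‖ ^ 2) / (N : ℝ) ^ 2) z ^ θ = Q at *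
  generalize ∑ i, ‖(q i).vec‖ ^ 2 = S at *
  have hm1 : c * 1 ≤ c * max (‖w‖ ^ 2) 1 := mul_le_mul_of_nonneg_left (le_max_right _ _) hc.le
  have hm2 : c * ‖w‖ ^ 2 ≤ c * max (‖w‖ ^ 2) 1 := mul_le_mul_of_nonneg_left (le_max_left _ _) hc.le
  have hm3 : c * max (‖w‖ ^ 2) 1 ≤ 1 / 3 := by
    have hpi := Real.pi_gt_three
    have h0 : 0 ≤ c * max (‖w‖ ^ 2) 1 := by linarith
    nlinarith
  have e1 : 1 / (2 * (f / c)) * (A * Q) = c * (1 / 2 * A * (1 / f * Q)) := by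
    field_simp
  have e2 : c * (1 / 2 * A * (1 / f * (Q - f)) - ν * (1 / 2 * S)) =
      c * (1 / 2 * A * (1 / f * Q)) - 1 / 2 * (c * A) - 1 / 2 * (c * (ν * S)) := by
    field_simp
  rw [e1, e2]
  have h4 : c * A ≤ 1 / 3 * S := by
    calc c * A ≤ c * (‖w‖ ^ 2 * S) := by gcongr
      _ = c * ‖w‖ ^ 2 * S := by ring
      _ ≤ 1 / 3 * S := by gcongr; linarith
  have h5 : c * (ν * S) ≤ 1 / 3 * S := by
    calc c * (ν * S) ≤ c * (1 * S) := by gcongr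
      _ = c * 1 * S := by ring
      _ ≤ 1 / 3 * S := by gcongr; linarith
  linarith

theorem upperSymbol_mul_le (hlam : 0 < lam) (hz : 0 < z) (hf : 0 < f) (k : Fin n → Mode) :
    upperSymbol w N lam z θ f k ≤ 3 / lam ∧
      upperSymbol w N lam z θ f k * ∑ i, ‖(k i).vec‖ ^ 2 ≤ 6 := by
  have h3 := logL_rpow_nonneg (N := N) (θ := θ) hlam hz.le k
  have hS : 0 ≤ ∑ i, ‖(k i).vec‖ ^ 2 := by positivity
  have hA : 0 ≤ ∑ i, (inner ℝ w (k i).vec) ^ 2 := by positivity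
  unfold upperSymbol
  generalize ∑ i, (inner ℝ w (k i).vec) ^ 2 = A at *
  generalize logL ((lam + 1 / 2 * ∑ i, ‖(k i).vec‖ ^ 2) / (N : ℝ) ^ 2) z ^ θ = Q at *
  generalize ∑ i, ‖(k i).vec‖ ^ 2 = S at *
  have h4 : 0 ≤ 1 / (2 * f) * (A * Q) := by positivity
  constructor
  · have h5 : 0 < lam / 3 := by positivity
    calc _ ≤ (lam / 3)⁻¹ := inv_anti₀ h5 (by linarith)
      _ = 3 / lam := inv_div _ _
  · rw [inv_mul_le_iff₀ (by positivity)]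
    linarith

/-- The off-diagonal error and the diagonal contribution in the upper bound. -/
theorem upper_coefficient_le {c' Q U : ℝ} {ω : ℝ} (hω : 0 < ω) (hf : 1 ≤ f) (hc : 0 < c) (hc1 : c ≤ 1)
    (hc' : 3 / (2 * Real.pi * ω) / c ≤ c') (hc'1 : 1 ≤ c') (hU : (ω * U) ^ 2 ≤ f) (hU0 : 0 ≤ U)
    (hn : 216 * ((n : ℝ) * (n + 1)) ≤ f) (hQ : 1 ≤ Q) :
    U * √(f / c) * Q / Real.pi ^ 2 + 18 * (n * (n + 1)) * 6 ≤ c' * (f * Q) := by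
  have hpi := Real.pi_gt_three
  have hf0 : 0 < f := by linarith
  have h1 : √(f / c) ≤ √f / c := by
    rw [Real.sqrt_div hf0.le]
    refine div_le_div_of_nonneg_left (Real.sqrt_nonneg _) hc ?_
    rw [Real.le_sqrt hc.le hc.le]
    nlinarith
  have h2 : ω * U ≤ √f := Real.le_sqrt_of_sq_le hU
  have h3 : U * √f ≤ f / ω := by
    rw [le_div_iff₀ hω]
    calc U * √f * ω = ω * U * √f := by ring
      _ ≤ √f * √f := by gcongr
      _ = f := Real.mul_self_sqrt hf0.le
  -- The diagonal part takes one half of c' f Q; since 216 n(n+1) ≤ f, the off-diagonal part fits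
  -- into the other half.
  have h4 : U * √(f / c) * Q / Real.pi ^ 2 ≤ 1 / 2 * (c' * (f * Q)) := by
    have h5 : U * √(f / c) ≤ f / ω / c := by
      calc U * √(f / c) ≤ U * (√f / c) := by gcongr
        _ = U * √f / c := by ring
        _ ≤ f / ω / c := by gcongr
    have h6 : f / ω / c = 2 * Real.pi / 3 * f * (3 / (2 * Real.pi * ω) / c) := by
      field_simp
    have h7 : U * √(f / c) ≤ 2 * Real.pi / 3 * f * c' := by
      rw [h6] at h5
      refine h5.trans ?_
      gcongr
    rw [div_le_iff₀ (by positivity)]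
    calc U * √(f / c) * Q ≤ 2 * Real.pi / 3 * f * c' * Q := by gcongr
      _ = (2 * Real.pi / 3) * (c' * (f * Q)) := by ring
      _ ≤ (1 / 2 * Real.pi ^ 2) * (c' * (f * Q)) := by
          gcongr
          nlinarith
      _ = _ := by ring
  have h8 : f ≤ c' * (f * Q) := by
    calc f = 1 * (f * 1) := by ring
      _ ≤ c' * (f * Q) := by gcongr
  linarith

theorem upperConst_nonneg {ω : ℝ} (hω : 0 < ω) : 0 ≤ upperConst ω := by
  unfold upperConst
  have : 0 ≤ ∑' l : Mode, 1 / ‖l.vec‖ ^ 3 := tsum_nonneg fun l => by positivity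
  positivity

theorem re_inner_resolvent_le_upperSymbol (hlam : 0 < lam) (hN : 0 < N) (hz : 0 < z)
    (hθ : 0 ≤ θ) (hf : 0 < f) (hc : 0 < c)
    (hcw : c * (Real.pi * max (‖w‖ ^ 2) 1) ≤ 1) (hν0 : 0 ≤ ν) (hν : ν ≤ 1)
    {H R : chaos n →L[ℂ] chaos n} (hR : IsBoundedInverse (resolventArg lam n H) R)
    (hH : ∀ φ : chaos n,
      Summable (fun k => evenSymbol w N lam z θ f c ν k * ‖(φ : L2Seq n) k‖ ^ 2) →
      ∑' k, evenSymbol w N lam z θ f c ν k * ‖(φ : L2Seq n) k‖ ^ 2 ≤ (inner ℂ (H φ) φ).re)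
    (ψ : chaos n) :
    (inner ℂ (R ψ) ψ).re ≤ ∑' k, upperSymbol w N lam z θ (f / c) k * ‖(ψ : L2Seq n) k‖ ^ 2 := by
  have hfc : 0 < f / c := by positivity
  have hlow := fun k : Fin n → Mode =>
    le_add_evenSymbol (w := w) (N := N) (z := z) (θ := θ) hlam hf hc hcw hν k
  have hpart : ∀ k : Fin n → Mode, 0 ≤ 1 / (2 * (f / c)) *
      ((∑ i, (inner ℝ w (k i).vec) ^ 2) *
      logL ((lam + 1 / 2 * ∑ i, ‖(k i).vec‖ ^ 2) / (N : ℝ) ^ 2) z ^ θ) := fun k => by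
    have := logL_rpow_nonneg (N := N) (θ := θ) hlam hz.le k
    positivity
  have h1 := re_inner_resolvent_le hlam hR (evenSymbol w N lam z θ f c ν)
    (fun k => abs_evenSymbol_le hlam hN hz.le hθ hf hc.le hν0 k) (κ := 1 / 3) (by norm_num)
    (fun k => by
      have := hlow k
      have := hpart k
      have := sub_laplacian_eq lam n k
      linarith) hH ψ
  have hD0 := fun k : Fin n → Mode =>
    upperSymbol_nonneg (w := w) (N := N) (θ := θ) hlam hz hfc k
  have hDC := fun k : Fin n → Mode =>
    upperSymbol_mul_le (w := w) (N := N) (θ := θ) hlam hz hfc k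
  have hden : ∀ k : Fin n → Mode, 0 < 1 / 3 * (lam + 1 / 2 * ∑ i, ‖(k i).vec‖ ^ 2) +
      1 / (2 * (f / c)) * ((∑ i, (inner ℝ w (k i).vec) ^ 2) *
      logL ((lam + 1 / 2 * ∑ i, ‖(k i).vec‖ ^ 2) / (N : ℝ) ^ 2) z ^ θ) := fun k => by
    have := hpart k
    have : 0 ≤ ∑ i, ‖(k i).vec‖ ^ 2 := by positivity
    linarith
  have hle : ∀ k : Fin n → Mode, (lam - laplacian n k + evenSymbol w N lam z θ f c ν k)⁻¹ ≤
      upperSymbol w N lam z θ (f / c) k := fun k => by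
    unfold upperSymbol
    exact inv_anti₀ (hden k) (hlow k)
  have hsum : Summable fun k => upperSymbol w N lam z θ (f / c) k *
      ‖(ψ : L2Seq n) k‖ ^ 2 :=
    summable_mul_norm_sq _ (C := 3 / lam) fun k => by
      rw [abs_of_nonneg (hD0 k)]
      exact (hDC k).1
  refine h1.trans (Summable.tsum_le_tsum
      (fun k => mul_le_mul_of_nonneg_right (hle k) (sq_nonneg _)) ?_ hsum)
  refine Summable.of_nonneg_of_le (fun k => mul_nonneg (inv_nonneg.mpr ?_) (sq_nonneg _))
      (fun k => mul_le_mul_of_nonneg_right (hle k) (sq_nonneg _)) hsum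
  exact (hden k).le.trans (hlow k)

theorem le_oddSymbol {c' : ℝ} (hw : 0 < ‖w‖) (hlam : 0 < lam) (hz : 6 ≤ z)
    (hθ1 : θ ≤ 1) (hf : 1 ≤ f) (hc : 0 < c) (hc1 : c ≤ 1)
    (hc' : 3 / (2 * Real.pi * ‖w‖) / c ≤ c') (hc'1 : 1 ≤ c')
    (hU : (‖w‖ * upperConst ‖w‖) ^ 2 ≤ f) (hn : 216 * ((n : ℝ) * (n + 1)) ≤ f)
    (q : Fin n → Mode) :
    (∑ b, bandSq w N (q b)) / 2 * (upperConst ‖w‖ * √(f / c) *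
      logL ((lam + 1 / 2 * ∑ i, ‖(q i).vec‖ ^ 2) / (N : ℝ) ^ 2) z ^ (1 - θ / 2) / Real.pi ^ 2 +
        18 * (n * (n + 1)) * 6) ≤ oddSymbol w N lam z (1 - θ / 2) f c' q := by
  have hL := le_logL_symbol (N := N) hlam z q
  have hb : ∑ b, bandSq w N (q b) ≤ ∑ i, (inner ℝ w (q i).vec) ^ 2 :=
    Finset.sum_le_sum fun b _ => bandSq_le w N (q b)
  have hb0 : 0 ≤ ∑ b, bandSq w N (q b) := Finset.sum_nonneg fun b _ => bandSq_nonneg w N (q b)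
  have hS := mul_nonneg (zero_le_one.trans hf) (half_sum_norm_sq_nonneg q)
  unfold oddSymbol
  generalize logL ((lam + 1 / 2 * ∑ i, ‖(q i).vec‖ ^ 2) / (N : ℝ) ^ 2) z = l at *
  generalize f * (1 / 2 * ∑ i, ‖(q i).vec‖ ^ 2) = S at *
  generalize ∑ i, (inner ℝ w (q i).vec) ^ 2 = A at *
  generalize ∑ b, bandSq w N (q b) = B at *
  have hQ : 1 ≤ l ^ (1 - θ / 2) := Real.one_le_rpow (by linarith) (by linarith)
  have hco := upper_coefficient_le (n := n) hw hf hc hc1 hc' hc'1 hU (upperConst_nonneg hw) hn hQ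
  calc _ ≤ B / 2 * (c' * (f * l ^ (1 - θ / 2))) := mul_le_mul_of_nonneg_left hco (by linarith)
    _ ≤ A / 2 * (c' * (f * l ^ (1 - θ / 2))) :=
        mul_le_mul_of_nonneg_right (by linarith) (by positivity)
    _ ≤ A / 2 * (c' * (f * l ^ (1 - θ / 2))) + c' * S := le_add_of_nonneg_right (by positivity)
    _ = _ := by ring

theorem resolvent_creation_le {c' : ℝ} (hw : 0 < ‖w‖) (hlam : 0 < lam) (hN : 0 < N) (hz : 6 ≤ z)
    (hθ : 0 ≤ θ) (hθ1 : θ ≤ 1) (hf : 1 ≤ f) (hc : 0 < c)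
    (hcw : c * (Real.pi * max (‖w‖ ^ 2) 1) ≤ 1) (hc1 : c ≤ 1) (hν0 : 0 ≤ ν) (hν : ν ≤ 1)
    (hc' : 3 / (2 * Real.pi * ‖w‖) / c ≤ c') (hc'1 : 1 ≤ c')
    (hU : (‖w‖ * upperConst ‖w‖) ^ 2 ≤ f) (hn : 216 * ((n : ℝ) * (n + 1)) ≤ f)
    {H R : chaos (n + 1) →L[ℂ] chaos (n + 1)} (hR : IsBoundedInverse (resolventArg lam (n + 1) H) R)
    (hH : ∀ φ : chaos (n + 1),
      Summable (fun k => evenSymbol w N lam z θ f c ν k * ‖(φ : L2Seq (n + 1)) k‖ ^ 2) →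
      ∑' k, evenSymbol w N lam z θ f c ν k * ‖(φ : L2Seq (n + 1)) k‖ ^ 2 ≤ (inner ℂ (H φ) φ).re)
    (φ : chaos n)
    (hφ : Summable fun q => oddSymbol w N lam z (1 - θ / 2) f c' q * ‖(φ : L2Seq n) q‖ ^ 2) :
    (n + 1).factorial * (inner ℂ (R (creation w N n φ)) (creation w N n φ)).re ≤
      n.factorial * ∑' q, oddSymbol w N lam z (1 - θ / 2) f c' q * ‖(φ : L2Seq n) q‖ ^ 2 := by
  have hz0 : 0 < z := by linarith
  have hf0 : 0 < f := by linarith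
  have hfc : 0 < f / c := by positivity
  have hfc1 : 1 ≤ f / c := by rw [le_div_iff₀ hc]; linarith
  have hD0 := fun k : Fin (n + 1) → Mode =>
    upperSymbol_nonneg (w := w) (N := N) (θ := θ) hlam hz0 hfc k
  have hDC := fun k : Fin (n + 1) → Mode =>
    upperSymbol_mul_le (w := w) (N := N) (θ := θ) hlam hz0 hfc k
  have h2 := re_inner_resolvent_le_upperSymbol hlam hN hz0 hθ hf0 hc hcw hν0 hν hR hH
    (creation w N n φ)
  refine (mul_le_mul_of_nonneg_left h2 (Nat.cast_nonneg _)).trans ?_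
  have hU0 := upperConst_nonneg hw
  refine tsum_creation_le_tsum φ (C := 3 / lam) (CD := 6)
    (Cs := upperConst ‖w‖ * √(f / c) * logL (lam / (N : ℝ) ^ 2) z ^ (1 - θ / 2))
    (s := fun q => upperConst ‖w‖ * √(f / c) *
      logL ((lam + 1 / 2 * ∑ i, ‖(q i).vec‖ ^ 2) / (N : ℝ) ^ 2) z ^ (1 - θ / 2))
    hD0 (fun k => (hDC k).1) (fun k => (hDC k).2) (fun q => ?_) (fun σ q => ?_)
    (fun j b q hq _ => tsum_upperSymbol_le hw hlam hz hθ hθ1 hfc1 hN hq j b) hφ (fun q _ => ?_)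
  · have h3 := logL_rpow_nonneg (N := N) (θ := 1 - θ / 2) hlam hz0.le q
    rw [abs_of_nonneg (by positivity)]
    have := logL_rpow_le (θ := 1 - θ / 2) hlam hN hz0.le (by linarith) q
    gcongr
  · rw [← sub_laplacian_eq, ← sub_laplacian_eq, laplacian_comp_perm]
  · exact le_oddSymbol hw hlam hz hθ1 hf hc hc1 hc' hc'1 hU hn q

end upper

/-! ### From the upper bound at an odd level to the lower bound at the next. -/

section lower

variable {w : EuclideanSpace ℝ (Fin 2)} {N n : ℕ} {lam z θ f c ν : ℝ}

/-- The root is at most |w|√B (1 + η), and (1 - η)(1 + η) ≤ 1. Under the root the excess over Bω²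
consists of a term of order Bω²/f and of bounded terms; as B ≥ f/3, the latter are of order B/f, and
η collects both. -/
theorem aniso_ratio_le {ω G η B : ℝ} (hω : 0 < ω) (hf : 1 ≤ f) (hG : f ≤ G)
    (hη : η = (1 + 6 / ω ^ 2) / f) (hη1 : η ≤ 1) (hB : f / 3 ≤ B) :
    (1 - η) * √((1 + 1 / G) * (1 + 1 / G + B * ω ^ 2)) ≤ ω * √B := by
  have hf0 : 0 < f := by linarith
  have hB0 : 0 < B := by linarith
  have hη0 : 0 ≤ η := by rw [hη]; positivity
  obtain ⟨t, ht⟩ : ∃ t, t = 1 / f := ⟨_, rfl⟩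
  have ht0 : 0 < t := by rw [ht]; positivity
  have ht1 : t ≤ 1 := by rw [ht, div_le_one hf0]; exact hf
  have hGt : 1 / G ≤ t := by rw [ht]; exact one_div_le_one_div_of_le hf0 hG
  have hG0 : 0 < 1 / G := by
    have : 0 < G := by linarith
    positivity
  have htB : 1 ≤ 3 * (t * B) := by
    rw [ht]
    have : 1 / f * (f / 3) ≤ 1 / f * B := by gcongr
    have e : 1 / f * (f / 3) = 1 / 3 := by field_simp
    linarith
  have hηt : η * ω ^ 2 = t * (ω ^ 2 + 6) := by
    rw [hη, ht]
    field_simp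
  generalize 1 / G = a at *
  have hkey : (1 + a) * (1 + a + B * ω ^ 2) ≤ (ω * √B * (1 + η)) ^ 2 := by
    have e : (ω * √B * (1 + η)) ^ 2 = B * ω ^ 2 * (1 + η) ^ 2 := by
      rw [mul_pow, mul_pow, Real.sq_sqrt hB0.le]
      ring
    rw [e]
    have h1 : (1 + a) * (1 + a) ≤ 4 := by nlinarith
    have h2 : a * (B * ω ^ 2) ≤ t * (B * ω ^ 2) := by gcongr
    have h3 : 0 ≤ B * ω ^ 2 * η ^ 2 := by positivity
    have h4 : B * ω ^ 2 * (1 + η) ^ 2 =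
        B * ω ^ 2 + 2 * (t * (B * ω ^ 2)) + 12 * (t * B) + B * ω ^ 2 * η ^ 2 := by
      have : B * ω ^ 2 * (1 + η) ^ 2 =
        B * ω ^ 2 + 2 * B * (η * ω ^ 2) + B * ω ^ 2 * η ^ 2 := by ring
      rw [this, hηt]
      ring
    rw [h4]
    have h5 : 0 ≤ t * (B * ω ^ 2) := by positivity
    nlinarith
  have h1 : √((1 + a) * (1 + a + B * ω ^ 2)) ≤ ω * √B * (1 + η) :=
    Real.sqrt_le_iff.mpr ⟨by positivity, hkey⟩
  calc _ ≤ (1 - η) * (ω * √B * (1 + η)) := mul_le_mul_of_nonneg_left h1 (by linarith)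
    _ = (ω * √B) * (1 - η ^ 2) := by ring
    _ ≤ ω * √B := mul_le_of_le_one_right (by positivity) (by nlinarith)

theorem rpow_le_two_mul_rpow {x : ℝ} (hz : 100 ≤ z) (hx1 : 1 ≤ x) (hx : x ≤ z + 7) (hθ : θ ≤ 2 / 3) :
    x ^ θ ≤ 2 * z ^ (2 / 3 : ℝ) := by
  calc x ^ θ ≤ x ^ (2 / 3 : ℝ) := Real.rpow_le_rpow_of_exponent_le hx1 hθ
    _ ≤ (2 * z) ^ (2 / 3 : ℝ) := Real.rpow_le_rpow (by linarith) (by linarith) (by norm_num)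
    _ = 2 ^ (2 / 3 : ℝ) * z ^ (2 / 3 : ℝ) := Real.mul_rpow (by norm_num) (by linarith)
    _ ≤ 2 * z ^ (2 / 3 : ℝ) := by
        gcongr
        calc (2 : ℝ) ^ (2 / 3 : ℝ) ≤ 2 ^ (1 : ℝ) :=
              Real.rpow_le_rpow_of_exponent_le (by norm_num) (by norm_num)
          _ = 2 := Real.rpow_one 2

theorem exp_nat_ge (m : ℕ) : (2.7 : ℝ) ^ m ≤ Real.exp m := by
  rw [Real.exp_one_pow m |>.symm]
  exact pow_le_pow_left₀ (by norm_num) (by linarith [Real.exp_one_gt_d9]) m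

/-- At the scales above the cutoff the lower bound is void. -/
theorem logL_rpow_le_of_large {x : ℝ} (hN : 0 < N) (hx : (N : ℝ) ^ 2 ≤ 512 * x) (hz : 100 ≤ z)
    (hθ : θ ≤ 2 / 3) : logL (x / (N : ℝ) ^ 2) z ^ θ ≤ 3 * z ^ (2 / 3 : ℝ) := by
  have hN' : (0 : ℝ) < N := by exact_mod_cast hN
  have hx0 : 0 < x := by
    have : 0 < (N : ℝ) ^ 2 := by positivity
    linarith
  have h1 : z ≤ logL (x / (N : ℝ) ^ 2) z := logL_ge (by positivity) z
  have h2 : logL (x / (N : ℝ) ^ 2) z ≤ z + 7 := by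
    have h3 : (x / (N : ℝ) ^ 2)⁻¹ ≤ 512 := by
      rw [inv_div, div_le_iff₀ hx0]
      exact hx
    have h4 : Real.log (1 + (x / (N : ℝ) ^ 2)⁻¹) ≤ 7 := by
      rw [Real.log_le_iff_le_exp (by positivity)]
      have := exp_nat_ge 7
      norm_num at this
      linarith
    unfold logL
    linarith
  have := rpow_le_two_mul_rpow hz (by linarith) h2 hθ
  have : 0 ≤ z ^ (2 / 3 : ℝ) := Real.rpow_nonneg (by linarith) _
  linarith

theorem radialLog_quarter_le (hN : 0 < N) (z : ℝ) :
    z ≤ radialLog N z (N / 4) ∧ radialLog N z (N / 4) ≤ z + 5 := by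
  have hN' : (0 : ℝ) < N := by exact_mod_cast hN
  have e : radialLog N z (N / 4) = z + Real.log 144 := by
    unfold radialLog
    rw [Real.log_div hN'.ne' (by norm_num), show (144 : ℝ) = 4 ^ 2 * 9 by norm_num,
      Real.log_mul (by norm_num) (by norm_num), Real.log_pow]
    push_cast
    ring
  rw [e]
  have h1 : 0 ≤ Real.log 144 := Real.log_nonneg (by norm_num)
  have h2 : Real.log 144 ≤ 5 := by
    rw [Real.log_le_iff_le_exp (by norm_num)]
    calc (144 : ℝ) ≤ 2.7182 ^ 5 := by norm_num
      _ ≤ Real.exp 1 ^ 5 :=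
        pow_le_pow_left₀ (by norm_num) (by linarith [Real.exp_one_gt_d9]) 5
      _ = Real.exp 5 := by rw [← Real.exp_nat_mul]; norm_num
  constructor <;> linarith

/-- Subtracting 2 divides the argument of the logarithm by e² ≥ 7, and 1 + 2t ≤ (9/16)·7·t for t =
N²/ρ² ≥ 256. -/
theorem logL_sub_two_le_radialLog {ρ x : ℝ} (hρ : 0 < ρ) (hρN : 16 * ρ ≤ N) (hx : ρ ^ 2 = 2 * x) :
    logL (x / (N : ℝ) ^ 2) z - 2 ≤ radialLog N z (4 * ρ) := by
  have hN' : (0 : ℝ) < N := by linarith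
  have hx0 : 0 < x := by nlinarith
  have hsq : 256 * ρ ^ 2 ≤ (N : ℝ) ^ 2 := by nlinarith
  have e1 : radialLog N z (4 * ρ) + 2 = z + Real.log (9 * ((N : ℝ) / (4 * ρ)) ^ 2 * Real.exp 2) := by
    have h4 : 0 < 4 * ρ := by positivity
    unfold radialLog
    generalize 4 * ρ = r at h4 ⊢
    rw [Real.log_mul (by positivity) (Real.exp_pos _).ne', Real.log_exp,
      Real.log_mul (by norm_num) (by positivity), Real.log_pow, Real.log_div hN'.ne' (by positivity)]
    push_cast
    ring
  have h7 : (7 : ℝ) ≤ Real.exp 2 := by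
    have := exp_nat_ge 2
    norm_num at this
    linarith
  have h2 : 1 + (x / (N : ℝ) ^ 2)⁻¹ ≤ 9 * ((N : ℝ) / (4 * ρ)) ^ 2 * Real.exp 2 := by
    have e2 : (x / (N : ℝ) ^ 2)⁻¹ = 2 * ((N : ℝ) ^ 2 / ρ ^ 2) := by
      rw [hx]
      field_simp
    have e3 : 9 * ((N : ℝ) / (4 * ρ)) ^ 2 * Real.exp 2 =
        9 / 16 * ((N : ℝ) ^ 2 / ρ ^ 2) * Real.exp 2 := by
      field_simp
      ring
    have h3 : 256 ≤ (N : ℝ) ^ 2 / ρ ^ 2 := by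
      rw [le_div_iff₀ (by positivity)]
      exact hsq
    rw [e2, e3]
    generalize (N : ℝ) ^ 2 / ρ ^ 2 = t at *
    nlinarith
  have h3 := Real.log_le_log (by positivity) h2
  unfold logL
  linarith

theorem rpow_le_rpow_sub_two_add {x : ℝ} (hx : 2 ≤ x) (hθ0 : 0 ≤ θ) (hθ : θ ≤ 1) :
    x ^ θ ≤ (x - 2) ^ θ + 2 := by
  have h := Real.rpow_add_le_add_rpow (p := θ) (a := x - 2) (b := 2) (by linarith) (by norm_num) hθ0 hθ
  have h2 : (2 : ℝ) ^ θ ≤ 2 ^ (1 : ℝ) := Real.rpow_le_rpow_of_exponent_le (by norm_num) hθ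
  rw [Real.rpow_one] at h2
  have e : x - 2 + 2 = x := by ring
  rw [e] at h
  linarith

/-- The diagonal contribution dominates the target coefficient. -/
theorem lower_coefficient_le {ω G ε η c' Z X P Q p : ℝ} (hω : 0 < ω) (hc : 0 < c) (hf : f = 3 * Z)
    (hZ : 100 + 3 * ω ≤ Z) (hG : G = c * f) (hε : 0 < ε) (hε1 : ε ≤ 1 / 2) (hη : η ≤ ε)
    (hcc : c * c' = 3 / (2 * Real.pi * ω) * ((1 - ε) / (1 + ε)))
    (hp0 : 0 < p) (hp : p ≤ 2 / 3) (hX : f ≤ X) (hP : X - 2 ≤ P) (hQ : Q ≤ 2 * Z) :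
    Real.pi ^ 2 * (c' * (1 / f * (X - f))) ≤
      1 / G * (Real.pi * (1 - η) / (ω * p) * (P - Q) - 2 * Real.pi) := by
  have hpi := Real.pi_pos
  have hf0 : 0 < f := by linarith
  have hε2 : 0 < 1 - ε := by linarith
  have e1 : Real.pi ^ 2 * (c' * (1 / f * (X - f))) =
      1 / G * (Real.pi ^ 2 * (c * c') * (X - f)) := by
    rw [hG]
    field_simp
  have hG0 : 0 < G := by rw [hG]; positivity
  rw [e1]
  refine mul_le_mul_of_nonneg_left ?_ (by positivity)
  have e2 : Real.pi ^ 2 * (c * c') * (X - f) =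
      3 * Real.pi / (2 * ω) * ((1 - ε) / (1 + ε)) * (X - f) := by
    rw [hcc]
    field_simp
  have h1 : (1 - ε) / (1 + ε) ≤ 1 - ε := div_le_self hε2.le (by linarith)
  -- Here f = 3Z pays for Q ≤ 2Z; the remaining Z ≥ 100 + 3ω covers the loss 2 in P and leaves 3ω to
  -- absorb 2π.
  have h2 : X - f + 3 * ω ≤ P - Q := by linarith
  have h3 : 3 * Real.pi / (2 * ω) * (1 - ε) ≤ Real.pi * (1 - η) / (ω * p) := by
    have : 3 * Real.pi / (2 * ω) * (1 - ε) = Real.pi * (1 - ε) / (ω * (2 / 3)) := by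
      field_simp
    rw [this]
    have h4 : Real.pi * (1 - ε) ≤ Real.pi * (1 - η) := by gcongr
    have h5 : ω * p ≤ ω * (2 / 3) := by gcongr
    exact div_le_div₀ (mul_nonneg hpi.le (by linarith)) h4 (by positivity) h5
  have h4 : 2 * Real.pi ≤ 3 * Real.pi / (2 * ω) * (1 - ε) * (3 * ω) := by
    have : 3 * Real.pi / (2 * ω) * (1 - ε) * (3 * ω) = 9 / 2 * Real.pi * (1 - ε) := by
      field_simp
      ring
    rw [this]
    nlinarith
  have h5 : 0 ≤ X - f := by linarith
  calc _ = 3 * Real.pi / (2 * ω) * ((1 - ε) / (1 + ε)) * (X - f) := e2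
    _ ≤ 3 * Real.pi / (2 * ω) * (1 - ε) * (X - f) := by gcongr
    _ ≤ 3 * Real.pi / (2 * ω) * (1 - ε) * (X - f + 3 * ω) - 2 * Real.pi := by linarith
    _ ≤ 3 * Real.pi / (2 * ω) * (1 - ε) * (P - Q) - 2 * Real.pi := by
        gcongr
    _ ≤ _ := by
        have : 0 ≤ P - Q := by linarith
        gcongr

theorem le_tsum_lowerSymbol_of_small {ε c' Z : ℝ} {q : Fin n → Mode} (hw : 0 < ‖w‖) (hlam : 0 < lam)
    (hz : 100 ≤ z) (hθ : 2 / 3 ≤ θ) (hθ1 : θ ≤ 1) (hZ : Z = z ^ (2 / 3 : ℝ)) (hf : f = 3 * Z)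
    (hZw : 100 + 3 * ‖w‖ ≤ Z) (hc : 1 ≤ c) (hε : 0 < ε) (hε1 : ε ≤ 1 / 2)
    (hη : (1 + 6 / ‖w‖ ^ 2) / f ≤ ε)
    (hcc : c * c' = 3 / (2 * Real.pi * ‖w‖) * ((1 - ε) / (1 + ε)))
    (hq : ∀ i, q i ≠ 0) (j : Fin (n + 1)) (b : Fin n)
    (hX : f ≤ logL ((lam + 1 / 2 * ∑ i, ‖(q i).vec‖ ^ 2) / (N : ℝ) ^ 2) z ^ (1 - θ / 2))
    (hN : 512 * (lam + 1 / 2 * ∑ i, ‖(q i).vec‖ ^ 2) ≤ (N : ℝ) ^ 2) :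
    Real.pi ^ 2 * (c' * (1 / f *
      (logL ((lam + 1 / 2 * ∑ i, ‖(q i).vec‖ ^ 2) / (N : ℝ) ^ 2) z ^ (1 - θ / 2) - f))) ≤
    ∑' l, cutoff N (q b - l) l * lowerSymbol w N lam z θ (c * f) (split j b q l) := by
  have hS : 1 ≤ ∑ i, ‖(q i).vec‖ ^ 2 := by
    have h1 : ‖(q b).vec‖ ^ 2 ≤ ∑ i, ‖(q i).vec‖ ^ 2 :=
      Finset.single_le_sum (f := fun i => ‖(q i).vec‖ ^ 2) (fun i _ => sq_nonneg _)
        (Finset.mem_univ b)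
    have h2 := one_le_norm_vec (hq b)
    nlinarith
  obtain ⟨ρ, hρ⟩ : ∃ ρ, ρ = √(2 * lam + ∑ i, ‖(q i).vec‖ ^ 2) := ⟨_, rfl⟩
  have hρ2 : ρ ^ 2 = 2 * lam + ∑ i, ‖(q i).vec‖ ^ 2 := by
    rw [hρ, Real.sq_sqrt (by linarith)]
  have hρ1 : 1 ≤ ρ := by
    rw [hρ, Real.one_le_sqrt]
    linarith
  have hρN : 16 * ρ ≤ N := by
    refine (sq_le_sq₀ (by linarith) (Nat.cast_nonneg N)).mp ?_
    rw [mul_pow, hρ2]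
    linarith
  have hN0 : 0 < N := by
    have : (0 : ℝ) < N := by linarith
    exact_mod_cast this
  have hz0 : 0 < z := by linarith
  have hf1 : 1 ≤ f := by linarith
  have hfG : f ≤ c * f := le_mul_of_one_le_left (by linarith) hc
  have hzθ : f / 3 ≤ z ^ θ := by
    have h1 : f / 3 = z ^ (2 / 3 : ℝ) := by rw [hf, hZ]; ring
    rw [h1]
    exact Real.rpow_le_rpow_of_exponent_le (by linarith) hθ
  refine le_trans ?_ (le_tsum_lowerSymbol hw hlam hz0 (by linarith) hθ1 (by linarith) hq hρ1 hρ2 hρN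
    (η := (1 + 6 / ‖w‖ ^ 2) / f)
    (fun B hB => aniso_ratio_le hw hf1 hfG rfl (by linarith) (hzθ.trans hB)) j b)
  have hP := logL_sub_two_le_radialLog (z := z) (x := lam + 1 / 2 * ∑ i, ‖(q i).vec‖ ^ 2)
    (by linarith) hρN (by rw [hρ2]; ring)
  have hQ := radialLog_quarter_le hN0 z
  have hL := le_logL_symbol (N := N) hlam z q
  generalize logL ((lam + 1 / 2 * ∑ i, ‖(q i).vec‖ ^ 2) / (N : ℝ) ^ 2) z = L at *
  refine lower_coefficient_le hw (by linarith) hf hZw rfl hε hε1 hη hcc (by linarith) (by linarith)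
    hX ?_ ?_
  · have h1 := rpow_le_rpow_sub_two_add (x := L) (θ := 1 - θ / 2) (by linarith) (by linarith)
      (by linarith)
    have h2 : (L - 2) ^ (1 - θ / 2) ≤ radialLog N z (4 * ρ) ^ (1 - θ / 2) :=
      Real.rpow_le_rpow (by linarith) hP (by linarith)
    linarith
  · rw [hZ]
    exact rpow_le_two_mul_rpow hz (by linarith) (by linarith) (by linarith)

/-- The term with ν pays for the off-diagonal error. If X ≤ f the rest of the symbol is nonpositive
and the diagonal part is not needed; if X > f no mode is lost by the band restriction. -/
theorem evenSymbol_le {c' G X S A B : ℝ} {ω : ℝ} (hf : 0 < f) (hG : 0 < G) (hG' : G = c * f)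
    (hc' : 0 ≤ c')
    (herr : 36 * ((n : ℝ) * (n + 1)) * ω ^ 2 ≤ c * c' * f * ν) (hc : 0 < c)
    (hS : 0 ≤ S) (hAS : A ≤ ω ^ 2 * S) (hA : 0 ≤ A) (hBA : B ≤ A)
    (hB : f < X → B = A) :
    c' * (1 / 2 * A * (1 / f * (X - f)) - ν * (1 / 2 * S)) ≤
      B / 2 * (max 0 (Real.pi ^ 2 * (c' * (1 / f * (X - f)))) / Real.pi ^ 2 -
        18 * (n * (n + 1)) * (2 / G)) := by
  have hpi := Real.pi_pos
  have h1 : B / 2 * (18 * (n * (n + 1)) * (2 / G)) ≤ c' * (ν * (1 / 2 * S)) := by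
    have h2 : 36 * ((n : ℝ) * (n + 1)) * (1 / G) * ω ^ 2 ≤ c' * ν := by
      have : 36 * ((n : ℝ) * (n + 1)) * (1 / G) * ω ^ 2 =
          36 * ((n : ℝ) * (n + 1)) * ω ^ 2 / (c * f) := by rw [hG']; ring
      rw [this, div_le_iff₀ (by positivity)]
      linarith
    calc B / 2 * (18 * (n * (n + 1)) * (2 / G))
        = B * (1 / 2 * (36 * ((n : ℝ) * (n + 1)) * (1 / G))) := by ring
      _ ≤ (ω ^ 2 * S) * (1 / 2 * (36 * ((n : ℝ) * (n + 1)) * (1 / G))) := by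
          gcongr
          linarith
      _ = (36 * ((n : ℝ) * (n + 1)) * (1 / G) * ω ^ 2) * (1 / 2 * S) := by ring
      _ ≤ c' * ν * (1 / 2 * S) := by gcongr
      _ = _ := by ring
  rcases le_or_gt X f with hX | hX
  · have h3 : c' * (1 / f * (X - f)) ≤ 0 :=
      mul_nonpos_of_nonneg_of_nonpos hc' (mul_nonpos_of_nonneg_of_nonpos (by positivity)
        (by linarith))
    have h4 : max 0 (Real.pi ^ 2 * (c' * (1 / f * (X - f)))) = 0 :=
      max_eq_left (mul_nonpos_of_nonneg_of_nonpos (by positivity) h3)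
    rw [h4, zero_div, zero_sub]
    have h5 : 1 / 2 * A * (c' * (1 / f * (X - f))) ≤ 0 :=
      mul_nonpos_of_nonneg_of_nonpos (by positivity) h3
    linarith
  · have h3 : 0 ≤ c' * (1 / f * (X - f)) := by
      have : 0 < X - f := by linarith
      positivity
    have h4 : max 0 (Real.pi ^ 2 * (c' * (1 / f * (X - f)))) / Real.pi ^ 2 =
        c' * (1 / f * (X - f)) := by
      rw [max_eq_right (by positivity)]
      field_simp
    rw [h4]
    have := hB hX
    subst this
    linarith

theorem sum_bandSq_eq {q : Fin n → Mode} (h : ∀ b, ‖(q b).vec‖ ≤ N) :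
    ∑ b, bandSq w N (q b) = ∑ b, (inner ℝ w (q b).vec) ^ 2 :=
  Finset.sum_congr rfl fun b _ => by
    unfold bandSq
    rw [if_pos (h b)]

theorem lowerSymbol_mul_le {G : ℝ} (hlam : 0 < lam) (hz : 0 < z) (hG : 0 < G) (k : Fin n → Mode) :
    lowerSymbol w N lam z θ G k ≤ 1 / lam ∧
      lowerSymbol w N lam z θ G k * ∑ i, ‖(k i).vec‖ ^ 2 ≤ 2 / G := by
  have h3 := logL_rpow_nonneg (N := N) (θ := θ) hlam hz.le k
  have hS : 0 ≤ ∑ i, ‖(k i).vec‖ ^ 2 := by positivity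
  have hA : 0 ≤ ∑ i, (inner ℝ w (k i).vec) ^ 2 := by positivity
  unfold lowerSymbol
  generalize ∑ i, (inner ℝ w (k i).vec) ^ 2 = A at *
  generalize logL ((lam + 1 / 2 * ∑ i, ‖(k i).vec‖ ^ 2) / (N : ℝ) ^ 2) z ^ θ = Q at *
  generalize ∑ i, ‖(k i).vec‖ ^ 2 = S at *
  have h4 : 0 ≤ G / 2 * (A * Q) := by positivity
  have h5 : 0 ≤ G / 2 * S := by positivity
  have h6 : G / 2 * (A * Q + S) = G / 2 * (A * Q) + G / 2 * S := by ring
  constructor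
  · calc _ ≤ lam⁻¹ := inv_anti₀ hlam (by linarith)
      _ = 1 / lam := (one_div lam).symm
  · rw [inv_mul_le_iff₀ (by positivity), mul_div_assoc', le_div_iff₀ hG]
    linarith

theorem inv_add_oddSymbol (k : Fin n → Mode) :
    (lam - laplacian n k + oddSymbol w N lam z θ f c k)⁻¹ = lowerSymbol w N lam z θ (c * f) k := by
  unfold lowerSymbol oddSymbol
  rw [sub_laplacian_eq]
  congr 1
  ring

theorem oddSymbol_nonneg (hlam : 0 < lam) (hz : 0 < z) (hf : 0 ≤ f) (hc : 0 ≤ c) (k : Fin n → Mode) :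
    0 ≤ oddSymbol w N lam z θ f c k := by
  have h3 := logL_rpow_nonneg (N := N) (θ := θ) hlam hz.le k
  unfold oddSymbol
  positivity

theorem oddSymbol_comp_perm (σ : Equiv.Perm (Fin n)) (k : Fin n → Mode) :
    oddSymbol w N lam z θ f c (k ∘ σ) = oddSymbol w N lam z θ f c k := by
  unfold oddSymbol
  have h1 : ∑ i, ‖((k ∘ σ) i).vec‖ ^ 2 = ∑ i, ‖(k i).vec‖ ^ 2 :=
    Equiv.sum_comp σ fun i => ‖(k i).vec‖ ^ 2
  have h2 : ∑ i, (inner ℝ w ((k ∘ σ) i).vec) ^ 2 = ∑ i, (inner ℝ w (k i).vec) ^ 2 :=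
    Equiv.sum_comp σ fun i => (inner ℝ w (k i).vec) ^ 2
  rw [h1, h2]

theorem le_resolvent_creation {ε c' Z : ℝ} (hw : 0 < ‖w‖) (hlam : 0 < lam) (hN : 0 < N)
    (hz : 100 ≤ z) (hθ : 2 / 3 ≤ θ) (hθ1 : θ ≤ 1) (hZ : Z = z ^ (2 / 3 : ℝ)) (hf : f = 3 * Z)
    (hZw : 100 + 3 * ‖w‖ ≤ Z) (hc : 1 ≤ c) (hc' : 0 < c') (hε : 0 < ε) (hε1 : ε ≤ 1 / 2)
    (hη : (1 + 6 / ‖w‖ ^ 2) / f ≤ ε)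
    (hcc : c * c' = 3 / (2 * Real.pi * ‖w‖) * ((1 - ε) / (1 + ε)))
    (herr : 36 * ((n : ℝ) * (n + 1)) * ‖w‖ ^ 2 ≤ c * c' * f * ν)
    {H R : chaos (n + 1) →L[ℂ] chaos (n + 1)} (hH : H.IsPositive)
    (hR : IsBoundedInverse (resolventArg lam (n + 1) H) R)
    (hHle : ∀ φ : chaos (n + 1),
      Summable (fun k => oddSymbol w N lam z θ f c k * ‖(φ : L2Seq (n + 1)) k‖ ^ 2) →
      (inner ℂ (H φ) φ).re ≤ ∑' k, oddSymbol w N lam z θ f c k * ‖(φ : L2Seq (n + 1)) k‖ ^ 2)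
    (φ : chaos n)
    (hφ : Summable fun q => evenSymbol w N lam z (1 - θ / 2) f c' ν q * ‖(φ : L2Seq n) q‖ ^ 2) :
    n.factorial * ∑' q, evenSymbol w N lam z (1 - θ / 2) f c' ν q * ‖(φ : L2Seq n) q‖ ^ 2 ≤
      (n + 1).factorial * (inner ℂ (R (creation w N n φ)) (creation w N n φ)).re := by
  have hz0 : 0 < z := by linarith
  have hf0 : 0 < f := by linarith
  have hc0 : 0 < c := by linarith
  have hG : 0 < c * f := by positivity
  have h1 := le_re_inner_resolvent hlam hH hR (oddSymbol w N lam z θ f c)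
    (oddSymbol_nonneg hlam hz0 hf0.le hc0.le) oddSymbol_comp_perm hHle (creation w N n φ)
  simp only [inv_add_oddSymbol] at h1
  refine le_trans ?_ (mul_le_mul_of_nonneg_left h1 (Nat.cast_nonneg _))
  have hDC := fun k : Fin (n + 1) → Mode =>
    lowerSymbol_mul_le (w := w) (N := N) (θ := θ) hlam hz0 hG k
  have hN' : (0 : ℝ) < N := by exact_mod_cast hN
  -- When the energy is at least N²/512 the logarithm is z + O(1), so its power stays below f. Where
  -- the target is positive, all modes lie below N and the annulus of the integral is nonempty.
  have hlarge : ∀ q : Fin n → Mode, (N : ℝ) ^ 2 ≤ 512 * (lam + 1 / 2 * ∑ i, ‖(q i).vec‖ ^ 2) →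
      logL ((lam + 1 / 2 * ∑ i, ‖(q i).vec‖ ^ 2) / (N : ℝ) ^ 2) z ^ (1 - θ / 2) ≤ f := fun q h => by
    rw [hf, hZ]
    exact logL_rpow_le_of_large hN h hz (by linarith)
  -- Truncation at 0 costs nothing, since the lattice sums are nonnegative, and makes the diagonal
  -- symbol bounded.
  refine tsum_le_tsum_creation φ (C := 1 / lam) (CD := 2 / (c * f))
    (Cs := Real.pi ^ 2 * (c' * (1 / f * logL (lam / (N : ℝ) ^ 2) z ^ (1 - θ / 2))))
    (s := fun q => max 0 (Real.pi ^ 2 * (c' * (1 / f *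
      (logL ((lam + 1 / 2 * ∑ i, ‖(q i).vec‖ ^ 2) / (N : ℝ) ^ 2) z ^ (1 - θ / 2) - f)))))
    (lowerSymbol_nonneg hlam hz0 hG) (fun k => (hDC k).1) (fun k => (hDC k).2) (fun q => ?_)
    (fun σ q => ?_) (fun j b q hq _ => ?_) hφ (fun q _ => ?_)
  · have h2 := logL_rpow_le (θ := 1 - θ / 2) hlam hN hz0.le (by linarith) q
    have h3 := logL_rpow_nonneg (N := N) (θ := 1 - θ / 2) hlam hz0.le q
    have h4 := h3.trans h2
    rw [abs_of_nonneg (le_max_left _ _)]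
    refine max_le (by positivity) ?_
    gcongr
    linarith
  · rw [← sub_laplacian_eq, ← sub_laplacian_eq, laplacian_comp_perm]
  · refine max_le (tsum_nonneg fun l => mul_nonneg (cutoff_nonneg _ _ _)
      (lowerSymbol_nonneg hlam hz0 hG _)) ?_
    rcases le_or_gt (logL ((lam + 1 / 2 * ∑ i, ‖(q i).vec‖ ^ 2) / (N : ℝ) ^ 2) z ^ (1 - θ / 2)) f
      with hX | hX
    · refine le_trans ?_ (tsum_nonneg fun l => mul_nonneg (cutoff_nonneg _ _ _)
        (lowerSymbol_nonneg hlam hz0 hG _))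
      exact mul_nonpos_of_nonneg_of_nonpos (by positivity)
        (mul_nonpos_of_nonneg_of_nonpos hc'.le
          (mul_nonpos_of_nonneg_of_nonpos (by positivity) (by linarith)))
    · refine le_tsum_lowerSymbol_of_small hw hlam hz hθ hθ1 hZ hf hZw hc hε hε1 hη hcc hq j b
        hX.le ?_
      by_contra hlt
      exact absurd (hlarge q (not_le.mp hlt).le) (not_le.mpr hX)
  · unfold evenSymbol
    refine evenSymbol_le hf0 hG rfl hc'.le herr hc0
      (Finset.sum_nonneg fun i _ => sq_nonneg _) (sum_inner_sq_le w q)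
      (Finset.sum_nonneg fun i _ => sq_nonneg _) (Finset.sum_le_sum fun b _ => bandSq_le w N (q b)) fun hX => ?_
    refine sum_bandSq_eq fun b => ?_
    by_contra hlt
    refine absurd (hlarge q ?_) (not_le.mpr hX)
    have h2 : ‖(q b).vec‖ ^ 2 ≤ ∑ i, ‖(q i).vec‖ ^ 2 :=
      Finset.single_le_sum (f := fun i => ‖(q i).vec‖ ^ 2) (fun i _ => sq_nonneg _)
        (Finset.mem_univ b)
    have h3 : (N : ℝ) ^ 2 ≤ ‖(q b).vec‖ ^ 2 :=
      pow_le_pow_left₀ hN'.le (not_le.mp hlt).le 2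
    have h4 : 0 ≤ (N : ℝ) ^ 2 := sq_nonneg _
    linarith

end lower

/-! ### The induction -/

section induction

variable {w : EuclideanSpace ℝ (Fin 2)} {N : ℕ} {lam K δ : ℝ}

theorem odd_mult_apply (c : ℝ) (k n : ℕ) (q : Fin n → Mode) :
    (c • (-skewLaplacian w * opS K δ lam N (2 * k + 3) +
      ofNumber (fCoeff K δ (2 * k + 3)) * -laplacian)) n q =
      oddSymbol w N lam (zCoeff K δ (2 * k + 3) n) (theta (2 * k + 3))
        (fCoeff K δ (2 * k + 3) n) c q := by
  have h1 : Odd (2 * k + 3) := ⟨k + 1, by ring⟩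
  have h2 : opS K δ lam N (2 * k + 3) n q = fCoeff K δ (2 * k + 3) n *
      logL ((lam + 1 / 2 * ∑ i, ‖(q i).vec‖ ^ 2) / (N : ℝ) ^ 2) (zCoeff K δ (2 * k + 3) n) ^
        theta (2 * k + 3) := by
    rw [opS, if_pos h1, logLk, sub_laplacian_eq]
  change c * (-(skewLaplacian w n q) * opS K δ lam N (2 * k + 3) n q +
    fCoeff K δ (2 * k + 3) n * -(laplacian n q)) = _
  rw [h2, skewLaplacian, laplacian, oddSymbol]
  ring

theorem even_mult_apply (h : ℕ → ℝ) (c : ℝ) (k n : ℕ) (q : Fin n → Mode) :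
    (c • (-skewLaplacian w * opS K δ lam N (2 * k + 2) - ofNumber h * -laplacian)) n q =
      evenSymbol w N lam (zCoeff K δ (2 * k + 2) n) (theta (2 * k + 2))
        (fCoeff K δ (2 * k + 2) n) c (h n) q := by
  have h1 : ¬ Odd (2 * k + 2) := by
    rw [Nat.not_odd_iff_even]
    exact ⟨k + 1, by ring⟩
  have h2 : opS K δ lam N (2 * k + 2) n q = 1 / fCoeff K δ (2 * k + 2) n *
      (logL ((lam + 1 / 2 * ∑ i, ‖(q i).vec‖ ^ 2) / (N : ℝ) ^ 2) (zCoeff K δ (2 * k + 2) n) ^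
        theta (2 * k + 2) - fCoeff K δ (2 * k + 2) n) := by
    rw [opS, if_neg h1, logLk, sub_laplacian_eq]
  change c * (-(skewLaplacian w n q) * opS K δ lam N (2 * k + 2) n q -
    h n * -(laplacian n q)) = _
  rw [h2, skewLaplacian, laplacian, evenSymbol]
  ring

theorem opLE_iff {H : ∀ n : ℕ, chaos n →L[ℂ] chaos n} {g : FourierMult} :
    OpLE H g ↔ ∀ (n : ℕ) (φ : chaos n), Summable (fun q => g n q * ‖(φ : L2Seq n) q‖ ^ 2) →
      (inner ℂ (H n φ) φ).re ≤ ∑' q, g n q * ‖(φ : L2Seq n) q‖ ^ 2 := by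
  refine forall_congr' fun n => forall_congr' fun φ => imp_congr Iff.rfl ?_
  rw [fockInner, ← Complex.ofReal_natCast, Complex.re_ofReal_mul, FourierMult.form]
  exact mul_le_mul_iff_right₀ (by exact_mod_cast n.factorial_pos)

theorem opGE_iff {H : ∀ n : ℕ, chaos n →L[ℂ] chaos n} {g : FourierMult} :
    OpGE H g ↔ ∀ (n : ℕ) (φ : chaos n), Summable (fun q => g n q * ‖(φ : L2Seq n) q‖ ^ 2) →
      ∑' q, g n q * ‖(φ : L2Seq n) q‖ ^ 2 ≤ (inner ℂ (H n φ) φ).re := by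
  refine forall_congr' fun n => forall_congr' fun φ => imp_congr Iff.rfl ?_
  rw [fockInner, ← Complex.ofReal_natCast, Complex.re_ofReal_mul, FourierMult.form]
  exact mul_le_mul_iff_right₀ (by exact_mod_cast n.factorial_pos)

theorem one_div_rpow_le_one (hδ : 0 < δ) {x : ℝ} (hx : 1 ≤ x) :
    0 ≤ 1 / x ^ (1 + δ) ∧ 1 / x ^ (1 + δ) ≤ 1 := by
  have h := Real.one_le_rpow hx (by linarith : 0 ≤ 1 + δ)
  exact ⟨by positivity, by rw [div_le_one (by linarith)]; exact h⟩

theorem opLE_of_opGE (hw : 0 < ‖w‖) (hK : baseConst ‖w‖ ^ (3 / 2 : ℝ) ≤ K) (hδ : 0 < δ)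
    (hlam : 0 < lam) (hN : 0 < N) {k : ℕ}
    (h : OpGE (opH w N lam (2 * k + 2)) (cCoeff w δ (2 * k + 2) •
      (-skewLaplacian w * opS K δ lam N (2 * k + 2) -
        ofNumber (fun n => 1 / ((n : ℝ) + k) ^ (1 + δ)) * -laplacian))) :
    OpLE (opH w N lam (2 * k + 3)) (cCoeff w δ (2 * k + 3) •
      (-skewLaplacian w * opS K δ lam N (2 * k + 3) +
        ofNumber (fCoeff K δ (2 * k + 3)) * -laplacian)) := by
  rw [opGE_iff] at h
  intro n φ hφ
  have h' := h (n + 1)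
  simp only [even_mult_apply, zCoeff_succ, fCoeff_succ] at h'
  rw [FourierMult.InFormDomain] at hφ
  rw [FourierMult.form, fockInner_opH]
  simp only [odd_mult_apply] at hφ ⊢
  obtain ⟨hz1, hz2⟩ := one_le_zCoeff hw hK hδ (k := 2 * k + 3) (by omega) n
  have hb := le_zCoeff_rpow_self hw hK hδ (k := 2 * k + 3) (by omega) n
  obtain ⟨hb1, -, -, hb4, -⟩ := baseConst_ge hw
  have hf : fCoeff K δ (2 * k + 3) n = 3 * zCoeff K δ (2 * k + 3) n ^ (2 / 3 : ℝ) := rfl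
  obtain ⟨hc0, hc⟩ := cCoeff_even_bounds (w := w) hw hδ k
  -- The hypothesis is used on chaos n + 1, so the base of the power is at least 1 even for n = k =
  -- 0.
  have hnu := one_div_rpow_le_one hδ (x := ((n + 1 : ℕ) : ℝ) + k) (by
    push_cast
    linarith [(Nat.cast_nonneg n : (0 : ℝ) ≤ n), (Nat.cast_nonneg k : (0 : ℝ) ≤ k)])
  have hn : 216 * ((n : ℝ) * (n + 1)) ≤ fCoeff K δ (2 * k + 3) n := by
    have hn0 : (0 : ℝ) ≤ n := Nat.cast_nonneg n
    have hk0 : (0 : ℝ) ≤ k := Nat.cast_nonneg k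
    have h1 : (n : ℝ) * (n + 1) ≤ ((n : ℝ) + (2 * k + 3 : ℕ)) ^ (3 + δ) := by
      push_cast
      calc (n : ℝ) * (n + 1) ≤ ((n : ℝ) + (2 * k + 3)) ^ 2 := by nlinarith
        _ = ((n : ℝ) + (2 * k + 3)) ^ (2 : ℝ) := (Real.rpow_two _).symm
        _ ≤ _ := Real.rpow_le_rpow_of_exponent_le (by linarith) (by linarith)
    have h2 := le_zCoeff_rpow hw hK (2 * k + 3) n h1 (by positivity)
    have h3 : 100 * ((n : ℝ) * (n + 1)) ≤ baseConst ‖w‖ * ((n : ℝ) * (n + 1)) := by gcongr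
    have h4 : 0 ≤ (n : ℝ) * (n + 1) := by positivity
    linarith
  have hth := theta_even k
  exact resolvent_creation_le hw hlam hN (by linarith) hth.1 (by linarith) (by linarith) hc0 hc
    (cCoeff_even_lt_one hw hδ k).le hnu.1 hnu.2 (le_cCoeff_odd hw hδ k)
    (one_lt_cCoeff_odd hw hδ k).le (by linarith) hn (opH_resolvent w N hlam (2 * k + 2) (n + 1))
    h' φ hφ

theorem opGE_of_opLE (hw : 0 < ‖w‖) (hK : baseConst ‖w‖ ^ (3 / 2 : ℝ) ≤ K) (hδ : 0 < δ)
    (hlam : 0 < lam) (hN : 0 < N) {k : ℕ}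
    (h : OpLE (opH w N lam (2 * k + 3)) (cCoeff w δ (2 * k + 3) •
      (-skewLaplacian w * opS K δ lam N (2 * k + 3) +
        ofNumber (fCoeff K δ (2 * k + 3)) * -laplacian))) :
    OpGE (opH w N lam (2 * (k + 1) + 2)) (cCoeff w δ (2 * (k + 1) + 2) •
      (-skewLaplacian w * opS K δ lam N (2 * (k + 1) + 2) -
        ofNumber (fun n => 1 / ((n : ℝ) + (k + 1 : ℕ)) ^ (1 + δ)) * -laplacian)) := by
  rw [opLE_iff] at h
  intro n φ hφ
  have h' := h (n + 1)
  simp only [odd_mult_apply, zCoeff_succ, fCoeff_succ] at h'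
  rw [FourierMult.InFormDomain] at hφ
  rw [FourierMult.form, show 2 * (k + 1) + 2 = (2 * k + 1) + 3 by ring, fockInner_opH]
  rw [show (2 * k + 1) + 3 = 2 * (k + 1) + 2 by ring]
  simp only [even_mult_apply] at hφ ⊢
  obtain ⟨hz1, hz2⟩ := one_le_zCoeff hw hK hδ (k := 2 * k + 4) (by omega) n
  have hb := le_zCoeff_rpow_self hw hK hδ (k := 2 * k + 4) (by omega) n
  obtain ⟨hb1, hb2, hb3, -, hb5⟩ := baseConst_ge hw
  have hf : fCoeff K δ (2 * k + 4) n = 3 * zCoeff K δ (2 * k + 4) n ^ (2 / 3 : ℝ) := rfl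
  have hn0 : (0 : ℝ) ≤ n := Nat.cast_nonneg n
  have hk0 : (0 : ℝ) ≤ k := Nat.cast_nonneg k
  have hε0 := epsCoeff_pos (δ := δ) k
  have hε1 := epsCoeff_le hδ k
  have hcc := cCoeff_odd_mul_even (w := w) hw hδ k
  have hc := one_lt_cCoeff_odd (w := w) hw hδ k
  have hc' := (cCoeff_even_bounds (w := w) hw hδ (k + 1)).1
  -- The anisotropy error decays like 1/f, faster than the allowed ε of order (k+1)^(-(1+δ)).
  have hη : (1 + 6 / ‖w‖ ^ 2) / fCoeff K δ (2 * k + 4) n ≤ epsCoeff δ k := by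
    have h1 : ((k : ℝ) + 1) ^ (1 + δ) ≤ ((n : ℝ) + (2 * k + 4 : ℕ)) ^ (3 + δ) := by
      push_cast
      calc ((k : ℝ) + 1) ^ (1 + δ) ≤ ((n : ℝ) + (2 * k + 4)) ^ (1 + δ) :=
            Real.rpow_le_rpow (by linarith) (by linarith) (by linarith)
        _ ≤ _ := Real.rpow_le_rpow_of_exponent_le (by linarith) (by linarith)
    have h0 : 0 < ((k : ℝ) + 1) ^ (1 + δ) := by positivity
    have h2 := le_zCoeff_rpow hw hK (2 * k + 4) n h1 h0.le
    have h3 : (1 + 6 / ‖w‖ ^ 2) * ((k : ℝ) + 1) ^ (1 + δ) ≤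
        baseConst ‖w‖ * ((k : ℝ) + 1) ^ (1 + δ) := by gcongr
    unfold epsCoeff
    rw [div_le_div_iff₀ (by linarith) (by positivity)]
    have h4 : 0 ≤ (1 + 6 / ‖w‖ ^ 2) * ((k : ℝ) + 1) ^ (1 + δ) := by positivity
    linarith
  -- The product of consecutive constants is at least 1/(2π|w|) because ε ≤ 1/2, and 72π ≤ 240 = 3 ·
  -- 80 explains the 80ω³ in `baseConst`.
  have herr : 36 * ((n : ℝ) * (n + 1)) * ‖w‖ ^ 2 ≤
      cCoeff w δ (2 * k + 3) * cCoeff w δ (2 * k + 4) * fCoeff K δ (2 * k + 4) n *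
        (1 / ((n : ℝ) + (k + 1 : ℕ)) ^ (1 + δ)) := by
    push_cast
    have hpow : 0 < ((n : ℝ) + (k + 1)) ^ (1 + δ) := by positivity
    have h1 : (n : ℝ) * (n + 1) * ((n : ℝ) + (k + 1)) ^ (1 + δ) ≤
        ((n : ℝ) + (2 * k + 4 : ℕ)) ^ (3 + δ) := by
      push_cast
      calc (n : ℝ) * (n + 1) * ((n : ℝ) + (k + 1)) ^ (1 + δ)
          ≤ ((n : ℝ) + (2 * k + 4)) ^ 2 * ((n : ℝ) + (2 * k + 4)) ^ (1 + δ) := by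
            gcongr
            · nlinarith
            · linarith
            · linarith
        _ = ((n : ℝ) + (2 * k + 4)) ^ (2 : ℝ) * ((n : ℝ) + (2 * k + 4)) ^ (1 + δ) := by
            rw [Real.rpow_two]
        _ = ((n : ℝ) + (2 * k + 4)) ^ (3 + δ) := by
            rw [← Real.rpow_add (by positivity)]
            ring_nf
    have h2 := le_zCoeff_rpow hw hK (2 * k + 4) n h1 (by positivity)
    have h3 : 1 / (2 * Real.pi * ‖w‖) ≤ cCoeff w δ (2 * k + 3) * cCoeff w δ (2 * k + 4) := by
      rw [hcc]
      have h4 : 1 / 3 ≤ (1 - epsCoeff δ k) / (1 + epsCoeff δ k) := by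
        rw [div_le_div_iff₀ (by norm_num) (by linarith)]
        linarith
      have hpi := Real.pi_pos
      calc 1 / (2 * Real.pi * ‖w‖) = 3 / (2 * Real.pi * ‖w‖) * (1 / 3) := by ring
        _ ≤ _ := by gcongr
    have h5 : 240 * ‖w‖ ^ 3 * ((n : ℝ) * (n + 1) * ((n : ℝ) + (k + 1)) ^ (1 + δ)) ≤
        fCoeff K δ (2 * k + 4) n := by
      have : 80 * ‖w‖ ^ 3 * ((n : ℝ) * (n + 1) * ((n : ℝ) + (k + 1)) ^ (1 + δ)) ≤
          baseConst ‖w‖ * ((n : ℝ) * (n + 1) * ((n : ℝ) + (k + 1)) ^ (1 + δ)) := by gcongr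
      linarith
    rw [mul_one_div, le_div_iff₀ hpow]
    generalize ((n : ℝ) + (k + 1)) ^ (1 + δ) = P at *
    have hpi := Real.pi_pos
    have hpi' := Real.pi_lt_d2
    calc 36 * ((n : ℝ) * (n + 1)) * ‖w‖ ^ 2 * P
        = 1 / (2 * Real.pi * ‖w‖) * (72 * Real.pi * ‖w‖ ^ 3 * ((n : ℝ) * (n + 1) * P)) := by
          field_simp
          ring
      _ ≤ 1 / (2 * Real.pi * ‖w‖) * (240 * ‖w‖ ^ 3 * ((n : ℝ) * (n + 1) * P)) := by
          gcongr
          linarith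
      _ ≤ 1 / (2 * Real.pi * ‖w‖) * fCoeff K δ (2 * k + 4) n := by gcongr
      _ ≤ _ := by
          have : 0 ≤ fCoeff K δ (2 * k + 4) n := by linarith
          gcongr
  have hth := theta_odd k
  exact le_resolvent_creation hw hlam hN hz2 hth.1 hth.2 rfl hf (by linarith) hc.le hc' hε0 hε1 hη
    hcc herr (opH_isPositive w N hlam (2 * k + 3) (n + 1)) (opH_resolvent w N hlam (2 * k + 3) (n + 1))
    h' φ hφ

theorem opGE_two (hw : 0 < ‖w‖) (hK : baseConst ‖w‖ ^ (3 / 2 : ℝ) ≤ K) (hδ : 0 < δ) :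
    OpGE (opH w N lam (2 * 0 + 2)) (cCoeff w δ (2 * 0 + 2) •
      (-skewLaplacian w * opS K δ lam N (2 * 0 + 2) -
        ofNumber (fun n => 1 / ((n : ℝ) + (0 : ℕ)) ^ (1 + δ)) * -laplacian)) := by
  rw [opGE_iff]
  intro n φ _
  have e : (inner ℂ (opH w N lam (2 * 0 + 2) n φ) φ).re = 0 := by
    change (inner ℂ (0 : chaos n) φ).re = 0
    rw [inner_zero_left, Complex.zero_re]
  rw [e]
  refine tsum_nonpos fun q => mul_nonpos_of_nonpos_of_nonneg ?_ (sq_nonneg _)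
  rw [even_mult_apply]
  have hb := le_zCoeff_rpow_self hw hK hδ (k := 2 * 0 + 2) (by omega) n
  have hb1 := (baseConst_ge hw).1
  have hf : fCoeff K δ (2 * 0 + 2) n = 3 * zCoeff K δ (2 * 0 + 2) n ^ (2 / 3 : ℝ) := rfl
  have hth : theta (2 * 0 + 2) = 0 := rfl
  have hc := (cCoeff_even_bounds (w := w) hw hδ 0).1
  -- For n = 0 this reads 1/0 = 0; the sums over modes are empty there anyway.
  have hnu : 0 ≤ 1 / ((n : ℝ) + (0 : ℕ)) ^ (1 + δ) := by positivity
  have hS := half_sum_norm_sq_nonneg q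
  have hA : 0 ≤ 1 / 2 * ∑ i, (inner ℝ w (q i).vec) ^ 2 := by positivity
  unfold evenSymbol
  rw [hth, Real.rpow_zero]
  refine mul_nonpos_of_nonneg_of_nonpos hc.le ?_
  have hf1 : 1 ≤ fCoeff K δ (2 * 0 + 2) n := by linarith
  have h1 : 1 / fCoeff K δ (2 * 0 + 2) n * (1 - fCoeff K δ (2 * 0 + 2) n) ≤ 0 :=
    mul_nonpos_of_nonneg_of_nonpos (by positivity) (by linarith)
  have h2 := mul_nonpos_of_nonneg_of_nonpos hA h1
  have h3 := mul_nonneg hnu hS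
  linarith

theorem opGE_even (hw : 0 < ‖w‖) (hK : baseConst ‖w‖ ^ (3 / 2 : ℝ) ≤ K) (hδ : 0 < δ)
    (hlam : 0 < lam) (hN : 0 < N) (k : ℕ) :
    OpGE (opH w N lam (2 * k + 2)) (cCoeff w δ (2 * k + 2) •
      (-skewLaplacian w * opS K δ lam N (2 * k + 2) -
        ofNumber (fun n => 1 / ((n : ℝ) + k) ^ (1 + δ)) * -laplacian)) := by
  induction k with
  | zero => exact opGE_two hw hK hδ
  | succ k ih => exact opGE_of_opLE hw hK hδ hlam hN (opLE_of_opGE hw hK hδ hlam hN ih)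

end induction

end Burgers

end

open Burgers in
theorem theorem4p3 :
    Filter.Tendsto theta Filter.atTop (nhds (2 / 3)) ∧
    ∀ ω : ℝ, 0 < ω → ∃ K₀ : ℝ, 0 < K₀ ∧ ∀ K : ℝ, K₀ ≤ K →
      ∀ w : EuclideanSpace ℝ (Fin 2), ‖w‖ = ω →
      ∀ δ : ℝ, 0 < δ → δ < 1 →
      ∀ lam : ℝ, 0 < lam → ∀ N : ℕ, 0 < N → ∀ k : ℕ,
        OpLE (opH w N lam (2 * k + 3))
          (cCoeff w δ (2 * k + 3) •
            (-skewLaplacian w * opS K δ lam N (2 * k + 3) +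
              ofNumber (fCoeff K δ (2 * k + 3)) * -laplacian)) ∧
        OpGE (opH w N lam (2 * k + 2))
          (cCoeff w δ (2 * k + 2) •
            (-skewLaplacian w * opS K δ lam N (2 * k + 2) -
              ofNumber (fun n => 1 / ((n : ℝ) + k) ^ (1 + δ)) * -laplacian)) ∧
        1 < cCoeff w δ (2 * k + 3) ∧ cCoeff w δ (2 * k + 2) < 1 := by
  -- The power 3/2 undoes the 2/3 in f = 3 z^(2/3).
  refine ⟨tendsto_theta, fun ω hω => ⟨baseConst ω ^ (3 / 2 : ℝ), ?_, ?_⟩⟩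
  · exact Real.rpow_pos_of_pos (by linarith [(baseConst_ge hω).1]) _
  · rintro K hK w rfl δ hδ - lam hlam N hN k
    have h := opGE_even hω hK hδ hlam hN k
    exact ⟨opLE_of_opGE hω hK hδ hlam hN h, h, one_lt_cCoeff_odd hω hδ k, cCoeff_even_lt_one hω hδ k⟩
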